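/- All graphs are finite and simple; $G+H$ denotes disjoint union, $tH$ the disjoint union of $t$ copies of $H$, $P_k$ the path on $k$ vertices, $K_k$ the complete graph on $k$ vertices, $\overline{K}_k$ the graph with $k$ vertices and no edges, and $\alpha'(G)$ the matching number of $G$. A graph $G$ is $H$-saturated if it contains no copy of $H$ as a subgraph, but adding to $G$ any edge of its complement creates a copy of $H$. Let $\mathrm{sat}(n,H)$ be the minimum number of edges of an $H$-saturated graph on $n$ vertices, and $\mathrm{Sat}(n,H)$ the set of $H$-saturated graphs on $n$ vertices with $\mathrm{sat}(n,H)$ edges. The fan $F_i$ consists of $i$ triangles sharing exactly one common vertex; its order is $2i+1$. **Theorem.** Let $n$ and $t$ be positive integers with $n\ge \frac{14}{5}t+27$. (1) $\mathrm{sat}(n,P_7+tP_2)=\min\{3t+25,\; n-\lfloor \frac{n}{14}\rfloor\}$. (2) If $n>\frac{14}{13}(3t+25)$, then $\mathrm{Sat}(n,P_7+tP_2)$ consists, up to isomorphism, exactly of the graphs $$K_8+cK_3+F+\overline{K}_{n-3c-|F|-8},$$ where $c\ge 0$ is an integer, $F$ is a (possibly empty) disjoint union of fans of order at least $7$, and $\alpha'(cK_3+F)=t-1$.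 If $n=\frac{14}{13}(3t+25)$, then these graphs are, up to isomorphism, exactly the members of $\mathrm{Sat}(n,P_7+tP_2)$ that have an isolated vertex. -/

import Mathlib

namespace LinearForestSat

open SimpleGraph

/-- `tH`: the disjoint union of `t` copies of the graph `H`. -/
def copies {V : Type*} (t : ℕ) (H : SimpleGraph V) : SimpleGraph (Fin t × V) where
  Adj a b := a.1 = b.1 ∧ H.Adj a.2 b.2
  symm := ⟨fun _ _ h => ⟨h.1.symm, h.2.symm⟩⟩
  loopless := ⟨fun _ h => h.2.ne rfl⟩

/-- `P_7 + tP_2`: the disjoint union of a path on seven vertices and `t` paths on two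
vertices. -/
abbrev p7tp2 (t : ℕ) : SimpleGraph (Fin 7 ⊕ (Fin t × Fin 2)) :=
  pathGraph 7 ⊕g copies t (pathGraph 2)

/-- `G` is `H`-saturated: `G` contains no copy of `H` (as a not necessarily induced subgraph),
but adding to `G` any edge of its complement creates a copy of `H`. -/
def IsSaturated {V W : Type*} (H : SimpleGraph W) (G : SimpleGraph V) : Prop :=
  ¬ H ⊑ G ∧ ∀ u v : V, u ≠ v → ¬ G.Adj u v → H ⊑ (G ⊔ edge u v)

/-- The numbers of edges of the `H`-saturated graphs on `n` vertices. -/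
def saturatedSizes {W : Type*} (n : ℕ) (H : SimpleGraph W) : Set ℕ :=
  {m | ∃ G : SimpleGraph (Fin n), IsSaturated H G ∧ G.edgeSet.ncard = m}

/-- The saturation number `sat(n, H)`. -/
noncomputable def satNumber {W : Type*} (n : ℕ) (H : SimpleGraph W) : ℕ :=
  sInf (saturatedSizes n H)

/-- `Sat(n, H)`: the `H`-saturated graphs on `n` vertices with exactly `sat(n, H)` edges. -/
def minSaturated {W : Type*} (n : ℕ) (H : SimpleGraph W) : Set (SimpleGraph (Fin n)) :=
  {G | IsSaturated H G ∧ G.edgeSet.ncard = satNumber n H}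

/-- The matching number `α'(G)` (for a finite graph `G`). -/
noncomputable def matchingNumber {V : Type*} (G : SimpleGraph V) : ℕ :=
  sSup {m | ∃ M : G.Subgraph, M.IsMatching ∧ M.edgeSet.ncard = m}

/-- The vertices of the fan with `i` triangles: `none` is the common vertex, and
`some (j, 0)`, `some (j, 1)` are the two other vertices of the `j`-th triangle. -/
abbrev FanVertex (i : ℕ) : Type := Option (Fin i × Fin 2)

/-- The fan `F_i`: `i` triangles sharing exactly one common vertex. -/
def fan (i : ℕ) : SimpleGraph (FanVertex i) where
  Adj
    | none, none => False
    | none, some _ => True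
    | some _, none => True
    | some a, some b => a.1 = b.1 ∧ a.2 ≠ b.2
  symm := ⟨by
    rintro (_ | a) (_ | b) h
    · exact h
    · trivial
    · trivial
    · exact ⟨h.1.symm, h.2.symm⟩⟩
  loopless := ⟨by
    rintro (_ | a) h
    · exact h
    · exact h.2 rfl⟩

/-- The disjoint union of the fans `F_{k 0}, …, F_{k (f - 1)}` (empty if `f = 0`). -/
def fanUnion {f : ℕ} (k : Fin f → ℕ) : SimpleGraph (Σ j : Fin f, FanVertex (k j)) where
  Adj a b := ∃ (j : Fin f) (u v : FanVertex (k j)),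
    (fan (k j)).Adj u v ∧ a = ⟨j, u⟩ ∧ b = ⟨j, v⟩
  symm := ⟨by
    rintro _ _ ⟨j, u, v, h, rfl, rfl⟩
    exact ⟨j, v, u, h.symm, rfl, rfl⟩⟩
  loopless := ⟨by
    rintro _ ⟨j, u, v, h, rfl, h2⟩
    simp only [Sigma.mk.injEq, heq_eq_eq, true_and] at h2
    exact h.ne h2⟩

/-- `G` is isomorphic to `K_8 + cK_3 + F + mK_1`, where `c, m ≥ 0` and `F` is a (possibly empty)
disjoint union of fans of order at least `7` with `α'(cK_3 + F) = t - 1` (written without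
subtraction). For `G` on `n` vertices, `m` is necessarily `n - 3c - |F| - 8`. -/
def IsK8K3FanGraph {V : Type*} (t : ℕ) (G : SimpleGraph V) : Prop :=
  ∃ (c f : ℕ) (k : Fin f → ℕ) (m : ℕ),
    (∀ j, 7 ≤ Fintype.card (FanVertex (k j))) ∧
    matchingNumber (copies c (completeGraph (Fin 3)) ⊕g fanUnion k) + 1 = t ∧
    Nonempty (G ≃g
      (completeGraph (Fin 8) ⊕g
        ((copies c (completeGraph (Fin 3)) ⊕g fanUnion k) ⊕g emptyGraph (Fin m))))

end LinearForestSat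

/-! Copies of `P_7 + tP_2` are handled as a path on seven vertices together with a disjoint matching
of `t` edges. A new edge either becomes one of the single edges (`EdgeCase`) or lies on the path
(`Split`). Saturated graphs are then separated by their number of isolated vertices.

Two or more isolated vertices (`Sat.large_of_isolated`). The matching number is at least `t + 2`. If
it equals `t + 2`, removing the added edge shows that every nonadjacent pair is missed by a common
maximum matching, so by Gallai's lemma all components are complete; two of them have at least seven
vertices, which costs too many edges (`Sat.large_of_card_eq`). Otherwise a path on seven vertices
that touches only three edges of a maximum matching is forbidden. This forces the vertices missed by
some maximum matching to form a union of components (`Sat.missable_of_adj`); in Gallai–Edmonds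
terms, the separating set is empty. Each of these components is complete on at most five vertices or
a fan (`exists_isFan`), so no path on seven vertices meets them. The remaining vertices form a set
`X` with a perfect matching. If the matching number were at least `t + 4`, `X` would contain no path
on seven vertices either (`NoShort.length_lt`); hence it is `t + 3`, and counting vertices shows
that `X` is a clique of even order at least 8. Covered vertices outside `X` have degree at least two
and one neighbour missed by the matching, so twice the number of edges is at least `8 * 7 + 3 * (2 *
t - 2)`. Equality leaves only an 8-clique with triangles, larger fans and isolated vertices
(`Mill`). Conversely each such graph is saturated (`Mill.sat`).

Exactly one isolated vertex. All other degrees are at least two, so there are at least `n - 1`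
edges, more than `n - n / 14`.

No isolated vertex (`Sat.large_of_no_isolated`). Fewer than `n - n / 14` edges would mean more than
`n / 14` tree components. A tree is a star or has, near the end of a longest path, a vertex all but
one of whose neighbours carry only leaves (`Tip`); at most one tree is a star. If the graph contains
a path on seven vertices, its matching number is at most `t + 5`, while each tree with a tip
accounts for five matching edges. If it contains none, there is no star and each tree has at least
fourteen vertices. Both counts are contradictory.

The value `n - n / 14` is attained by a forest of `n / 14` trees, each with two adjacent roots, two
further neighbours at each root, and at least two leaves at each of those (`BroomVertex.sat`). -/

namespace LinearForestSat

open SimpleGraph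
open scoped Classical

variable {V W : Type*} {G G' : SimpleGraph V} {M N : Finset (Sym2 V)} {l : List V} {t : ℕ}

/-! ### Matchings as finite edge sets, and paths with a disjoint matching -/

/-- `v` is not covered by the edge set `M`. -/
def Uncov (M : Finset (Sym2 V)) (v : V) : Prop := ∀ e ∈ M, v ∉ e

/-- `M` is a matching of `G`, as a finite set of pairwise disjoint edges. -/
structure IsMatch (G : SimpleGraph V) (M : Finset (Sym2 V)) : Prop where
  sub : ∀ e ∈ M, e ∈ G.edgeSet
  disj : ∀ e ∈ M, ∀ f ∈ M, ∀ v, v ∈ e → v ∈ f → e = f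

/-- `l` lists the vertices of a path of `G`, and `M` is a matching of `G` avoiding it. -/
structure Forest (G : SimpleGraph V) (l : List V) (M : Finset (Sym2 V)) : Prop where
  chain : l.IsChain G.Adj
  nodup : l.Nodup
  isMatch : IsMatch G M
  avoid : ∀ v ∈ l, Uncov M v

/-- `G` contains `P_7 + tP_2`. -/
def HasForest (G : SimpleGraph V) (t : ℕ) : Prop :=
  ∃ l M, Forest G l M ∧ l.length = 7 ∧ M.card = t

lemma uncov_iff {v : V} : Uncov M v ↔ ∀ w, s(v, w) ∉ M := by
  constructor
  · intro h w hw
    exact h _ hw (Sym2.mem_mk_left v w)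
  · intro h e he hv
    obtain ⟨w, rfl⟩ := Sym2.mem_iff_exists.1 hv
    exact h w he

lemma not_uncov_iff {v : V} : ¬ Uncov M v ↔ ∃ w, s(v, w) ∈ M := by
  rw [uncov_iff]; push Not; rfl

lemma Uncov.mono {v : V} (h : Uncov M v) (hN : N ⊆ M) : Uncov N v := fun e he => h e (hN he)

namespace IsMatch

lemma adj (h : IsMatch G M) {a b : V} (hab : s(a, b) ∈ M) : G.Adj a b := h.sub _ hab

lemma eq_right (h : IsMatch G M) {a b c : V} (hb : s(a, b) ∈ M) (hc : s(a, c) ∈ M) : b = c := by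
  exact Sym2.congr_right.1 (h.disj _ hb _ hc a (Sym2.mem_mk_left _ _) (Sym2.mem_mk_left _ _))

lemma subset (h : IsMatch G M) (hN : N ⊆ M) : IsMatch G N :=
  ⟨fun e he => h.sub e (hN he), fun e he f hf => h.disj e (hN he) f (hN hf)⟩

lemma mono (h : IsMatch G M) (hG : G ≤ G') : IsMatch G' M :=
  ⟨fun e he => edgeSet_mono hG (h.sub e he), h.disj⟩

lemma empty : IsMatch G ∅ := ⟨by simp, by simp⟩

lemma insert (h : IsMatch G M) {a b : V} (hab : G.Adj a b) (ha : Uncov M a) (hb : Uncov M b) :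
    IsMatch G (insert s(a, b) M) := by
  refine ⟨fun e he => ?_, fun e he f hf v hve hvf => ?_⟩
  · rcases Finset.mem_insert.1 he with rfl | he
    · exact hab
    · exact h.sub e he
  · rcases Finset.mem_insert.1 he with rfl | he' <;> rcases Finset.mem_insert.1 hf with rfl | hf'
    · rfl
    · rcases Sym2.mem_iff.1 hve with h1 | h1
      · exact absurd (h1 ▸ hvf) (ha f hf')
      · exact absurd (h1 ▸ hvf) (hb f hf')
    · rcases Sym2.mem_iff.1 hvf with h1 | h1
      · exact absurd (h1 ▸ hve) (ha e he')
      · exact absurd (h1 ▸ hve) (hb e he')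
    · exact h.disj e he' f hf' v hve hvf

lemma union (h : IsMatch G M) (h' : IsMatch G N) (hd : ∀ e ∈ M, ∀ v ∈ e, Uncov N v) :
    IsMatch G (M ∪ N) := by
  refine ⟨fun e he => ?_, fun e he f hf v hve hvf => ?_⟩
  · rcases Finset.mem_union.1 he with he | he
    · exact h.sub e he
    · exact h'.sub e he
  · rcases Finset.mem_union.1 he with he | he <;> rcases Finset.mem_union.1 hf with hf | hf
    · exact h.disj e he f hf v hve hvf
    · exact absurd hvf (hd e he v hve f hf)
    · exact absurd hve (hd f hf v hvf e he)
    · exact h'.disj e he f hf v hve hvf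

end IsMatch

lemma disjoint_of_uncov (hd : ∀ e ∈ M, ∀ v ∈ e, Uncov N v) : Disjoint M N := by
  rw [Finset.disjoint_left]
  intro e he hN
  induction e with
  | _ a b => exact hd _ he a (Sym2.mem_mk_left _ _) _ hN (Sym2.mem_mk_left _ _)

lemma Uncov.notMem {a b : V} (h : Uncov M a) : s(a, b) ∉ M := uncov_iff.1 h b

lemma card_insert_uncov {a b : V} (h : Uncov M a) : (insert s(a, b) M).card = M.card + 1 :=
  Finset.card_insert_of_notMem h.notMem

lemma uncov_insert {a b v : V} : Uncov (insert s(a, b) M) v ↔ (v ≠ a ∧ v ≠ b) ∧ Uncov M v := by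
  simp [Uncov]

lemma IsMatch.uncov_erase_left (h : IsMatch G M) {a b : V} (hab : s(a, b) ∈ M) :
    Uncov (M.erase s(a, b)) a := by
  intro e he ha
  rw [Finset.mem_erase] at he
  exact he.1 (h.disj _ he.2 _ hab a ha (Sym2.mem_mk_left _ _))

lemma IsMatch.uncov_erase_right (h : IsMatch G M) {a b : V} (hab : s(a, b) ∈ M) :
    Uncov (M.erase s(a, b)) b := by
  rw [Sym2.eq_swap] at hab ⊢
  exact h.uncov_erase_left hab

/-- Initial segments of paths and subsets of matchings may be taken, so only lower bounds on the two
sizes ever need to be checked. -/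
lemma Forest.hasForest (h : Forest G l M) (hl : 7 ≤ l.length) (hM : t ≤ M.card) :
    HasForest G t := by
  obtain ⟨N, hN, hc⟩ := Finset.exists_subset_card_eq hM
  refine ⟨l.take 7, N, ⟨h.chain.take 7, h.nodup.sublist (List.take_sublist 7 l),
    h.isMatch.subset hN, fun v hv => (h.avoid v (List.mem_of_mem_take hv)).mono hN⟩, ?_, hc⟩
  simp [hl]

/-- Removing from a matching the edges in a set that contains all edges touched by a path. -/
lemma IsMatch.hasForest_of_touch (h : IsMatch G M) (hc : l.IsChain G.Adj) (hn : l.Nodup)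
    (hl : 7 ≤ l.length) (S : Finset (Sym2 V)) (hS : ∀ v ∈ l, ∀ w, s(v, w) ∈ M → s(v, w) ∈ S)
    (hcard : t + S.card ≤ M.card) : HasForest G t := by
  refine Forest.hasForest (M := M \ S) ⟨hc, hn, h.subset Finset.sdiff_subset, ?_⟩ hl ?_
  · intro v hv
    rw [uncov_iff]
    intro w hw
    rw [Finset.mem_sdiff] at hw
    exact hw.2 (hS v hv w hw.1)
  · have := Finset.le_card_sdiff S M
    omega

lemma isChain_reverse_adj {l : List V} : l.reverse.IsChain G.Adj ↔ l.IsChain G.Adj := by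
  rw [List.isChain_reverse]
  constructor <;> exact fun h => h.imp fun _ _ h => h.symm

/-- Joining two paths leaving the ends of an edge. -/
lemma isChain_join {u v : V} {p q : List V} (huv : G.Adj u v) (hp : (u :: p).IsChain G.Adj)
    (hq : (v :: q).IsChain G.Adj) : ((u :: p).reverse ++ v :: q).IsChain G.Adj := by
  rw [List.isChain_append]
  refine ⟨isChain_reverse_adj.2 hp, hq, ?_⟩
  intro x hx y hy
  simp at hx hy
  subst hx hy
  exact huv

/-- A vertex of a path with at least two vertices has a neighbour on it. -/
lemma exists_adj_of_mem_chain (hc : l.IsChain G.Adj) (hl : 2 ≤ l.length) {v : V} (hv : v ∈ l) :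
    ∃ w ∈ l, G.Adj v w := by
  obtain ⟨a, b, rfl⟩ := List.append_of_mem hv
  rcases b with _ | ⟨c, b⟩
  · rcases List.eq_nil_or_concat a with rfl | ⟨a, d, rfl⟩
    · simp at hl
    · refine ⟨d, by simp, ?_⟩
      rw [List.isChain_append] at hc
      exact (hc.2.2 d (by simp) v (by simp)).symm
  · refine ⟨c, by simp, ?_⟩
    rw [List.isChain_append] at hc
    exact (List.isChain_cons_cons.1 hc.2.1).1

/-! ### The graph `P_7 + tP_2` -/

lemma hasForest_iff {t : ℕ} : p7tp2 t ⊑ G ↔ HasForest G t := by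
  constructor
  · rintro ⟨f⟩
    have hinj := f.injective'
    have hadj : ∀ a b, (p7tp2 t).Adj a b → G.Adj (f a) (f b) := fun a b h => f.toHom.map_rel h
    have hinj' : ∀ a b, f a = f b → a = b := fun a b h => hinj h
    let e : Fin t → Sym2 V := fun i => s(f (Sum.inr (i, 0)), f (Sum.inr (i, 1)))
    have hmem : ∀ i v, v ∈ e i → ∃ j, v = f (Sum.inr (i, j)) := by
      intro i v hv
      rcases Sym2.mem_iff.1 hv with rfl | rfl
      · exact ⟨0, rfl⟩
      · exact ⟨1, rfl⟩
    have hdis : ∀ i j v, v ∈ e i → v ∈ e j → i = j := by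
      intro i j v hi hj
      obtain ⟨a, rfl⟩ := hmem i v hi
      obtain ⟨b, hb⟩ := hmem j _ hj
      have := hinj' _ _ hb
      simp at this
      exact this.1
    have heinj : Function.Injective e := by
      intro i j hij
      refine hdis i j (f (Sum.inr (i, 0))) (Sym2.mem_mk_left _ _) ?_
      rw [← hij]
      exact Sym2.mem_mk_left _ _
    refine ⟨List.ofFn (fun i : Fin 7 => f (Sum.inl i)), Finset.univ.image e,
      ⟨?_, ?_, ⟨?_, ?_⟩, ?_⟩, by simp, ?_⟩
    · rw [List.isChain_ofFn]
      intro i hi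
      apply hadj
      simp [pathGraph_adj]
    · rw [List.nodup_ofFn]
      intro i j hij
      simpa using hinj' _ _ hij
    · intro x hx
      obtain ⟨i, -, rfl⟩ := Finset.mem_image.1 hx
      apply hadj
      simp [copies, pathGraph_adj]
    · intro x hx y hy v hv hv'
      obtain ⟨i, -, rfl⟩ := Finset.mem_image.1 hx
      obtain ⟨j, -, rfl⟩ := Finset.mem_image.1 hy
      rw [hdis i j v hv hv']
    · intro v hv x hx hvx
      obtain ⟨i, -, rfl⟩ := Finset.mem_image.1 hx
      obtain ⟨k, rfl⟩ := (List.mem_ofFn' _ _).1 hv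
      obtain ⟨j, hj⟩ := hmem _ _ hvx
      have := hinj' _ _ hj
      simp at this
    · rw [Finset.card_image_of_injective _ heinj]
      simp
  · rintro ⟨l, M, h, hl, hM⟩
    let φ : Fin t ≃ M := (finCongr hM.symm).trans M.equivFin.symm
    have hrep : ∀ i : Fin t, ∃ a b, (φ i : Sym2 V) = s(a, b) := by
      intro i
      induction (φ i : Sym2 V) with
      | _ a b => exact ⟨a, b, rfl⟩
    choose a b hab using hrep
    have habM : ∀ i, s(a i, b i) ∈ M := fun i => hab i ▸ (φ i).2
    let r : Fin t × Fin 2 → V := fun x => if x.2 = 0 then a x.1 else b x.1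
    have hr : ∀ x, r x ∈ s(a x.1, b x.1) := by
      intro x
      by_cases hx : x.2 = 0 <;> simp [r, hx]
    let g : Fin 7 ⊕ (Fin t × Fin 2) → V := Sum.elim (fun i => l[i.1]'(by omega)) r
    have hne : ∀ i, a i ≠ b i := fun i => (h.isMatch.adj (habM i)).ne
    refine ⟨⟨⟨g, ?_⟩, ?_⟩⟩
    · rintro (i | ⟨i, i'⟩) (j | ⟨j, j'⟩) hij
      · simp [pathGraph_adj] at hij
        have hc := List.isChain_iff_getElem.1 h.chain
        rcases hij with hij | hij
        · have := hc i.1 (by omega)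
          simpa [g, hij] using this
        · have := hc j.1 (by omega)
          simpa [g, hij] using this.symm
      · simp at hij
      · simp at hij
      · simp [copies, pathGraph_adj] at hij
        obtain ⟨rfl, hij⟩ := hij
        have := h.isMatch.adj (habM i)
        fin_cases i' <;> fin_cases j' <;> simp [g, r] at hij ⊢
        · exact this
        · exact this.symm
    · rintro (i | x) (j | y) hij
      · simp only [g] at hij
        change l[i.1]'_ = l[j.1]'_ at hij
        rw [h.nodup.getElem_inj_iff] at hij
        rw [Fin.ext hij]
      · exfalso
        change l[i.1]'_ = r y at hij
        exact h.avoid _ (List.getElem_mem _) _ (habM y.1) (hij ▸ hr y)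
      · exfalso
        change r x = l[j.1]'_ at hij
        exact h.avoid _ (List.getElem_mem _) _ (habM x.1) (hij ▸ hr x)
      · change r x = r y at hij
        have h1 := h.isMatch.disj _ (habM x.1) _ (habM y.1) (r x) (hr x) (hij ▸ hr y)
        rw [← hab, ← hab] at h1
        have h2 : x.1 = y.1 := φ.injective (Subtype.ext h1)
        obtain ⟨i, i'⟩ := x
        obtain ⟨j, j'⟩ := y
        simp only at h2
        subst h2
        have := hne i
        fin_cases i' <;> fin_cases j' <;> simp [r] at hij ⊢
        · exact this hij
        · exact this hij.symm

/-! ### The two roles of an added edge -/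

/-- The added edge `uv` is one of the copies of `P_2`. -/
def EdgeCase (G : SimpleGraph V) (t : ℕ) (u v : V) : Prop :=
  ∃ l M, Forest G l M ∧ l.length = 7 ∧ M.card + 1 = t ∧ u ∉ l ∧ v ∉ l ∧ Uncov M u ∧ Uncov M v

/-- The added edge `uv` lies on the copy of `P_7`; the lists `p` and `q` continue the path
beyond `u` and `v`. -/
structure Split (G : SimpleGraph V) (t : ℕ) (u v : V) (p q : List V) (M : Finset (Sym2 V)) :
    Prop where
  left : (u :: p).IsChain G.Adj
  right : (v :: q).IsChain G.Adj
  nodup : ((u :: p) ++ v :: q).Nodup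
  length : p.length + q.length = 5
  isMatch : IsMatch G M
  card : M.card = t
  avoid : ∀ w ∈ (u :: p) ++ v :: q, Uncov M w

lemma Split.symm {u v : V} {p q : List V} (h : Split G t u v p q M) : Split G t v u q p M where
  left := h.right
  right := h.left
  nodup := List.nodup_append_comm.1 h.nodup
  length := by have := h.length; omega
  isMatch := h.isMatch
  card := h.card
  avoid := fun w hw => h.avoid w (by simp only [List.mem_append] at hw ⊢; tauto)

lemma exists_bad_step {R S : V → V → Prop} (h : l.IsChain R) (h' : ¬ l.IsChain S) :
    ∃ a b x y, l = a ++ x :: y :: b ∧ R x y ∧ ¬ S x y := by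
  induction l with
  | nil => simp at h'
  | cons x l ih =>
    cases l with
    | nil => simp at h'
    | cons y l =>
      rw [List.isChain_cons_cons] at h h'
      by_cases hS : S x y
      · obtain ⟨a, b, x', y', h1, h2⟩ := ih h.2 (fun h3 => h' ⟨hS, h3⟩)
        exact ⟨x :: a, b, x', y', by rw [h1]; rfl, h2⟩
      · exact ⟨[], l, x, y, rfl, h.1, hS⟩

lemma isChain_of_sup_edge {u v : V} (h : l.IsChain (G ⊔ edge u v).Adj) (hu : u ∉ l ∨ v ∉ l) :
    l.IsChain G.Adj := by
  by_contra h'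
  obtain ⟨a, b, x, y, rfl, h1, h2⟩ := exists_bad_step h h'
  rw [sup_adj, edge_adj] at h1
  grind

lemma isMatch_of_sup_edge {u v : V} (h : IsMatch (G ⊔ edge u v) M) (hu : s(u, v) ∉ M) :
    IsMatch G M := by
  refine ⟨fun e he => ?_, h.disj⟩
  have := h.sub e he
  induction e with
  | _ a b =>
    rw [mem_edgeSet, sup_adj, edge_adj] at this
    rcases this with h1 | ⟨⟨rfl, rfl⟩ | ⟨rfl, rfl⟩, -⟩
    · exact h1
    · exact absurd he hu
    · exact absurd (Sym2.eq_swap ▸ he) hu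

/-- If the new edge is not in the matching, the path must use it, since otherwise the forest already
lies in `G`. Cutting the path at that step gives the two halves. -/
lemma add_cases (h : ¬ HasForest G t) {u v : V} (h' : HasForest (G ⊔ edge u v) t) :
    EdgeCase G t u v ∨ ∃ p q M, Split G t u v p q M := by
  obtain ⟨l, M, hF, hl, hM⟩ := h'
  by_cases huv : s(u, v) ∈ M
  · left
    have hu : u ∉ l := fun hu => hF.avoid u hu _ huv (Sym2.mem_mk_left _ _)
    have hv : v ∉ l := fun hv => hF.avoid v hv _ huv (Sym2.mem_mk_right _ _)
    refine ⟨l, M.erase s(u, v), ⟨isChain_of_sup_edge hF.chain (Or.inl hu), hF.nodup,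
      isMatch_of_sup_edge (hF.isMatch.subset (Finset.erase_subset _ _)) (by simp),
      fun w hw => (hF.avoid w hw).mono (Finset.erase_subset _ _)⟩, hl, ?_, hu, hv,
      hF.isMatch.uncov_erase_left huv, hF.isMatch.uncov_erase_right huv⟩
    rw [Finset.card_erase_of_mem huv]
    have := Finset.card_pos.2 ⟨_, huv⟩
    omega
  · right
    have hMG := isMatch_of_sup_edge hF.isMatch huv
    have hc : ¬ l.IsChain G.Adj := fun hc =>
      h ⟨l, M, ⟨hc, hF.nodup, hMG, hF.avoid⟩, hl, hM⟩
    obtain ⟨a, b, x, y, rfl, h1, h2⟩ := exists_bad_step hF.chain hc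
    have hn := hF.nodup
    have key : Split G t x y a.reverse b M := by
      have hch := hF.chain
      rw [List.isChain_append_cons_cons] at hch
      have hxy : (x = u ∧ y = v) ∨ (x = v ∧ y = u) := by
        rw [sup_adj, edge_adj] at h1
        tauto
      refine ⟨?_, ?_, ?_, ?_, hMG, hM, ?_⟩
      · have : (a ++ [x]).IsChain G.Adj := by
          apply isChain_of_sup_edge hch.1
          grind
        rw [← isChain_reverse_adj] at this
        simpa using this
      · apply isChain_of_sup_edge hch.2.2
        grind
      · grind
      · simp at hl ⊢
        omega
      · intro w hw
        apply hF.avoid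
        simp at hw ⊢
        tauto
    rw [sup_adj, edge_adj] at h1
    rcases h1 with h1 | ⟨⟨rfl, rfl⟩ | ⟨rfl, rfl⟩, -⟩
    · exact absurd h1 h2
    · exact ⟨_, _, _, key⟩
    · exact ⟨_, _, _, key.symm⟩

/-- `G` is saturated with respect to `P_7 + tP_2`. -/
structure Sat (G : SimpleGraph V) (t : ℕ) : Prop where
  free : ¬ HasForest G t
  add : ∀ u v, u ≠ v → ¬ G.Adj u v → HasForest (G ⊔ edge u v) t

lemma isSaturated_iff : IsSaturated (p7tp2 t) G ↔ Sat G t := by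
  unfold IsSaturated
  simp only [hasForest_iff]
  exact ⟨fun h => ⟨h.1, h.2⟩, fun h => ⟨h.1, h.2⟩⟩

lemma Sat.cases (h : Sat G t) {u v : V} (huv : u ≠ v) (hadj : ¬ G.Adj u v) :
    EdgeCase G t u v ∨ ∃ p q M, Split G t u v p q M :=
  add_cases h.free (h.add u v huv hadj)

/-! ### Vertices of small degree in saturated graphs -/

/-- A covered vertex all of whose neighbours are uncovered does not exist. -/
lemma IsMatch.uncov_of_adj (h : IsMatch G M) {v : V} (hv : ∀ w, G.Adj v w → Uncov M w) :
    Uncov M v := by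
  rw [uncov_iff]
  intro w hw
  exact hv w (h.adj hw) _ hw (Sym2.mem_mk_right _ _)

/-- The forest minus the new edge avoids `x` and `z`, hence also `y`, whose neighbours are among
them. So `xy` can take the place of the new edge. -/
lemma EdgeCase.hasForest_of_adj {x y z : V} (h : EdgeCase G t x z) (hxy : G.Adj x y)
    (hy : ∀ w, G.Adj y w → w = x ∨ w = z) : HasForest G t := by
  obtain ⟨l, M, hF, hl, hM, hx, hz, hMx, hMz⟩ := h
  have hyl : y ∉ l := by
    intro hyl
    obtain ⟨w, hw, hyw⟩ := exists_adj_of_mem_chain hF.chain (by omega) hyl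
    rcases hy w hyw with rfl | rfl
    · exact hx hw
    · exact hz hw
  have hMy : Uncov M y := hF.isMatch.uncov_of_adj fun w hw => by
    rcases hy w hw with rfl | rfl <;> assumption
  refine ⟨l, insert s(x, y) M, ⟨hF.chain, hF.nodup, hF.isMatch.insert hxy hMx hMy, ?_⟩, hl, ?_⟩
  · intro v hv
    rw [uncov_insert]
    exact ⟨⟨fun h => hx (h ▸ hv), fun h => hyl (h ▸ hv)⟩, hF.avoid v hv⟩
  · rw [card_insert_uncov hMx, hM]

/-- In a path leaving `x`, a vertex whose neighbours are among `x` and a vertex off the path is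
the only further vertex. -/
lemma eq_singleton_of_mem {x y z : V} {p : List V} (hc : (x :: p).IsChain G.Adj)
    (hn : (x :: p).Nodup) (hz : z ∉ p) (hy : ∀ w, G.Adj y w → w = x ∨ w = z) (hyp : y ∈ p) :
    p = [y] := by
  obtain ⟨a, b, rfl⟩ := List.append_of_mem hyp
  have hb : b = [] := by
    rcases b with _ | ⟨c, b⟩
    · rfl
    · have h1 : (y :: c :: b).IsChain G.Adj := (List.isChain_append.1 (List.isChain_of_isChain_cons hc)).2.1
      have := hy c (List.isChain_cons_cons.1 h1).1
      grind
  subst hb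
  rcases List.eq_nil_or_concat a with rfl | ⟨a, d, rfl⟩
  · rfl
  · exfalso
    have hc' : (a.concat d ++ [y]).IsChain G.Adj := List.isChain_of_isChain_cons hc
    rw [List.isChain_append] at hc'
    have := hy d (hc'.2.2 d (by simp) y (by simp)).symm
    grind

/-- The two neighbours of a vertex of degree two are adjacent. -/
lemma Sat.adj_of_degree_two (h : Sat G t) {x y z : V} (hxz : x ≠ z) (hyx : G.Adj y x)
    (hyz : G.Adj y z) (hy : ∀ w, G.Adj y w → w = x ∨ w = z) : G.Adj x z := by
  by_contra hadj
  rcases h.cases hxz hadj with hA | ⟨p, q, M, hS⟩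
  · exact h.free (hA.hasForest_of_adj hyx.symm hy)
  · have hMy : Uncov M y := hS.isMatch.uncov_of_adj fun w hw => by
      rcases hy w hw with rfl | rfl <;> exact hS.avoid _ (by simp)
    have hn := hS.nodup
    have hlen := hS.length
    have hav := hS.avoid
    have hl := hS.left
    have hr := hS.right
    -- a path ending in `y` next to `x` and continuing from `z`
    have key : ∀ {x z : V} {q : List V}, G.Adj y x → G.Adj y z → (z :: q).IsChain G.Adj →
        ([x, y] ++ z :: q).Nodup → q.length = 4 → (∀ w ∈ [x, y] ++ z :: q, Uncov M w) →
        HasForest G t := by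
      intro x z q hyx hyz hq hn hlen hav
      refine Forest.hasForest (M := M) (l := [x, y] ++ z :: q) ⟨?_, hn, hS.isMatch, hav⟩ ?_
        hS.card.ge
      · simp only [List.cons_append, List.nil_append, List.isChain_cons_cons]
        exact ⟨hyx.symm, hyz, hq⟩
      · simp [hlen]
    -- If `y` is used at all, it is the only vertex of the path beyond `x` (or beyond `z`); moving
    -- it between `x` and `z` removes the need for the new edge.
    by_cases hyp : y ∈ p
    · have hp := eq_singleton_of_mem hl (by grind) (by grind) hy hyp
      subst hp
      refine h.free (key hyx hyz hr ?_ ?_ ?_)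
      · simpa using hn
      · simp at hlen; omega
      · simpa using hav
    by_cases hyq : y ∈ q
    · have hq := eq_singleton_of_mem hr (by grind) (by grind) (fun w hw => (hy w hw).symm) hyq
      subst hq
      refine h.free (key hyz hyx hl ?_ ?_ ?_)
      · grind
      · simp at hlen; omega
      · intro w hw
        apply hav
        simp at hw ⊢
        tauto
    -- Here `y` is free, and the detour through it replaces the new edge, giving a path on eight
    -- vertices.
    · refine h.free (Forest.hasForest (M := M) (l := (x :: p).reverse ++ (y :: z :: q))
        ⟨isChain_join hyx.symm hl (List.isChain_cons_cons.2 ⟨hyz, hr⟩), ?_, hS.isMatch, ?_⟩ ?_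
        hS.card.ge)
      · have h1 := hyx.ne
        have h2 := hyz.ne
        clear key
        simp only [List.nodup_append, List.nodup_cons, List.nodup_reverse, List.mem_reverse,
          List.mem_cons] at hn ⊢
        grind
      · intro w hw
        by_cases hwy : w = y
        · rwa [hwy]
        · apply hav
          simp at hw ⊢
          tauto
      · simp
        omega

/-- Adding an edge at an isolated vertex. -/
lemma Sat.cases_isolated (h : Sat G t) {u x : V} (hu : ∀ w, ¬ G.Adj u w) (hux : u ≠ x) :
    EdgeCase G t u x ∨ ∃ q M, Split G t u x [] q M := by
  rcases h.cases hux (hu x) with hA | ⟨p, q, M, hS⟩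
  · exact Or.inl hA
  · right
    rcases p with _ | ⟨a, p⟩
    · exact ⟨q, M, hS⟩
    · exact absurd (List.isChain_cons_cons.1 hS.left).1 (hu a)

/-- If there is an isolated vertex, then there is no vertex of degree one. -/
lemma Sat.exists_second_neighbour (h : Sat G t) {u x y : V} (hu : ∀ w, ¬ G.Adj u w)
    (hyx : G.Adj y x) : ∃ z, z ≠ x ∧ G.Adj y z := by
  by_contra! hcon
  have hy : ∀ w, G.Adj y w → w = x := fun w hw => by
    by_contra hne
    exact hcon w hne hw
  have hux : u ≠ x := by
    rintro rfl
    exact hu y hyx.symm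
  rcases h.cases_isolated hu hux with ⟨l, M, hF, hl, hM, hul, hxl, hMu, hMx⟩ | ⟨q, M, hS⟩
  · exact h.free (EdgeCase.hasForest_of_adj (z := u)
      ⟨l, M, hF, hl, hM, hxl, hul, hMx, hMu⟩ hyx.symm fun w hw => Or.inl (hy w hw))
  · have hMy : Uncov M y := hS.isMatch.uncov_of_adj fun w hw => by
      rw [hy w hw]
      exact hS.avoid _ (by simp)
    have hn := hS.nodup
    have hlen := hS.length
    have hyq : y ∉ q := by
      intro hyq
      have := eq_singleton_of_mem (z := u) hS.right (by grind) (by grind)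
        (fun w hw => Or.inl (hy w hw)) hyq
      simp [this] at hlen
    refine h.free (Forest.hasForest (M := M) (l := y :: x :: q)
      ⟨List.isChain_cons_cons.2 ⟨hyx, hS.right⟩, ?_, hS.isMatch, ?_⟩ ?_ hS.card.ge)
    · have := hyx.ne
      grind
    · intro w hw
      rcases List.mem_cons.1 hw with rfl | hw
      · exact hMy
      · exact hS.avoid w (by simp at hw ⊢; tauto)
    · simp at hlen ⊢
      omega

/-! ### Maximum matchings and the vertices they miss -/

/-- `M` is a maximum matching of `G`. -/
def MaxM (G : SimpleGraph V) (M : Finset (Sym2 V)) : Prop :=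
  IsMatch G M ∧ ∀ N, IsMatch G N → N.card ≤ M.card

/-- Some maximum matching does not cover `v`. -/
def Missable (G : SimpleGraph V) (v : V) : Prop := ∃ M, MaxM G M ∧ Uncov M v

/-- Some maximum matching covers neither `a` nor `b`. -/
def Joint (G : SimpleGraph V) (a b : V) : Prop := ∃ M, MaxM G M ∧ Uncov M a ∧ Uncov M b

lemma exists_maxM [Finite V] (G : SimpleGraph V) : ∃ M, MaxM G M := by
  have := Fintype.ofFinite V
  obtain ⟨M, hM, hmax⟩ := Finset.exists_max_image
    (Finset.univ.filter fun M : Finset (Sym2 V) => IsMatch G M) Finset.card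
    ⟨∅, by simp [IsMatch.empty]⟩
  simp only [Finset.mem_filter, Finset.mem_univ, true_and] at hM hmax
  exact ⟨M, hM, hmax⟩

lemma MaxM.card_eq (h : MaxM G M) (h' : MaxM G N) : M.card = N.card :=
  le_antisymm (h'.2 _ h.1) (h.2 _ h'.1)

lemma MaxM.not_adj (h : MaxM G M) {a b : V} (ha : Uncov M a) (hb : Uncov M b) :
    ¬ G.Adj a b := by
  intro hab
  have := h.2 _ (h.1.insert hab ha hb)
  rw [card_insert_uncov ha] at this
  omega

lemma MaxM.exists_mate (h : MaxM G M) {a b : V} (ha : Uncov M a) (hab : G.Adj a b) :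
    ∃ c, s(b, c) ∈ M := by
  by_contra! hcon
  exact h.not_adj ha (uncov_iff.2 hcon) hab

/-- Exchange the matching edge `aa'` for `da`. -/
noncomputable def swapM (M : Finset (Sym2 V)) (d a a' : V) : Finset (Sym2 V) :=
  insert s(d, a) (M.erase s(a, a'))

lemma mem_swapM_self {d a a' : V} : s(d, a) ∈ swapM M d a a' := Finset.mem_insert_self _ _

lemma mem_swapM {d a a' : V} {e : Sym2 V} (he : e ∈ M) (hne : e ≠ s(a, a')) :
    e ∈ swapM M d a a' :=
  Finset.mem_insert_of_mem (Finset.mem_erase.2 ⟨hne, he⟩)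

lemma uncov_swapM {d a a' v : V} (hv : Uncov M v) (hd : v ≠ d) (ha : v ≠ a) :
    Uncov (swapM M d a a') v :=
  uncov_insert.2 ⟨⟨hd, ha⟩, hv.mono (Finset.erase_subset _ _)⟩

lemma IsMatch.swap (h : IsMatch G M) {d a a' : V} (hd : Uncov M d) (hda : G.Adj d a)
    (haa : s(a, a') ∈ M) :
    IsMatch G (swapM M d a a') ∧ (swapM M d a a').card = M.card ∧ Uncov (swapM M d a a') a' := by
  have hd' : Uncov (M.erase s(a, a')) d := hd.mono (Finset.erase_subset _ _)
  refine ⟨(h.subset (Finset.erase_subset _ _)).insert hda hd' (h.uncov_erase_left haa), ?_, ?_⟩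
  · unfold swapM
    rw [card_insert_uncov hd', Finset.card_erase_of_mem haa]
    have := Finset.card_pos.2 ⟨_, haa⟩
    omega
  · unfold swapM
    rw [uncov_insert]
    refine ⟨⟨?_, (h.adj haa).ne'⟩, h.uncov_erase_right haa⟩
    rintro rfl
    exact hd _ haa (Sym2.mem_mk_right _ _)

lemma MaxM.swap (h : MaxM G M) {d a a' : V} (hd : Uncov M d) (hda : G.Adj d a)
    (haa : s(a, a') ∈ M) : MaxM G (swapM M d a a') ∧ Uncov (swapM M d a a') a' := by
  obtain ⟨h1, h2, h3⟩ := h.1.swap hd hda haa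
  exact ⟨⟨h1, fun N hN => h2 ▸ h.2 N hN⟩, h3⟩

/-- Deleting the three edges that the path can touch leaves at least `t` edges disjoint from it.
This is the only way in which the bound `t + 3` on the matching number is exploited locally. -/
lemma IsMatch.hasForest_of_three (h : IsMatch G M) (ht : t + 3 ≤ M.card) {a a' b b' c c' : V}
    (ha : s(a, a') ∈ M) (hb : s(b, b') ∈ M) (hc : s(c, c') ∈ M) (hl : l.IsChain G.Adj)
    (hn : l.Nodup) (hlen : 7 ≤ l.length)
    (hv : ∀ v ∈ l, v = a ∨ v = a' ∨ v = b ∨ v = b' ∨ v = c ∨ v = c' ∨ Uncov M v) :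
    HasForest G t := by
  refine h.hasForest_of_touch hl hn hlen {s(a, a'), s(b, b'), s(c, c')} ?_ ?_
  · intro v hvl w hw
    have key : ∀ {x y : V}, s(x, y) ∈ M → v = x ∨ v = y → s(v, w) = s(x, y) := by
      rintro x y hxy (rfl | rfl)
      · rw [h.eq_right hw hxy]
      · rw [Sym2.eq_swap] at hxy
        rw [h.eq_right hw hxy, Sym2.eq_swap]
    simp only [Finset.mem_insert, Finset.mem_singleton]
    rcases hv v hvl with hv | hv | hv | hv | hv | hv | hv
    · exact Or.inl (key ha (Or.inl hv))
    · exact Or.inl (key ha (Or.inr hv))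
    · exact Or.inr (Or.inl (key hb (Or.inl hv)))
    · exact Or.inr (Or.inl (key hb (Or.inr hv)))
    · exact Or.inr (Or.inr (key hc (Or.inl hv)))
    · exact Or.inr (Or.inr (key hc (Or.inr hv)))
    · exact absurd hw hv.notMem
  · have := Finset.card_le_three (a := s(a, a')) (b := s(b, b')) (c := s(c, c'))
    omega

lemma isChain_seven {a b c d e f g : V} (h1 : G.Adj a b) (h2 : G.Adj b c) (h3 : G.Adj c d)
    (h4 : G.Adj d e) (h5 : G.Adj e f) (h6 : G.Adj f g) :
    [a, b, c, d, e, f, g].IsChain G.Adj := by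
  simp [*]

/-- The edges of a path complete a disjoint matching. -/
lemma Forest.exists_match : ∀ {l : List V} {M : Finset (Sym2 V)}, Forest G l M →
    ∃ N, IsMatch G N ∧ N.card = M.card + l.length / 2 ∧ (∀ v ∉ l, Uncov M v → Uncov N v) ∧
      (∀ v, Uncov N v → Uncov M v) ∧ (Even l.length → ∀ v ∈ l, ¬ Uncov N v)
  | [], M, h => ⟨M, h.isMatch, by simp, by simp, by simp, by simp⟩
  | [a], M, h => ⟨M, h.isMatch, by simp, by simp, by simp, by simp⟩
  | a :: b :: l, M, h => by
    have hn := h.nodup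
    have hab := (List.isChain_cons_cons.1 h.chain).1
    have hF : Forest G l M := ⟨(h.chain.tail).tail, by grind, h.isMatch,
      fun v hv => h.avoid v (by simp [hv])⟩
    obtain ⟨N, h1, h2, h3, h4, h5⟩ := hF.exists_match
    have ha : Uncov N a := h3 a (by grind) (h.avoid a (by simp))
    have hb : Uncov N b := h3 b (by grind) (h.avoid b (by simp))
    refine ⟨insert s(a, b) N, h1.insert hab ha hb, ?_, ?_, ?_, ?_⟩
    · rw [card_insert_uncov ha, h2]
      simp only [List.length_cons]
      omega
    · intro v hv hvM
      rw [uncov_insert]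
      simp only [List.mem_cons, not_or] at hv
      exact ⟨⟨hv.1, hv.2.1⟩, h3 v hv.2.2 hvM⟩
    · intro v hv
      exact h4 v (uncov_insert.1 hv).2
    · intro he v hv hvN
      rw [uncov_insert] at hvN
      have he' : Even l.length := by
        simp only [List.length_cons] at he
        rw [Nat.even_iff] at he ⊢
        omega
      simp only [List.mem_cons] at hv
      rcases hv with hv | hv | hv
      · exact hvN.1.1 hv
      · exact hvN.1.2 hv
      · exact h5 he' v hv hvN.2

lemma Forest.sublist {l' : List V} (h : Forest G l M) (hl : l' <:+: l) : Forest G l' M :=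
  ⟨h.chain.infix hl, h.nodup.sublist hl.sublist, h.isMatch, fun v hv => h.avoid v (hl.mem hv)⟩

lemma HasForest.exists_match (h : HasForest G t) : ∃ N, IsMatch G N ∧ N.card = t + 3 := by
  obtain ⟨l, M, hF, hl, hM⟩ := h
  obtain ⟨N, h1, h2, -⟩ := hF.exists_match
  exact ⟨N, h1, by rw [h2, hl, hM]⟩

lemma IsMatch.erase_sup_edge {u v : V} (h : IsMatch (G ⊔ edge u v) M) :
    IsMatch G (M.erase s(u, v)) :=
  isMatch_of_sup_edge (h.subset (Finset.erase_subset _ _)) (by simp)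

/-- `P_7 + tP_2` contains `t + 3` disjoint edges, at most one of which is the new edge. -/
lemma Sat.two_le (h : Sat G t) (hM : MaxM G M) {u v : V} (huv : u ≠ v) (hadj : ¬ G.Adj u v) :
    t + 2 ≤ M.card := by
  obtain ⟨N, hN, hc⟩ := (h.add u v huv hadj).exists_match
  have h1 := hM.2 _ hN.erase_sup_edge
  have := Finset.pred_card_le_card_erase (s := N) (a := s(u, v))
  omega

/-- Three vertices with at most two neighbours together are not all covered. -/
lemma IsMatch.exists_uncov_of_three (h : IsMatch G N) {x y z r s : V} (hxy : x ≠ y) (hxz : x ≠ z)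
    (hyz : y ≠ z) (hx : ∀ w, G.Adj x w → w = s ∨ w = r) (hy : ∀ w, G.Adj y w → w = s ∨ w = r)
    (hz : ∀ w, G.Adj z w → w = s ∨ w = r) (hcx : ¬ Uncov N x) (hcy : ¬ Uncov N y)
    (hcz : ¬ Uncov N z) : False := by
  rw [not_uncov_iff] at hcx hcy hcz
  obtain ⟨a, ha⟩ := hcx
  obtain ⟨b, hb⟩ := hcy
  obtain ⟨c, hc⟩ := hcz
  have h1 := hx a (h.adj ha)
  have h2 := hy b (h.adj hb)
  have h3 := hz c (h.adj hc)
  have key : ∀ {p q w : V}, s(p, w) ∈ N → s(q, w) ∈ N → p = q := by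
    intro p q w hp hq
    rw [Sym2.eq_swap] at hp hq
    exact h.eq_right hp hq
  grind

/-- Add the edge `us`. If it is a matching edge, match up the first six path vertices: each of `x`,
`y`, `z` is then the last path vertex or matched to `r`, since otherwise it is free and can replace
`u`; two places do not suffice for three vertices. If `us` ends the path, the six vertices from `s`
on are matched up, and any of the three left uncovered could start the path instead of `u`; but
three vertices with only two possible mates cannot all be covered. -/
lemma Sat.not_three (h : Sat G t) {u : V} (hu : ∀ w, ¬ G.Adj u w) {x y z r s : V} (hxy : x ≠ y)
    (hxz : x ≠ z) (hyz : y ≠ z) (hxs : G.Adj x s) (hys : G.Adj y s) (hzs : G.Adj z s)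
    (hx : ∀ w, G.Adj x w → w = s ∨ w = r) (hy : ∀ w, G.Adj y w → w = s ∨ w = r)
    (hz : ∀ w, G.Adj z w → w = s ∨ w = r) : False := by
  have hus : u ≠ s := by
    rintro rfl
    exact hu x hxs.symm
  rcases h.cases_isolated hu hus with ⟨l, M, hF, hl, hM, hul, hsl, hMu, hMs⟩ | ⟨q, M, hS⟩
  · obtain ⟨l', a, rfl⟩ : ∃ l' a, l = l' ++ [a] := by
      rcases List.eq_nil_or_concat l with rfl | ⟨l', a, rfl⟩
      · simp at hl
      · exact ⟨l', a, by simp⟩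
    obtain ⟨N, h1, h2, h3, h4, h5⟩ :=
      (hF.sublist (l' := l') (List.prefix_append _ _).isInfix).exists_match
    have hlen : l'.length = 6 := by simpa using hl
    have hNs : Uncov N s := h3 s (fun hs => hsl (by simp [hs])) hMs
    have key : ∀ v, G.Adj v s → (∀ w, G.Adj v w → w = s ∨ w = r) → v = a ∨ s(v, r) ∈ N := by
      intro v hvs hv
      by_contra! hcon
      have hvN : Uncov N v := by
        by_contra hvN
        obtain ⟨w, hw⟩ := not_uncov_iff.1 hvN
        rcases hv w (h1.adj hw) with rfl | rfl
        · exact hNs _ hw (Sym2.mem_mk_right _ _)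
        · exact hcon.2 hw
      have hvl : v ∉ l' ++ [a] := by
        intro hvl
        rcases List.mem_append.1 hvl with hvl | hvl
        · exact h5 (by rw [hlen]; decide) v hvl hvN
        · exact hcon.1 (by simpa using hvl)
      refine h.free ⟨l' ++ [a], insert s(v, s) M, ⟨hF.chain, hF.nodup,
        hF.isMatch.insert hvs (h4 v hvN) hMs, ?_⟩, hl, ?_⟩
      · intro x hx
        rw [uncov_insert]
        exact ⟨⟨fun h => hvl (h ▸ hx), fun h => hsl (h ▸ hx)⟩, hF.avoid x hx⟩
      · rw [card_insert_uncov (h4 v hvN), hM]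
    have hk : ∀ {p q w : V}, s(p, w) ∈ N → s(q, w) ∈ N → p = q := by
      intro p q w hp hq
      rw [Sym2.eq_swap] at hp hq
      exact h1.eq_right hp hq
    have := key x hxs hx
    have := key y hys hy
    have := key z hzs hz
    grind
  · have hlen := hS.length
    have hF : Forest G (s :: q) M := ⟨hS.right, by have := hS.nodup; grind, hS.isMatch,
      fun v hv => hS.avoid v (by simp at hv ⊢; tauto)⟩
    obtain ⟨N, h1, h2, h3, h4, h5⟩ := hF.exists_match
    have hev : Even (s :: q).length := by
      simp at hlen ⊢
      rw [hlen]
      decide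
    have key : ∀ v, G.Adj v s → ¬ Uncov N v := by
      intro v hvs hvN
      have hvl : v ∉ s :: q := fun hv => h5 hev v hv hvN
      refine h.free (Forest.hasForest (M := M) (l := v :: s :: q)
        ⟨List.isChain_cons_cons.2 ⟨hvs, hF.chain⟩, List.nodup_cons.2 ⟨hvl, hF.nodup⟩, hF.isMatch,
          ?_⟩ ?_ hS.card.ge)
      · intro w hw
        rcases List.mem_cons.1 hw with rfl | hw
        · exact h4 _ hvN
        · exact hF.avoid w hw
      · simp at hlen ⊢
        omega
    exact h1.exists_uncov_of_three hxy hxz hyz hx hy hz (key x hxs) (key y hys) (key z hzs)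

/-! ### Missable vertices and Gallai's lemma -/

/-- In the presence of an isolated vertex, neighbours of missable vertices are missable. -/
lemma Sat.missable_of_adj (h : Sat G t) {u : V} (hu : ∀ w, ¬ G.Adj u w)
    (hm : ∀ M, MaxM G M → t + 3 ≤ M.card) {d s : V} (hd : Missable G d) (hds : G.Adj d s) :
    Missable G s := by
  by_contra hs
  -- The contradiction comes from `Sat.not_three`: the vertices `d`, `s'` and `r'` found below turn
  -- out to have no neighbours besides `s` and `r`, and all are adjacent to `s`. Any further edge
  -- yields either an exchange exposing `s` or a path on seven vertices touching only three matching
  -- edges.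
  have hs' : ∀ N, MaxM G N → ¬ Uncov N s := fun N hN hsN => hs ⟨N, hN, hsN⟩
  obtain ⟨M, hM, hdM⟩ := hd
  have hsw : ∀ {x y : V}, s(x, y) ∈ M → s(y, x) ∈ M := fun h => by rwa [Sym2.eq_swap]
  have huniq : ∀ {x y z : V}, s(x, y) ∈ M → s(x, z) ∈ M → y = z := fun h1 h2 => hM.1.eq_right h1 h2
  have huncov : ∀ {x : V}, s(d, x) ∉ M := hdM.notMem
  have hne : ∀ {x y : V}, s(x, y) ∈ M → x ≠ y := fun h => (hM.1.adj h).ne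
  have hadjne : ∀ {x y : V}, G.Adj x y → x ≠ y := fun h => h.ne
  obtain ⟨s', hss'⟩ := hM.exists_mate hdM hds
  have hss := hM.1.adj hss'
  have hds' : ¬ G.Adj d s' := fun hadj => by
    obtain ⟨h1, h2⟩ := hM.swap hdM hadj (hsw hss')
    exact hs' _ h1 h2
  obtain ⟨r, hrs, hdr⟩ := h.exists_second_neighbour hu hds
  obtain ⟨r', hrr'⟩ := hM.exists_mate hdM hdr
  have hrr := hM.1.adj hrr'
  have hrs' : r ≠ s' := by
    rintro rfl
    exact hds' hdr
  obtain ⟨hMr, hMr'⟩ := hM.swap hdM hdr hrr'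
  have hssr : s(s, s') ∈ swapM M d r r' := mem_swapM hss' (by
    rw [Ne, Sym2.eq_iff]
    grind)
  have hrs'' : r' ≠ s := fun h1 => by grind
  have hrs3 : r' ≠ s' := fun h1 => by grind
  have hdne : d ≠ s' ∧ d ≠ r' := by constructor <;> rintro rfl <;> grind
  have hds1 := hds.ne
  have hdr1 := hdr.ne
  have hss1 := hss.ne
  have hrr1 := hrr.ne
  -- `s'` has no neighbour besides `s` and `r`
  have hNs' : ∀ x, G.Adj s' x → x = s ∨ x = r := by
    intro x hx
    by_contra! hcon
    have hxd : x ≠ d := by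
      rintro rfl
      exact hds' hx.symm
    by_cases hxr' : x = r'
    · subst hxr'
      obtain ⟨h1, h2⟩ := hMr.swap hMr' hx.symm (Sym2.eq_swap ▸ hssr)
      exact hs' _ h1 h2
    by_cases hxM : Uncov M x
    · obtain ⟨h1, h2⟩ := hM.swap hdM hds hss'
      exact h1.not_adj h2 (uncov_swapM hxM hxd hcon.1) hx
    obtain ⟨x', hxx'⟩ := not_uncov_iff.1 hxM
    have hxx := hM.1.adj hxx'
    have := hxx.ne
    have := hx.ne
    refine h.free (hM.1.hasForest_of_three (hm M hM) hrr' hss' hxx'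
      (isChain_seven hrr.symm hdr.symm hds hss hx hxx : [r', r, d, s, s', x, x'].IsChain G.Adj)
      ?_ (by simp) (by simp [hdM]))
    simp only [List.nodup_cons, List.mem_cons, List.not_mem_nil]
    grind
  have hs'r : G.Adj s' r := by
    obtain ⟨z, hz, hz'⟩ := h.exists_second_neighbour hu hss.symm
    rcases hNs' z hz' with rfl | rfl
    · exact absurd rfl hz
    · exact hz'
  have hNr' : ∀ x, G.Adj r' x → x = s ∨ x = r := by
    intro x hx
    by_contra! hcon
    have hxs' : x ≠ s' := by
      rintro rfl
      have := hNs' _ hx.symm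
      grind
    by_cases hxd : x = d
    · subst hxd
      -- Two exchanges in succession: the first exposes `r`, the second replaces `s's` by `rs'` and
      -- so exposes `s`.
      obtain ⟨h1, h2⟩ := hM.swap hdM hx.symm (hsw hrr')
      have h3 : s(s', s) ∈ swapM M x r' r := mem_swapM (hsw hss') (by
        rw [Ne, Sym2.eq_iff]
        grind)
      obtain ⟨h4, h5⟩ := h1.swap h2 hs'r.symm h3
      exact hs' _ h4 h5
    by_cases hxM : Uncov M x
    · exact hMr.not_adj hMr' (uncov_swapM hxM hxd hcon.2) hx
    obtain ⟨x', hxx'⟩ := not_uncov_iff.1 hxM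
    have hxx := hM.1.adj hxx'
    have := hxx.ne
    have := hx.ne
    refine h.free (hM.1.hasForest_of_three (hm M hM) hrr' hss' hxx'
      (isChain_seven hxx.symm hx.symm hrr.symm hdr.symm hds hss :
        [x', x, r', r, d, s, s'].IsChain G.Adj)
      ?_ (by simp) (by simp [hdM]))
    simp only [List.nodup_cons, List.mem_cons, List.not_mem_nil]
    grind
  have hr's : G.Adj r' s := by
    obtain ⟨z, hz, hz'⟩ := h.exists_second_neighbour hu hrr.symm
    rcases hNr' z hz' with rfl | rfl
    · exact hz'
    · exact absurd rfl hz
  have hNd : ∀ x, G.Adj d x → x = s ∨ x = r := by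
    intro x hx
    by_contra! hcon
    have hxs' : x ≠ s' := by
      rintro rfl
      exact hds' hx
    have hxr' : x ≠ r' := by
      rintro rfl
      have := hNr' _ hx.symm
      grind
    obtain ⟨x', hxx'⟩ := hM.exists_mate hdM hx
    have hxx := hM.1.adj hxx'
    have := hxx.ne
    have := hx.ne
    refine h.free (hM.1.hasForest_of_three (hm M hM) hrr' hss' hxx'
      (isChain_seven hxx.symm hx.symm hdr hs'r.symm hss.symm hr's.symm :
        [x', x, d, r, s', s, r'].IsChain G.Adj)
      ?_ (by simp) (by simp [hdM]))
    simp only [List.nodup_cons, List.mem_cons, List.not_mem_nil]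
    grind
  exact h.not_three hu hdne.1 hdne.2 hrs3.symm hds hss.symm hr's hNd hNs' hNr'

/-- The vertices covered by an edge set. -/
noncomputable def cov (M : Finset (Sym2 V)) : Finset V := M.biUnion Sym2.toFinset

lemma mem_cov {v : V} : v ∈ cov M ↔ ¬ Uncov M v := by
  simp [cov, Uncov]

lemma notMem_cov {v : V} : v ∉ cov M ↔ Uncov M v := by rw [mem_cov, not_not]

lemma IsMatch.card_cov (h : IsMatch G M) : (cov M).card = 2 * M.card := by
  unfold cov
  rw [Finset.card_biUnion, Finset.sum_congr rfl (g := fun _ => 2), Finset.sum_const]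
  · simp [mul_comm]
  · intro e he
    exact Sym2.card_toFinset_of_not_isDiag e (G.not_isDiag_of_mem_edgeSet (h.sub e he))
  · intro e he f hf hef
    rw [Function.onFun, Finset.disjoint_left]
    intro v hv hv'
    rw [Sym2.mem_toFinset] at hv hv'
    exact hef (h.disj e he f hf v hv hv')

/-- Gallai's lemma: not being missed together is transitive through missable vertices. -/
lemma not_joint_trans [Finite V] {a b c : V} (hac : a ≠ c) (hb : Missable G b)
    (hab : ¬ Joint G a b) (hbc : ¬ Joint G b c) : ¬ Joint G a c := by
  have := Fintype.ofFinite V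
  rintro ⟨M, hM, haM, hcM⟩
  obtain ⟨N₀, hN₀⟩ := hb
  -- Among the maximum matchings missing `b`, take one that agrees with `M` in as many edges as
  -- possible.
  obtain ⟨N, hN, hmax⟩ := Finset.exists_max_image
    (Finset.univ.filter fun N : Finset (Sym2 V) => MaxM G N ∧ Uncov N b)
    (fun N => (M ∩ N).card) ⟨N₀, by simpa using hN₀⟩
  simp only [Finset.mem_filter, Finset.mem_univ, true_and, and_imp] at hN hmax
  obtain ⟨hN, hbN⟩ := hN
  have haN : a ∈ cov N := mem_cov.2 fun h => hab ⟨N, hN, h, hbN⟩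
  have hcN : c ∈ cov N := mem_cov.2 fun h => hbc ⟨N, hN, hbN, h⟩
  have hcard : (cov M \ cov N).card = (cov N \ cov M).card := by
    have h1 := Finset.card_sdiff_add_card_inter (cov M) (cov N)
    have h2 := Finset.card_sdiff_add_card_inter (cov N) (cov M)
    rw [Finset.inter_comm] at h2
    have h3 := hM.1.card_cov
    have h4 := hN.1.card_cov
    have h5 := hM.card_eq hN
    omega
  have h2 : 1 < (cov N \ cov M).card := by
    rw [Finset.one_lt_card]
    exact ⟨a, by simp [haN, notMem_cov.2 haM], c, by simp [hcN, notMem_cov.2 hcM], hac⟩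
  -- Since `N` covers `a` and `c`, and both matchings have the same size, some `x` other than `b` is
  -- covered by `M` only. Exchanging an edge of `N` for the `M`-edge at `x` still misses `b` but
  -- increases the agreement with `M`.
  obtain ⟨x, hx, hxb⟩ := Finset.exists_mem_ne (hcard ▸ h2) b
  rw [Finset.mem_sdiff, notMem_cov, mem_cov, not_uncov_iff] at hx
  obtain ⟨⟨y, hxy⟩, hxN⟩ := hx
  have hadj := hM.1.adj hxy
  obtain ⟨z, hyz⟩ := hN.exists_mate hxN hadj
  obtain ⟨h3, -⟩ := hN.swap hxN hadj hyz
  have hyb : y ≠ b := by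
    rintro rfl
    exact hbN _ hyz (Sym2.mem_mk_left _ _)
  have h4 := hmax _ h3 (uncov_swapM hbN hxb.symm hyb.symm)
  have hxz : x ≠ z := by
    rintro rfl
    exact hxN _ hyz (Sym2.mem_mk_right _ _)
  have h5 : insert s(x, y) (M ∩ N) ⊆ M ∩ swapM N x y z := by
    intro e he
    rw [Finset.mem_insert] at he
    rw [Finset.mem_inter]
    rcases he with rfl | he
    · exact ⟨hxy, mem_swapM_self⟩
    · rw [Finset.mem_inter] at he
      refine ⟨he.1, mem_swapM he.2 ?_⟩
      rintro rfl
      exact hxz (hM.1.eq_right (Sym2.eq_swap ▸ hxy) he.1)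
  have h6 := Finset.card_le_card h5
  rw [Finset.card_insert_of_notMem
    (fun h => hxN _ (Finset.mem_inter.1 h).2 (Sym2.mem_mk_left _ _))] at h6
  omega

lemma MaxM.not_joint_of_adj {a b : V} (h : G.Adj a b) : ¬ Joint G a b := by
  rintro ⟨M, hM, ha, hb⟩
  exact hM.not_adj ha hb h

/-- The missable vertices are closed under adjacency. -/
def MissClosed (G : SimpleGraph V) : Prop := ∀ d s, Missable G d → G.Adj d s → Missable G s

lemma MissClosed.missable (h : MissClosed G) {a b : V} (hr : G.Reachable a b)
    (ha : Missable G a) : Missable G b := by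
  obtain ⟨p⟩ := hr
  induction p with
  | nil => exact ha
  | cons hadj p ih => exact ih (h _ _ ha hadj)

/-- Adjacent vertices are never missed together, and Gallai's lemma carries this along a walk of
missable vertices. So a maximum matching misses at most one vertex of such a component. -/
lemma MissClosed.not_joint [Finite V] (h : MissClosed G) {a b : V} (hr : G.Reachable a b)
    (ha : Missable G a) (hab : a ≠ b) : ¬ Joint G a b := by
  obtain ⟨p⟩ := hr
  induction p with
  | nil => exact absurd rfl hab
  | @cons u v w hadj p ih =>
    by_cases hvw : v = w
    · subst hvw
      exact MaxM.not_joint_of_adj hadj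
    · have hv := h _ _ ha hadj
      exact not_joint_trans hab hv (MaxM.not_joint_of_adj hadj) (ih hv hvw)

lemma MissClosed.exists_mate [Finite V] (h : MissClosed G) {a b : V} (hr : G.Reachable a b)
    (hM : MaxM G M) (ha : Uncov M a) (hab : a ≠ b) : ∃ c, s(b, c) ∈ M := by
  rw [← not_uncov_iff]
  exact fun hb => h.not_joint hr ⟨M, hM, ha⟩ hab ⟨M, hM, ha, hb⟩

/-! ### Large components of missable vertices are fans -/

/-- The component of the centre `z` is a fan; `π` matches the vertices other than `z`. -/
def IsFan (G : SimpleGraph V) (z : V) (π : V → V) : Prop :=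
  ∀ y, G.Reachable z y → y ≠ z →
    π y ≠ z ∧ π y ≠ y ∧ π (π y) = y ∧ ∀ w, G.Adj y w ↔ w = z ∨ w = π y

lemma IsFan.length_le_two {z : V} {π : V → V} (h : IsFan G z π) (hc : l.IsChain G.Adj)
    (hn : l.Nodup) (hl : ∀ v ∈ l, G.Reachable z v) (hz : z ∉ l) : l.length ≤ 2 := by
  match l with
  | [] => simp
  | [_] => simp
  | [_, _] => simp
  | a :: b :: c :: l =>
    exfalso
    simp only [List.isChain_cons_cons] at hc
    have ha := h a (hl a (by simp)) (by grind)
    have hb := h b (hl b (by simp)) (by grind)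
    have h1 := (ha.2.2.2 b).1 hc.1
    have h2 := (hb.2.2.2 c).1 hc.2.1
    grind

/-- A path passes the centre at most once, and on either side of it stays within one pair. -/
lemma IsFan.length_le {z : V} {π : V → V} (h : IsFan G z π) (hc : l.IsChain G.Adj)
    (hn : l.Nodup) (hl : ∀ v ∈ l, G.Reachable z v) : l.length ≤ 5 := by
  by_cases hz : z ∈ l
  · obtain ⟨a, b, rfl⟩ := List.append_of_mem hz
    rw [List.isChain_append] at hc
    have h1 := h.length_le_two hc.1 (by grind) (fun v hv => hl v (by simp [hv])) (by grind)
    have h2 := h.length_le_two hc.2.1.tail (by grind)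
      (fun v hv => hl v (by simp at hv ⊢; tauto)) (by grind)
    simp at h2 ⊢
    omega
  · have := h.length_le_two hc hn hl hz
    omega

/-- The component of `z` does not fit into five vertices. -/
def Big (G : SimpleGraph V) (z : V) : Prop :=
  ∀ a b c d e : V, ∃ v, G.Reachable z v ∧ v ∉ [a, b, c, d, e]

lemma Big.of_reachable {z y : V} (h : Big G z) (hr : G.Reachable z y) : Big G y := by
  intro a b c d e
  obtain ⟨v, hv, hv'⟩ := h a b c d e
  exact ⟨v, hr.symm.trans hv, hv'⟩

lemma exists_adj_of_reachable {S : V → Prop} {a b : V} (hr : G.Reachable a b) (ha : S a)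
    (hb : ¬ S b) : ∃ x y, S x ∧ ¬ S y ∧ G.Adj x y ∧ G.Reachable a y := by
  obtain ⟨p⟩ := hr
  induction p with
  | nil => exact absurd ha hb
  | @cons u v w hadj p ih =>
    by_cases hv : S v
    · obtain ⟨x, y, h1, h2, h3, h4⟩ := ih hv hb
      exact ⟨x, y, h1, h2, h3, hadj.reachable.trans h4⟩
    · exact ⟨u, v, ha, hv, hadj, hadj.reachable⟩

section FactorCritical

variable [Finite V] (hF : ¬ HasForest G t) (hm : ∀ M, MaxM G M → t + 3 ≤ M.card)
  (hD : MissClosed G) {z : V}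

include hF hm hD

/-- A big component has an edge leaving the five-cycle, to a vertex `g` with mate `g'`. Starting at
`g'`, `g` and running once around the cycle gives seven vertices touching three matching edges; the
direction is chosen according to where the cycle is entered. -/
lemma not_five_cycle (hM : MaxM G M) (hz : Uncov M z) (hbig : Big G z) {p q r s : V}
    (hzp : G.Adj z p) (hpq : s(p, q) ∈ M) (hqr : G.Adj q r) (hrs : s(r, s) ∈ M)
    (hsz : G.Adj s z) (hpr : p ≠ r) (hps : p ≠ s) : False := by
  have hsw : ∀ {x y : V}, s(x, y) ∈ M → s(y, x) ∈ M := fun h => by rwa [Sym2.eq_swap]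
  have huniq : ∀ {x y z : V}, s(x, y) ∈ M → s(x, z) ∈ M → y = z := fun h1 h2 => hM.1.eq_right h1 h2
  have huncov : ∀ {x : V}, s(z, x) ∉ M := hz.notMem
  have hpq' := hM.1.adj hpq
  have hrs' := hM.1.adj hrs
  obtain ⟨v, hv, hv'⟩ := hbig z p q r s
  obtain ⟨x, g, hx, hg, hadj, hreach⟩ :=
    exists_adj_of_reachable (S := fun x => x ∈ [z, p, q, r, s]) hv (by simp) hv'
  simp only [List.mem_cons, List.not_mem_nil, or_false] at hx hg
  push Not at hg
  obtain ⟨g', hgg⟩ := hD.exists_mate hreach hM hz hg.1.symm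
  have hgg' := hM.1.adj hgg
  have h1 := hpq'.ne
  have h2 := hrs'.ne
  have h3 := hgg'.ne
  have h4 : z ≠ p := hzp.ne
  have h5 : z ≠ s := hsz.ne'
  have h6 : z ≠ q := by rintro rfl; exact huncov (hsw hpq)
  have h7 : z ≠ r := by rintro rfl; exact huncov hrs
  have h8 : z ≠ g' := by rintro rfl; exact huncov (hsw hgg)
  have h9 := hqr.ne
  have h10 : q ≠ s := by rintro rfl; exact hpr (huniq (hsw hpq) (hsw hrs))
  have h11 : g' ≠ p := by rintro rfl; exact hg.2.2.1 (huniq (hsw hgg) hpq)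
  have h12 : g' ≠ q := by rintro rfl; exact hg.2.1 (huniq (hsw hgg) (hsw hpq))
  have h13 : g' ≠ r := by rintro rfl; exact hg.2.2.2.2 (huniq (hsw hgg) hrs)
  have h14 : g' ≠ s := by rintro rfl; exact hg.2.2.2.1 (huniq (hsw hgg) (hsw hrs))
  have key : ∀ {a b c d e : V}, G.Adj g a → G.Adj a b → G.Adj b c → G.Adj c d → G.Adj d e →
      [a, b, c, d, e].Nodup → (∀ v ∈ [a, b, c, d, e], v ∈ [z, p, q, r, s]) → False := by
    intro a b c d e i1 i2 i3 i4 i5 hn hmem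
    refine hF (hM.1.hasForest_of_three (hm M hM) hpq hrs hgg
      (isChain_seven hgg'.symm i1 i2 i3 i4 i5) ?_ (by simp) ?_)
    · rw [List.nodup_cons, List.nodup_cons]
      refine ⟨?_, ?_, hn⟩
      · intro hmem'
        rw [List.mem_cons] at hmem'
        rcases hmem' with rfl | hmem'
        · exact h3 rfl
        · have := hmem _ hmem'
          simp at this
          grind
      · intro hmem'
        have := hmem _ hmem'
        simp at this
        grind
    · intro v hv
      rw [List.mem_cons, List.mem_cons] at hv
      rcases hv with hv | hv | hv
      · simp [hv]
      · simp [hv]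
      · have := hmem _ hv
        simp only [List.mem_cons, List.not_mem_nil, or_false] at this
        rcases this with h | h | h | h | h
        · simp [h, hz]
        all_goals simp [h]
  have hnd : ∀ {a b c d e : V}, (a ≠ b ∧ a ≠ c ∧ a ≠ d ∧ a ≠ e ∧ b ≠ c ∧ b ≠ d ∧ b ≠ e ∧ c ≠ d ∧
      c ≠ e ∧ d ≠ e) → [a, b, c, d, e].Nodup := by
    intro a b c d e h
    simp
    tauto
  rcases hx with rfl | rfl | rfl | rfl | rfl
  · exact key hadj.symm hzp hpq' hqr hrs' (hnd (by
      refine ⟨?_, ?_, ?_, ?_, ?_, ?_, ?_, ?_, ?_, ?_⟩ <;> assumption)) (by simp)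
  · exact key hadj.symm hzp.symm hsz.symm hrs'.symm hqr.symm (hnd (by
      refine ⟨?_, ?_, ?_, ?_, ?_, ?_, ?_, ?_, ?_, ?_⟩ <;> first | assumption | exact Ne.symm ‹_›)) (by simp)
  · exact key hadj.symm hpq'.symm hzp.symm hsz.symm hrs'.symm (hnd (by
      refine ⟨?_, ?_, ?_, ?_, ?_, ?_, ?_, ?_, ?_, ?_⟩ <;> first | assumption | exact Ne.symm ‹_›)) (by simp)
  · exact key hadj.symm hrs' hsz hzp hpq' (hnd (by
      refine ⟨?_, ?_, ?_, ?_, ?_, ?_, ?_, ?_, ?_, ?_⟩ <;> first | assumption | exact Ne.symm ‹_›)) (by simp)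
  · exact key hadj.symm hsz hzp hpq' hqr (hnd (by
      refine ⟨?_, ?_, ?_, ?_, ?_, ?_, ?_, ?_, ?_, ?_⟩ <;> first | assumption | exact Ne.symm ‹_›)) (by simp)

/-- Let `N` be a maximum matching missing `b` and follow the `N`-`M` alternating path from `z`. If
it reaches `b` after two edges, then `z` is adjacent to `b'`; if after four edges, the edge `bz`
closes a five-cycle; otherwise its first seven vertices touch only three edges of `M`. -/
lemma adj_mate (hM : MaxM G M) (hz : Uncov M z) (hbig : Big G z) {b b' : V} (hzb : G.Adj z b)
    (hbb : s(b, b') ∈ M) : G.Adj z b' := by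
  by_contra hcon
  have hsw : ∀ {x y : V}, s(x, y) ∈ M → s(y, x) ∈ M := fun h => by rwa [Sym2.eq_swap]
  have huniq : ∀ {x y z : V}, s(x, y) ∈ M → s(x, z) ∈ M → y = z := fun h1 h2 => hM.1.eq_right h1 h2
  have huncov : ∀ {x : V}, s(z, x) ∉ M := hz.notMem
  have huncov' : ∀ {x : V}, s(x, z) ∉ M := fun h => huncov (hsw h)
  obtain ⟨N, hN, hbN⟩ := hD.missable hzb.reachable ⟨M, hM, hz⟩
  have hswN : ∀ {x y : V}, s(x, y) ∈ N → s(y, x) ∈ N := fun h => by rwa [Sym2.eq_swap]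
  have huniqN : ∀ {x y z : V}, s(x, y) ∈ N → s(x, z) ∈ N → y = z :=
    fun h1 h2 => hN.1.eq_right h1 h2
  have huncovN : ∀ {x : V}, s(b, x) ∉ N := hbN.notMem
  have huncovN' : ∀ {x : V}, s(x, b) ∉ N := fun h => huncovN (hswN h)
  obtain ⟨p1, hp1⟩ := hN.exists_mate hbN hzb.symm
  have a1 := hN.1.adj hp1
  obtain ⟨p2, hp2⟩ := hM.exists_mate hz a1
  have a2 := hM.1.adj hp2
  have n1 : p2 ≠ b := by
    rintro rfl
    exact hcon (by rwa [huniq hbb (hsw hp2)])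
  obtain ⟨p3, hp3⟩ := hD.exists_mate (hzb.symm.reachable.trans (a1.reachable.trans a2.reachable))
    hN hbN n1.symm
  have a3 := hN.1.adj hp3
  have n2 : p3 ≠ z := by
    rintro rfl
    have := huniqN (hswN hp3) hp1
    subst this
    exact a2.ne rfl
  obtain ⟨p4, hp4⟩ := hD.exists_mate (a1.reachable.trans (a2.reachable.trans a3.reachable))
    hM hz n2.symm
  have a4 := hM.1.adj hp4
  have n3 : p2 ≠ z := by rintro rfl; exact huncov' hp2
  have n4 : p3 ≠ p1 := by
    rintro rfl
    exact n3 (huniqN (hswN hp3) (hswN hp1))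
  have n5 : p4 ≠ z := by rintro rfl; exact huncov' hp4
  have n6 : p4 ≠ p2 := by
    rintro rfl
    exact n4 (huniq (hsw hp4) (hsw hp2))
  have n7 : p4 ≠ p1 := by
    rintro rfl
    have := huniq (hsw hp4) hp2
    subst this
    exact a3.ne rfl
  -- The alternating path closes up to the five-cycle `z p1 p2 p3 b`.
  by_cases hp4b : p4 = b
  · subst hp4b
    exact not_five_cycle hF hm hD hM hz hbig a1 hp2 a3 hp4 hzb.symm n4.symm n7.symm
  obtain ⟨p5, hp5⟩ := hD.exists_mate (hzb.symm.reachable.trans (a1.reachable.trans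
    (a2.reachable.trans (a3.reachable.trans a4.reachable)))) hN hbN (Ne.symm hp4b)
  have a5 := hN.1.adj hp5
  have n8 : p5 ≠ z := by
    rintro rfl
    exact n7 (huniqN (hswN hp5) hp1)
  obtain ⟨p6, hp6⟩ := hD.exists_mate (a1.reachable.trans (a2.reachable.trans
    (a3.reachable.trans (a4.reachable.trans a5.reachable)))) hM hz n8.symm
  have a6 := hM.1.adj hp6
  have b1 := a1.ne
  have b2 := a2.ne
  have b3 := a3.ne
  have b4 := a4.ne
  have b5 := a5.ne
  have b6 := a6.ne
  have n9 : p5 ≠ p1 := by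
    rintro rfl
    exact n5 (huniqN (hswN hp5) (hswN hp1))
  have n10 : p5 ≠ p2 := by
    rintro rfl
    have := huniqN (hswN hp5) hp3
    exact b4 this.symm
  have n11 : p5 ≠ p3 := by
    rintro rfl
    exact n6 (huniqN (hswN hp5) (hswN hp3))
  have n12 : p6 ≠ z := by rintro rfl; exact huncov' hp6
  have n13 : p6 ≠ p1 := by rintro rfl; exact n10 (huniq (hsw hp6) hp2)
  have n14 : p6 ≠ p2 := by rintro rfl; exact n9 (huniq (hsw hp6) (hsw hp2))
  have n15 : p6 ≠ p3 := by rintro rfl; exact b5 (huniq (hsw hp6) hp4).symm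
  have n16 : p6 ≠ p4 := by rintro rfl; exact n11 (huniq (hsw hp6) (hsw hp4))
  refine hF (hM.1.hasForest_of_three (hm M hM) hp2 hp4 hp6
    (isChain_seven a1 a2 a3 a4 a5 a6) ?_ (by simp) (by simp [hz]))
  simp
  grind

/-- Suppose `b` has another neighbour `w`, with mate `w'`. After an exchange exposing `b`,
`adj_mate` applied at `b` shows that `w'` is adjacent to `b` too. If `w` is adjacent to `z` this
produces a five-cycle; if not, the triangle at `b` and the second pair at `z` lie on the path `w w'
b b' z c c'`. -/
lemma adj_iff_of_two_pairs (hM : MaxM G M) (hz : Uncov M z) (hbig : Big G z) {b b' c c' : V}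
    (hzb : G.Adj z b) (hbb : s(b, b') ∈ M) (hzc : G.Adj z c) (hcc : s(c, c') ∈ M) (hbc : c ≠ b)
    (hbc' : c ≠ b') (w : V) : G.Adj b w ↔ w = z ∨ w = b' := by
  have hsw : ∀ {x y : V}, s(x, y) ∈ M → s(y, x) ∈ M := fun h => by rwa [Sym2.eq_swap]
  have huniq : ∀ {x y z : V}, s(x, y) ∈ M → s(x, z) ∈ M → y = z := fun h1 h2 => hM.1.eq_right h1 h2
  have hzb' := adj_mate hF hm hD hM hz hbig hzb hbb
  have hzc' := adj_mate hF hm hD hM hz hbig hzc hcc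
  have hbb' := hM.1.adj hbb
  constructor
  · intro hw
    by_contra! hcon
    obtain ⟨h1, h2⟩ := hM.swap hz hzb' (hsw hbb)
    obtain ⟨w', hww⟩ := hD.exists_mate (hzb.reachable.trans hw.reachable) hM hz hcon.1.symm
    have hww' := hM.1.adj hww
    have hww2 : s(w, w') ∈ swapM M z b' b := mem_swapM hww (by
      rw [Ne, Sym2.eq_iff]
      have := hw.ne
      grind)
    have hbw' : G.Adj b w' :=
      adj_mate hF hm hD h1 h2 (hbig.of_reachable hzb.reachable) hw hww2
    have n0 := hw.ne
    have n1 : w' ≠ b := by rintro rfl; exact hcon.2 (huniq (hsw hww) hbb)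
    have n2 : w' ≠ b' := by rintro rfl; exact n0 (huniq (hsw hww) (hsw hbb)).symm
    by_cases hzw : G.Adj z w
    · exact not_five_cycle hF hm hD hM hz hbig hzw hww hbw'.symm hbb hzb'.symm n0.symm hcon.2
    · have n3 : w ≠ c := by rintro rfl; exact hzw hzc
      have n4 : w ≠ c' := by rintro rfl; exact hzw hzc'
      have n5 : w' ≠ c := by rintro rfl; exact n4 (huniq (hsw hww) hcc)
      have n6 : w' ≠ c' := by rintro rfl; exact n3 (huniq (hsw hww) (hsw hcc))
      have n7 : c' ≠ b := by rintro rfl; exact hbc' (huniq (hsw hcc) hbb)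
      have n8 : c' ≠ b' := by rintro rfl; exact hbc (huniq (hsw hcc) (hsw hbb))
      have n9 := hzb.ne
      have n10 := hzb'.ne
      have n11 := hzc.ne
      have n12 := hzc'.ne
      have n13 := hbb'.ne
      have n14 := hww'.ne
      have n15 := (hM.1.adj hcc).ne
      have n16 : w' ≠ z := by rintro rfl; exact hz.notMem (hsw hww)
      refine hF (hM.1.hasForest_of_three (hm M hM) hbb hcc hww
        (isChain_seven hww' hbw'.symm hbb' hzb'.symm hzc (hM.1.adj hcc) :
          [w, w', b, b', z, c, c'].IsChain G.Adj) ?_ (by simp) (by simp [hz]))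
      simp
      grind
  · rintro (rfl | rfl)
    · exact hzb.symm
    · exact hbb'

/-- A large component of missable vertices is a fan. -/
lemma exists_isFan (hz : Missable G z) (hbig : Big G z) :
    ∃ y π, G.Reachable z y ∧ IsFan G y π := by
  -- a vertex with at least three neighbours
  obtain ⟨y, hzy, M, hM, hy, b, b', c, c', hb, hbb, hc, hcc, hbc, hbc'⟩ : ∃ y, G.Reachable z y ∧
      ∃ M, MaxM G M ∧ Uncov M y ∧ ∃ b b' c c', G.Adj y b ∧ s(b, b') ∈ M ∧ G.Adj y c ∧
        s(c, c') ∈ M ∧ c ≠ b ∧ c ≠ b' := by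
    by_contra! hcon
    -- If no vertex has two pairs of neighbours, every vertex has exactly two neighbours, which are
    -- adjacent. The component is then a triangle and not big.
    have hdeg : ∀ y, G.Reachable z y → ∀ b, G.Adj y b →
        ∃ b', G.Adj y b' ∧ G.Adj b b' ∧ ∀ c, G.Adj y c → c = b ∨ c = b' := by
      intro y hzy b hb
      obtain ⟨M, hM, hy⟩ := hD.missable hzy hz
      obtain ⟨b', hbb⟩ := hM.exists_mate hy hb
      refine ⟨b', adj_mate hF hm hD hM hy (hbig.of_reachable hzy) hb hbb, hM.1.adj hbb, ?_⟩
      intro c hc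
      obtain ⟨c', hcc⟩ := hM.exists_mate hy hc
      by_contra! h
      exact h.2 (hcon y hzy M hM hy b b' c c' hb hbb hc hcc h.1)
    obtain ⟨v, hv, hv'⟩ := hbig z z z z z
    obtain ⟨x, b, hx, -, hzb, -⟩ := exists_adj_of_reachable (S := fun x => x = z) hv rfl
      (by simpa using hv')
    subst hx
    obtain ⟨b', h1, h2, h3⟩ := hdeg x (Reachable.refl _) b hzb
    obtain ⟨v, hv, hv'⟩ := hbig x b b' x x
    obtain ⟨y, c, hy, hc, hyc, -⟩ := exists_adj_of_reachable (S := fun y => y ∈ [x, b, b']) hv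
      (by simp) (by simp at hv' ⊢; tauto)
    simp only [List.mem_cons, List.not_mem_nil, or_false, not_or] at hy hc
    have hyx : G.Reachable x y := by
      rcases hy with rfl | rfl | rfl
      · exact Reachable.refl _
      · exact hzb.reachable
      · exact h1.reachable
    rcases hy with rfl | rfl | rfl
    · rcases h3 c hyc with h | h <;> tauto
    · obtain ⟨d, -, -, h6⟩ := hdeg y hyx x hzb.symm
      have e1 := h6 _ h2
      have e2 := h6 _ hyc
      have := h1.ne
      grind
    · obtain ⟨d, -, -, h6⟩ := hdeg y hyx x h1.symm
      have e1 := h6 _ h2.symm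
      have e2 := h6 _ hyc
      have := hzb.ne
      grind
  have hbig' := hbig.of_reachable hzy
  have hsw : ∀ {x y : V}, s(x, y) ∈ M → s(y, x) ∈ M := fun h => by rwa [Sym2.eq_swap]
  have huniq : ∀ {x y z : V}, s(x, y) ∈ M → s(x, z) ∈ M → y = z := fun h1 h2 => hM.1.eq_right h1 h2
  -- neighbours of the centre
  have hnb : ∀ a a', G.Adj y a → s(a, a') ∈ M → ∀ w, G.Adj a w ↔ w = y ∨ w = a' := by
    intro a a' ha haa
    by_cases hab : b ≠ a ∧ b ≠ a'
    · exact adj_iff_of_two_pairs hF hm hD hM hy hbig' ha haa hb hbb hab.1 hab.2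
    · refine adj_iff_of_two_pairs hF hm hD hM hy hbig' ha haa hc hcc ?_ ?_
      · rintro rfl
        apply hab
        refine ⟨hbc.symm, ?_⟩
        rintro rfl
        exact hbc' (huniq (hsw haa) hbb)
      · rintro rfl
        apply hab
        refine ⟨?_, hbc.symm⟩
        rintro rfl
        exact hbc' (huniq haa hbb)
  -- The centre with its neighbours is closed under adjacency, because a neighbour sees only the
  -- centre and its own mate.
  have hall : ∀ a, G.Reachable y a → a ≠ y → G.Adj y a := by
    intro a ha hay
    by_contra hcon
    obtain ⟨x, w, hx, hw, hxw, -⟩ := exists_adj_of_reachable (S := fun x => x = y ∨ G.Adj y x) ha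
      (Or.inl rfl) (by tauto)
    rcases hx with rfl | hx
    · exact hw (Or.inr hxw)
    · obtain ⟨x', hxx⟩ := hM.exists_mate hy hx
      rcases (hnb x x' hx hxx w).1 hxw with rfl | rfl
      · exact hw (Or.inl rfl)
      · exact hw (Or.inr (adj_mate hF hm hD hM hy hbig' hx hxx))
  have hmate : ∀ a, ∃ a', G.Reachable y a → a ≠ y → s(a, a') ∈ M := by
    intro a
    by_cases h : G.Reachable y a ∧ a ≠ y
    · obtain ⟨a', ha'⟩ := hD.exists_mate h.1 hM hy h.2.symm
      exact ⟨a', fun _ _ => ha'⟩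
    · exact ⟨a, fun h1 h2 => absurd ⟨h1, h2⟩ h⟩
  choose π hπ using hmate
  refine ⟨y, π, hzy, fun a ha hay => ?_⟩
  have h1 := hπ a ha hay
  have h2 : π a ≠ y := by
    intro h
    rw [h] at h1
    exact hy.notMem (hsw h1)
  have h3 := hM.1.adj h1
  refine ⟨h2, h3.ne', ?_, hnb a (π a) (hall a ha hay) h1⟩
  exact huniq (hπ (π a) (ha.trans h3.reachable) h2) (hsw h1)

end FactorCritical

/-! ### Components with a perfect matching and no short path on seven vertices -/

lemma isChain_iff_of_closed {R : V → V → Prop} {S : V → Prop} (h : l.IsChain R)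
    (hS : ∀ v ∈ l, ∀ w ∈ l, R v w → (S v ↔ S w)) : ∀ v ∈ l, ∀ w ∈ l, (S v ↔ S w) := by
  induction l with
  | nil => simp
  | cons a l ih =>
    cases l with
    | nil => simp
    | cons b l =>
      rw [List.isChain_cons_cons] at h
      have h1 := ih h.2 fun v hv w hw => hS v (List.mem_cons_of_mem _ hv) w
        (List.mem_cons_of_mem _ hw)
      have h2 := hS a (by simp) b (by simp) h.1
      have h3 : ∀ v ∈ b :: l, (S a ↔ S v) := fun v hv => h2.trans (h1 b (by simp) v hv)
      intro v hv w hw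
      rcases List.mem_cons.1 hv with rfl | hv' <;> rcases List.mem_cons.1 hw with rfl | hw'
      · rfl
      · exact h3 w hw'
      · exact (h3 v hv').symm
      · exact h1 v hv' w hw'

/-- `v` and `π v` have no neighbours besides each other and `b`. -/
def Pendant (G : SimpleGraph V) (π : V → V) (b v : V) : Prop :=
  (∀ w, G.Adj v w → w = π v ∨ w = b) ∧ ∀ w, G.Adj (π v) w → w = v ∨ w = b

lemma Pendant.forall_eq {π : V → V} {b x : V} (hx : Pendant G π b x) (hc : l.IsChain G.Adj)
    (hb : b ∉ l) (hxl : x ∈ l) : ∀ v ∈ l, v = x ∨ v = π x := by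
  intro v hv
  refine (isChain_iff_of_closed (S := fun v => v = x ∨ v = π x) hc ?_ x hxl v hv).1
    (Or.inl rfl)
  have key : ∀ v ∈ l, ∀ w ∈ l, G.Adj v w → (v = x ∨ v = π x) → w = x ∨ w = π x := by
    rintro v hv w hw hvw (rfl | rfl)
    · rcases hx.1 w hvw with h | rfl
      · exact Or.inr h
      · exact absurd hw hb
    · rcases hx.2 w hvw with h | rfl
      · exact Or.inl h
      · exact absurd hw hb
  exact fun v hv w hw hvw => ⟨key v hv w hw hvw, key w hw v hv hvw.symm⟩

lemma length_le_two_of_forall {x y : V} (hn : l.Nodup) (h : ∀ v ∈ l, v = x ∨ v = y) :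
    l.length ≤ 2 := by
  rw [← List.toFinset_card_of_nodup hn]
  refine (Finset.card_le_card (t := {x, y}) ?_).trans Finset.card_le_two
  intro v hv
  simpa using h v (by simpa using hv)

/-- A path can leave a pendant pair only through `b`. Meeting two different pairs, it would consist
of `b` and at most two vertices on either side. -/
lemma Pendant.eq_or_eq {π : V → V} {b x y : V} (hx : Pendant G π b x) (hy : Pendant G π b y)
    (hc : l.IsChain G.Adj) (hn : l.Nodup) (hlen : 6 ≤ l.length) (hxl : x ∈ l) (hyl : y ∈ l)
    (hxb : x ≠ b) (hyb : y ≠ b) : y = x ∨ y = π x := by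
  by_cases hb : b ∈ l
  · obtain ⟨l1, l2, rfl⟩ := List.append_of_mem hb
    rw [List.isChain_append] at hc
    have hc2 := hc.2.1.tail
    simp only [List.tail_cons] at hc2
    have hb1 : b ∉ l1 := by grind
    have hb2 : b ∉ l2 := by grind
    have hn1 : l1.Nodup := by grind
    have hn2 : l2.Nodup := by grind
    have hx' : x ∈ l1 ∨ x ∈ l2 := by simp at hxl; tauto
    have hy' : y ∈ l1 ∨ y ∈ l2 := by simp at hyl; tauto
    simp at hlen
    rcases hx' with hx' | hx' <;> rcases hy' with hy' | hy'
    · exact hx.forall_eq hc.1 hb1 hx' y hy'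
    · have := length_le_two_of_forall hn1 (hx.forall_eq hc.1 hb1 hx')
      have := length_le_two_of_forall hn2 (hy.forall_eq hc2 hb2 hy')
      omega
    · have := length_le_two_of_forall hn1 (hy.forall_eq hc.1 hb1 hy')
      have := length_le_two_of_forall hn2 (hx.forall_eq hc2 hb2 hx')
      omega
    · exact hx.forall_eq hc2 hb2 hx' y hy'
  · exact hx.forall_eq hc hb hxl y hyl

lemma IsMatch.hasForest_of_four (h : IsMatch G M) (ht : t + 4 ≤ M.card)
    {a a' b b' c c' d d' : V} (ha : s(a, a') ∈ M) (hb : s(b, b') ∈ M) (hc : s(c, c') ∈ M)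
    (hd : s(d, d') ∈ M) (hl : l.IsChain G.Adj) (hn : l.Nodup) (hlen : 7 ≤ l.length)
    (hv : ∀ v ∈ l, v ∈ [a, a', b, b', c, c', d, d']) :
    HasForest G t := by
  refine h.hasForest_of_touch hl hn hlen {s(a, a'), s(b, b'), s(c, c'), s(d, d')} ?_ ?_
  · intro v hvl w hw
    have key : ∀ {x y : V}, s(x, y) ∈ M → v = x ∨ v = y → s(v, w) = s(x, y) := by
      rintro x y hxy (rfl | rfl)
      · rw [h.eq_right hw hxy]
      · rw [Sym2.eq_swap] at hxy
        rw [h.eq_right hw hxy, Sym2.eq_swap]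
    have h1 := hv v hvl
    simp only [List.mem_cons, List.not_mem_nil, or_false] at h1
    simp only [Finset.mem_insert, Finset.mem_singleton]
    rcases h1 with hv | hv | hv | hv | hv | hv | hv | hv
    · exact Or.inl (key ha (Or.inl hv))
    · exact Or.inl (key ha (Or.inr hv))
    · exact Or.inr (Or.inl (key hb (Or.inl hv)))
    · exact Or.inr (Or.inl (key hb (Or.inr hv)))
    · exact Or.inr (Or.inr (Or.inl (key hc (Or.inl hv))))
    · exact Or.inr (Or.inr (Or.inl (key hc (Or.inr hv))))
    · exact Or.inr (Or.inr (Or.inr (key hd (Or.inl hv))))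
    · exact Or.inr (Or.inr (Or.inr (key hd (Or.inr hv))))
  · have := Finset.card_le_four (a := s(a, a')) (b := s(b, b')) (c := s(c, c')) (d := s(d, d'))
    omega

/-- A component covered by a matching `{v, π v}` such that no path on seven vertices meets at most
four matching edges. -/
structure NoShort (G : SimpleGraph V) (r : V) (π : V → V) : Prop where
  adj : ∀ v, G.Reachable r v → G.Adj v (π v)
  invol : ∀ v, G.Reachable r v → π (π v) = v
  second : ∀ y x, G.Adj y x → ∃ z, z ≠ x ∧ G.Adj y z
  not_path : ∀ a b c d, G.Reachable r a → G.Reachable r b → G.Reachable r c → G.Reachable r d →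
    ∀ l : List V, l.IsChain G.Adj → l.Nodup → 7 ≤ l.length →
      (∀ v ∈ l, v ∈ [a, π a, b, π b, c, π c, d, π d]) → False

/-- An alternating path `a, π a, b, π b, c, π c`. -/
structure Alt (G : SimpleGraph V) (r : V) (π : V → V) (a b c : V) : Prop where
  ha : G.Reachable r a
  hb : G.Reachable r b
  hc : G.Reachable r c
  hab : G.Adj (π a) b
  hbc : G.Adj (π b) c
  hca : c ≠ a ∧ c ≠ π a
  hba : b ≠ a
  hcb : c ≠ b

namespace NoShort

variable {r a b c : V} {π : V → V} (h : NoShort G r π)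

include h

lemma reach {v : V} (hv : G.Reachable r v) : G.Reachable r (π v) :=
  hv.trans (h.adj v hv).reachable

lemma ne_pair {x y : V} (hx : G.Reachable r x) (hy : G.Reachable r y) (h1 : y ≠ x)
    (h2 : y ≠ π x) : π y ≠ x ∧ π y ≠ π x := by
  constructor
  · rintro rfl
    exact h2 (h.invol y hy).symm
  · intro h3
    apply h1
    rw [← h.invol y hy, h3, h.invol x hx]

lemma alt_symm (hA : Alt G r π a b c) : Alt G r π (π c) (π b) (π a) := by
  refine ⟨h.reach hA.hc, h.reach hA.hb, h.reach hA.ha, ?_, ?_, ?_, ?_, ?_⟩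
  · rw [h.invol c hA.hc]
    exact hA.hbc.symm
  · rw [h.invol b hA.hb]
    exact hA.hab.symm
  · have h1 := h.ne_pair hA.ha hA.hc hA.hca.1 hA.hca.2
    rw [h.invol c hA.hc]
    exact ⟨h1.2.symm, hA.hca.2.symm⟩
  · intro h1
    apply hA.hcb
    rw [← h.invol c hA.hc, ← h1, h.invol b hA.hb]
  · intro h1
    apply hA.hba
    rw [← h.invol b hA.hb, ← h1, h.invol a hA.ha]

lemma alt_facts (hA : Alt G r π a b c) :
    [a, π a, b, π b, c, π c].Nodup := by
  have h1 := h.ne_pair hA.ha hA.hc hA.hca.1 hA.hca.2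
  have h2 := h.ne_pair hA.ha hA.hb hA.hba hA.hab.ne'
  have h3 := h.ne_pair hA.hb hA.hc hA.hcb hA.hbc.ne'
  have h4 := (h.adj a hA.ha).ne
  have h5 := (h.adj b hA.hb).ne
  have h6 := (h.adj c hA.hc).ne
  have h7 := hA.hab.ne
  have h8 := hA.hbc.ne
  have h9 := hA.hca
  have h10 := hA.hba
  have h11 := hA.hcb
  simp
  grind

lemma nodup_eight (hA : Alt G r π a b c) {y : V} (hy : G.Reachable r y)
    (hyB : y ∉ [a, π a, b, π b, c, π c]) : [y, π y, a, π a, b, π b, c, π c].Nodup := by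
  have h0 := h.alt_facts hA
  simp only [List.mem_cons, List.not_mem_nil, or_false, not_or] at hyB
  have h1 := h.ne_pair hA.ha hy hyB.1 hyB.2.1
  have h2 := h.ne_pair hA.hb hy hyB.2.2.1 hyB.2.2.2.1
  have h3 := h.ne_pair hA.hc hy hyB.2.2.2.2.1 hyB.2.2.2.2.2
  have h4 := (h.adj y hy).ne
  rw [List.nodup_cons, List.nodup_cons]
  refine ⟨?_, ?_, h0⟩ <;> simp <;> grind

/-- Seven consecutive vertices inside four matching edges. -/
lemma not_seven (hA : Alt G r π a b c) {y : V} (hy : G.Reachable r y) {v1 v2 v3 v4 v5 v6 v7 : V} (h1 : G.Adj v1 v2)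
    (h2 : G.Adj v2 v3) (h3 : G.Adj v3 v4) (h4 : G.Adj v4 v5) (h5 : G.Adj v5 v6)
    (h6 : G.Adj v6 v7)
    (hm : [v1, v2, v3, v4, v5, v6, v7].Nodup ∧ ∀ v ∈ [v1, v2, v3, v4, v5, v6, v7],
      v ∈ [y, π y, a, π a, b, π b, c, π c]) : False :=
  h.not_path y a b c hy hA.ha hA.hb hA.hc _ (isChain_seven h1 h2 h3 h4 h5 h6) hm.1 (by simp) hm.2

/-- An outside neighbour put in front of the alternating path gives seven vertices inside four
matching edges. -/
lemma adj_first (hA : Alt G r π a b c) {y : V} (hay : G.Adj a y) :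
    y ∈ [a, π a, b, π b, c, π c] := by
  by_contra hyB
  have hy := hA.ha.trans hay.reachable
  have hn := h.nodup_eight hA hy hyB
  refine h.not_seven hA hy hay.symm (h.adj a hA.ha) hA.hab (h.adj b hA.hb) hA.hbc
    (h.adj c hA.hc) ⟨?_, by simp⟩
  simp only [List.nodup_cons, List.mem_cons, List.not_mem_nil] at hn ⊢
  grind

lemma exists_second_first (hA : Alt G r π a b c) :
    ∃ j, G.Adj a j ∧ (j = b ∨ j = π b ∨ j = c ∨ j = π c) := by
  obtain ⟨j, hj, haj⟩ := h.second a (π a) (h.adj a hA.ha)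
  have := h.adj_first hA haj
  have := haj.ne
  simp at this
  refine ⟨j, haj, ?_⟩
  simp_all
  tauto

/-- From an outside neighbour `y` the path `π y, y, π a, a` continues through a second neighbour of
`a`, which lies on one of the other two matching edges; four further choices complete it to seven
vertices. -/
lemma adj_second (hA : Alt G r π a b c) {y : V} (hay : G.Adj (π a) y) :
    y ∈ [a, π a, b, π b, c, π c] := by
  by_contra hyB
  have hy := (h.reach hA.ha).trans hay.reachable
  have hn := h.nodup_eight hA hy hyB
  obtain ⟨j, haj, hj⟩ := h.exists_second_first hA
  have a1 := h.adj a hA.ha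
  have a2 := h.adj b hA.hb
  have a3 := h.adj c hA.hc
  have a4 := h.adj y hy
  have hB := hA.hbc
  simp only [List.nodup_cons, List.mem_cons, List.not_mem_nil] at hn
  rcases hj with rfl | rfl | rfl | rfl
  · refine h.not_seven hA hy a4.symm hay.symm a1.symm haj a2 hB ⟨?_, by simp⟩
    simp; grind
  · refine h.not_seven hA hy a4.symm hay.symm a1.symm haj hB a3 ⟨?_, by simp⟩
    simp; grind
  · refine h.not_seven hA hy a4.symm hay.symm a1.symm haj hB.symm a2.symm ⟨?_, by simp⟩
    simp; grind
  · refine h.not_seven hA hy a4.symm hay.symm a1.symm haj a3.symm hB.symm ⟨?_, by simp⟩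
    simp; grind

lemma mem_symm (hA : Alt G r π a b c) {y : V} :
    y ∈ [π c, π (π c), π b, π (π b), π a, π (π a)] ↔ y ∈ [a, π a, b, π b, c, π c] := by
  rw [h.invol a hA.ha, h.invol b hA.hb, h.invol c hA.hc]
  simp only [List.mem_cons, List.not_mem_nil, or_false]
  grind

lemma adj_last (hA : Alt G r π a b c) {y : V} (hcy : G.Adj c y ∨ G.Adj (π c) y) :
    y ∈ [a, π a, b, π b, c, π c] := by
  rw [← h.mem_symm hA]
  rcases hcy with hcy | hcy
  · refine h.adj_second (h.alt_symm hA) ?_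
    rwa [h.invol c hA.hc]
  · exact h.adj_first (h.alt_symm hA) hcy

/-- The piece `π y, y, b` ends in `b`, so `a, π a` can be traversed in either order after it. Any
neighbour on `π b`, `c` or `π c` would prolong this to seven vertices within four matching edges. -/
lemma pendant_first (hA : Alt G r π a b c) {y : V} (hby : G.Adj b y)
    (hyB : y ∉ [a, π a, b, π b, c, π c]) : Pendant G π b a := by
  have hy := hA.hb.trans hby.reachable
  have hn := h.nodup_eight hA hy hyB
  have a1 := h.adj a hA.ha
  have a2 := h.adj b hA.hb
  have a3 := h.adj c hA.hc
  have a4 := h.adj y hy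
  have hB := hA.hbc
  have hC := hA.hab
  have ns := @h.not_seven _ _ _ _ _ _ _ hA y hy
  simp only [List.nodup_cons, List.mem_cons, List.not_mem_nil] at hn
  have e1 : ∀ w, G.Adj a w → w = π a ∨ w = b := by
    intro w haw
    have hw := h.adj_first hA haw
    have := haw.ne
    simp only [List.mem_cons, List.not_mem_nil, or_false] at hw
    rcases hw with rfl | rfl | rfl | rfl | rfl | rfl
    · exact absurd rfl this
    · exact Or.inl rfl
    · exact Or.inr rfl
    · exact (ns a4.symm hby.symm hC.symm a1.symm haw hB ⟨by simp; grind, by simp⟩).elim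
    · exact (ns a4.symm hby.symm hC.symm a1.symm haw a3 ⟨by simp; grind, by simp⟩).elim
    · exact (ns a4.symm hby.symm hC.symm a1.symm haw a3.symm ⟨by simp; grind, by simp⟩).elim
  have hab : G.Adj a b := by
    obtain ⟨j, hj, haj⟩ := h.second a (π a) a1
    rcases e1 j haj with rfl | rfl
    · exact absurd rfl hj
    · exact haj
  refine ⟨e1, fun w haw => ?_⟩
  have hw := h.adj_second hA haw
  have := haw.ne
  simp only [List.mem_cons, List.not_mem_nil, or_false] at hw
  rcases hw with rfl | rfl | rfl | rfl | rfl | rfl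
  · exact Or.inl rfl
  · exact absurd rfl this
  · exact Or.inr rfl
  · exact (ns a4.symm hby.symm hab.symm a1 haw hB ⟨by simp; grind, by simp⟩).elim
  · exact (ns a4.symm hby.symm hab.symm a1 haw a3 ⟨by simp; grind, by simp⟩).elim
  · exact (ns a4.symm hby.symm hab.symm a1 haw a3.symm ⟨by simp; grind, by simp⟩).elim

lemma mate_notMem (hA : Alt G r π a b c) {y : V} (hy : G.Reachable r y)
    (hyB : y ∉ [a, π a, b, π b, c, π c]) : π y ∉ [a, π a, b, π b, c, π c] := by
  have hn := h.nodup_eight hA hy hyB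
  exact (List.nodup_cons.1 (List.nodup_cons.1 hn).2).1

/-- With `a` already pendant at `b`, a neighbour of `π y` on `π b`, `c` or `π c` allows the path `a,
π a, b, y, π y` to continue there. A neighbour off the six vertices gives a path through its edge,
`π y`, `y`, `b`, `π b`, `c`, `π c`. -/
lemma adj_mate_outside (hA : Alt G r π a b c) {y : V} (hby : G.Adj b y)
    (hyB : y ∉ [a, π a, b, π b, c, π c]) {w : V} (hyw : G.Adj (π y) w) : w = y ∨ w = b := by
  have hy := hA.hb.trans hby.reachable
  have hn := h.nodup_eight hA hy hyB
  have a1 := h.adj a hA.ha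
  have a2 := h.adj b hA.hb
  have a3 := h.adj c hA.hc
  have a4 := h.adj y hy
  have hB := hA.hbc
  have hC := hA.hab
  have ns := @h.not_seven _ _ _ _ _ _ _ hA y hy
  have hP := h.pendant_first hA hby hyB
  simp only [List.nodup_cons, List.mem_cons, List.not_mem_nil] at hn
  by_contra! hw
  have hne := hyw.ne
  by_cases hwB : w ∈ [a, π a, b, π b, c, π c]
  · simp only [List.mem_cons, List.not_mem_nil, or_false] at hwB
    rcases hwB with rfl | rfl | rfl | rfl | rfl | rfl
    · have := hP.1 _ hyw.symm
      grind
    · have := hP.2 _ hyw.symm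
      grind
    · exact hw.2 rfl
    · exact (ns a1 hC hby a4 hyw hB ⟨by simp; grind, by simp⟩).elim
    · exact (ns a1 hC hby a4 hyw a3 ⟨by simp; grind, by simp⟩).elim
    · exact (ns a1 hC hby a4 hyw a3.symm ⟨by simp; grind, by simp⟩).elim
  · have hwr := (h.reach hy).trans hyw.reachable
    refine h.not_path w y b c hwr hy hA.hb hA.hc _ (isChain_seven hyw.symm a4.symm hby.symm a2 hB
      a3) ?_ (by simp) (by simp)
    simp only [List.mem_cons, List.not_mem_nil, or_false, not_or] at hwB
    simp
    grind

lemma pendant_outside (hA : Alt G r π a b c) {y : V} (hby : G.Adj b y)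
    (hyB : y ∉ [a, π a, b, π b, c, π c]) : Pendant G π b y := by
  have hy := hA.hb.trans hby.reachable
  have hby' : G.Adj b (π y) := by
    obtain ⟨j, hj, hyj⟩ := h.second (π y) y (h.adj y hy).symm
    rcases h.adj_mate_outside hA hby hyB hyj with rfl | rfl
    · exact absurd rfl hj
    · exact hyj.symm
  refine ⟨fun w hw => ?_, fun w hw => h.adj_mate_outside hA hby hyB hw⟩
  refine h.adj_mate_outside hA hby' (h.mate_notMem hA hy hyB) ?_
  rwa [h.invol y hy]

lemma Pendant.mate {v : V} (hv : G.Reachable r v) (hp : Pendant G π b v) :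
    Pendant G π b (π v) := by
  refine ⟨fun w hw => ?_, fun w hw => ?_⟩
  · rw [h.invol v hv]
    exact hp.2 w hw
  · rw [h.invol v hv] at hw
    exact hp.1 w hw

/-- The listed vertices contain `b` and are closed under adjacency. The last alternative arises when
`π b` also has an outside neighbour: the reversed alternating path then makes `c` and that neighbour
pendant at `π b`. -/
lemma cover (hA : Alt G r π a b c) {y : V} (hby : G.Adj b y)
    (hyB : y ∉ [a, π a, b, π b, c, π c]) {v : V} (hv : G.Reachable r v) :
    v = b ∨ v = π b ∨ Pendant G π b v ∨
      (v = c ∨ v = π c) ∨ (Pendant G π (π b) c ∧ Pendant G π (π b) v) := by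
  by_contra hcon
  obtain ⟨x, z, hx, hz, hxz, hbx⟩ := exists_adj_of_reachable
    (S := fun v => v = b ∨ v = π b ∨ Pendant G π b v ∨
      (v = c ∨ v = π c) ∨ (Pendant G π (π b) c ∧ Pendant G π (π b) v))
    (hA.hb.symm.trans hv) (Or.inl rfl) hcon
  have hrx : G.Reachable r x := hA.hb.trans (hbx.trans hxz.symm.reachable)
  have hPa := h.pendant_first hA hby hyB
  have hPa' := Pendant.mate h hA.ha hPa
  have hzB : z ∉ [a, π a, b, π b, c, π c] := by
    intro hzB
    simp only [List.mem_cons, List.not_mem_nil, or_false] at hzB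
    apply hz
    rcases hzB with rfl | rfl | rfl | rfl | rfl | rfl <;> simp [hPa, hPa']
  rcases hx with rfl | rfl | hx | hx | ⟨hPc, hx⟩
  · exact hz (Or.inr (Or.inr (Or.inl (h.pendant_outside hA hxz hzB))))
  · have hA' := h.alt_symm hA
    rw [← h.mem_symm hA] at hzB
    have h1 := Pendant.mate h (h.reach hA.hc) (h.pendant_first hA' hxz hzB)
    rw [h.invol c hA.hc] at h1
    exact hz (Or.inr (Or.inr (Or.inr (Or.inr ⟨h1, h.pendant_outside hA' hxz hzB⟩))))
  · rcases hx.1 z hxz with rfl | rfl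
    · exact hz (Or.inr (Or.inr (Or.inl (Pendant.mate h hrx hx))))
    · exact hz (Or.inl rfl)
  · apply hzB
    apply h.adj_last hA
    rcases hx with rfl | rfl
    · exact Or.inl hxz
    · exact Or.inr hxz
  · rcases hx.1 z hxz with rfl | rfl
    · exact hz (Or.inr (Or.inr (Or.inr (Or.inr ⟨hPc, Pendant.mate h hrx hx⟩))))
    · exact hz (Or.inr (Or.inl rfl))

/-- By `Pendant.eq_or_eq`, besides `b` and `π b` a long path meets at most one pair on either side,
hence six vertices in total. -/
lemma not_long_of_outside (hA : Alt G r π a b c) {y : V} (hby : G.Adj b y)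
    (hyB : y ∉ [a, π a, b, π b, c, π c]) (hl : l.IsChain G.Adj) (hn : l.Nodup)
    (hlr : ∀ v ∈ l, G.Reachable r v) : l.length < 7 := by
  by_contra! hlen
  obtain ⟨x, hx⟩ : ∃ x, ∀ v ∈ l, v ≠ b → Pendant G π b v → v = x ∨ v = π x := by
    by_cases hex : ∃ x ∈ l, x ≠ b ∧ Pendant G π b x
    · obtain ⟨x, hxl, hxb, hx⟩ := hex
      exact ⟨x, fun v hvl hvb hv => hx.eq_or_eq hv hl hn (by omega) hxl hvl hxb hvb⟩
    · push Not at hex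
      exact ⟨b, fun v hvl hvb hv => absurd hv (hex v hvl hvb)⟩
  obtain ⟨z, hz⟩ : ∃ z, ∀ v ∈ l, v ≠ π b →
      (v = c ∨ v = π c) ∨ (Pendant G π (π b) c ∧ Pendant G π (π b) v) → v = z ∨ v = π z := by
    by_cases hPc : Pendant G π (π b) c
    · have key : ∀ v, (v = c ∨ v = π c) ∨ (Pendant G π (π b) c ∧ Pendant G π (π b) v) →
          Pendant G π (π b) v := by
        rintro v ((rfl | rfl) | hv)
        · exact hPc
        · exact Pendant.mate h hA.hc hPc
        · exact hv.2
      by_cases hex : ∃ x ∈ l, x ≠ π b ∧ Pendant G π (π b) x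
      · obtain ⟨x, hxl, hxb, hx⟩ := hex
        exact ⟨x, fun v hvl hvb hv =>
          hx.eq_or_eq (key v hv) hl hn (by omega) hxl hvl hxb hvb⟩
      · push Not at hex
        exact ⟨b, fun v hvl hvb hv => absurd (key v hv) (hex v hvl hvb)⟩
    · exact ⟨c, fun v _ _ hv => hv.resolve_right fun h => hPc h.1⟩
  have hsub : l.toFinset ⊆ {b, π b, x, π x, z, π z} := by
    intro v hv
    rw [List.mem_toFinset] at hv
    simp only [Finset.mem_insert, Finset.mem_singleton]
    by_cases h1 : v = b
    · exact Or.inl h1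
    by_cases h2 : v = π b
    · exact Or.inr (Or.inl h2)
    rcases h.cover hA hby hyB (hlr v hv) with h3 | h3 | h3 | h3
    · exact absurd h3 h1
    · exact absurd h3 h2
    · rcases hx v hv h1 h3 with h4 | h4 <;> simp [h4]
    · rcases hz v hv h2 h3 with h4 | h4 <;> simp [h4]
  have := Finset.card_le_card hsub
  rw [List.toFinset_card_of_nodup hn] at this
  have := this.trans Finset.card_le_six
  omega

/-- A path on seven vertices leaves the six vertices of the alternating path, so some edge leaves
them too. Only the middle pair can have outside neighbours. -/
lemma alt_not_long (hA : Alt G r π a b c) (hl : l.IsChain G.Adj) (hn : l.Nodup)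
    (hlr : ∀ v ∈ l, G.Reachable r v) : l.length < 7 := by
  by_contra! hlen
  obtain ⟨v, hvl, hv⟩ : ∃ v ∈ l, v ∉ [a, π a, b, π b, c, π c] := by
    by_contra! hcon
    have hsub : l.toFinset ⊆ [a, π a, b, π b, c, π c].toFinset := by
      intro v hv
      rw [List.mem_toFinset] at hv ⊢
      exact hcon v hv
    have := (Finset.card_le_card hsub).trans (List.toFinset_card_le _)
    rw [List.toFinset_card_of_nodup hn] at this
    simp at this
    omega
  obtain ⟨x, z, hx, hz, hxz, hbx⟩ := exists_adj_of_reachable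
    (S := fun v => v ∈ [a, π a, b, π b, c, π c])
    (hA.hb.symm.trans (hlr v hvl)) (by simp) hv
  simp only [List.mem_cons, List.not_mem_nil, or_false] at hx
  rcases hx with rfl | rfl | rfl | rfl | rfl | rfl
  · exact hz (h.adj_first hA hxz)
  · exact hz (h.adj_second hA hxz)
  · exact absurd (h.not_long_of_outside hA hxz hz hl hn hlr) (by omega)
  · rw [← h.mem_symm hA] at hz
    exact absurd (h.not_long_of_outside (h.alt_symm hA) hxz hz hl hn hlr) (by omega)
  · exact hz (h.adj_last hA (Or.inl hxz))
  · exact hz (h.adj_last hA (Or.inr hxz))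

lemma alt_of_adj {x w : V} (hb : G.Reachable r b) (hbx : G.Adj b x) (hbw : G.Adj (π b) w)
    (hx : x ≠ π b) (hw : w ≠ b) (h1 : w ≠ x) (h2 : w ≠ π x) : Alt G r π (π x) b w := by
  have hxr := hb.trans hbx.reachable
  refine ⟨h.reach hxr, hb, (h.reach hb).trans hbw.reachable, ?_, hbw, ⟨h2, ?_⟩, ?_, hw⟩
  · rw [h.invol x hxr]
    exact hbx.symm
  · rwa [h.invol x hxr]
  · rintro rfl
    exact hx (h.invol x hxr).symm

/-- A second neighbour of `π b` supplies the other end of the alternating path; since it can lie in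
only one of the pairs of `x` and `y`, the other pair is used on the side of `b`. -/
lemma exists_alt_of_same {x y : V} (hb : G.Reachable r b) (hbx : G.Adj b x) (hby : G.Adj b y)
    (hx : x ≠ π b) (hy : y ≠ π b) (h1 : y ≠ x) (h2 : y ≠ π x) :
    ∃ a b c, Alt G r π a b c := by
  obtain ⟨w, hw, hbw⟩ := h.second (π b) b (h.adj b hb).symm
  have hxr := hb.trans hbx.reachable
  have hyr := hb.trans hby.reachable
  by_cases hwx : w = x ∨ w = π x
  · have h3 := h.ne_pair hxr hyr h1 h2
    refine ⟨_, _, _, h.alt_of_adj hb hby hbw hy hw ?_ ?_⟩ <;> rcases hwx with rfl | rfl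
    · exact h1.symm
    · exact h2.symm
    · exact h3.1.symm
    · exact h3.2.symm
  · push Not at hwx
    exact ⟨_, _, _, h.alt_of_adj hb hbx hbw hx hw hwx.1 hwx.2⟩

lemma exists_alt_of_two {x y : V} (hb : G.Reachable r b) (hbx : G.Adj b x ∨ G.Adj (π b) x)
    (hby : G.Adj b y ∨ G.Adj (π b) y) (hx : x ≠ b ∧ x ≠ π b) (hy : y ≠ b ∧ y ≠ π b)
    (h1 : y ≠ x) (h2 : y ≠ π x) : ∃ a b c, Alt G r π a b c := by
  have hxr : G.Reachable r x := by
    rcases hbx with hbx | hbx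
    · exact hb.trans hbx.reachable
    · exact (h.reach hb).trans hbx.reachable
  have hyr : G.Reachable r y := by
    rcases hby with hby | hby
    · exact hb.trans hby.reachable
    · exact (h.reach hb).trans hby.reachable
  have h3 := h.ne_pair hxr hyr h1 h2
  rcases hbx with hbx | hbx <;> rcases hby with hby | hby
  · exact h.exists_alt_of_same hb hbx hby hx.2 hy.2 h1 h2
  · exact ⟨_, _, _, h.alt_of_adj hb hbx hby hx.2 hy.1 h1 h2⟩
  · exact ⟨_, _, _, h.alt_of_adj hb hby hbx hy.2 hx.1 h1.symm h3.1.symm⟩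
  · refine h.exists_alt_of_same (h.reach hb) hbx hby ?_ ?_ h1 h2 <;> rw [h.invol b hb]
    exacts [hx.1, hy.1]

/-- By connectedness there are two further matching edges, both attached to that of `r`, or the
second attached to the first. In either case one matching edge has two others attached to it, which
yields an alternating path on six vertices. -/
theorem length_lt (hl : l.IsChain G.Adj) (hn : l.Nodup) (hlr : ∀ v ∈ l, G.Reachable r v) :
    l.length < 7 := by
  by_contra! hlen
  have hbig : ∀ s : Finset V, s.card < 7 → ∃ v, G.Reachable r v ∧ v ∉ s := by
    intro s hs
    by_contra! hcon
    have hsub : l.toFinset ⊆ s := by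
      intro v hv
      rw [List.mem_toFinset] at hv
      exact hcon v (hlr v hv)
    have := Finset.card_le_card hsub
    rw [List.toFinset_card_of_nodup hn] at this
    omega
  obtain ⟨v, hv, hvS⟩ := hbig {r, π r} (by have := Finset.card_le_two (a := r) (b := π r); omega)
  obtain ⟨p, q, hp, hq, hpq, hrq⟩ := exists_adj_of_reachable
    (S := fun v => v ∈ ({r, π r} : Finset V)) hv (by simp) hvS
  obtain ⟨v, hv, hvS⟩ := hbig {r, π r, q, π q}
    (by have := Finset.card_le_four (a := r) (b := π r) (c := q) (d := π q); omega)
  obtain ⟨x, y, hx, hy, hxy, hry⟩ := exists_adj_of_reachable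
    (S := fun v => v ∈ ({r, π r, q, π q} : Finset V)) hv (by simp) hvS
  simp only [Finset.mem_insert, Finset.mem_singleton, not_or] at hp hq hx hy
  have hpq' : G.Adj r q ∨ G.Adj (π r) q := by
    rcases hp with rfl | rfl
    · exact Or.inl hpq
    · exact Or.inr hpq
  suffices ∃ a b c, Alt G r π a b c by
    obtain ⟨a, b, c, hA⟩ := this
    have := h.alt_not_long hA hl hn hlr
    omega
  have hr : G.Reachable r r := Reachable.refl _
  rcases hx with rfl | rfl | rfl | rfl
  · exact h.exists_alt_of_two hr hpq' (Or.inl hxy) hq ⟨hy.1, hy.2.1⟩ hy.2.2.1 hy.2.2.2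
  · exact h.exists_alt_of_two hr hpq' (Or.inr hxy) hq ⟨hy.1, hy.2.1⟩ hy.2.2.1 hy.2.2.2
  all_goals
    have hne := h.ne_pair hr hrq hq.1 hq.2
    have hne' := h.ne_pair hr hry hy.1 hy.2.1
    rcases hp with rfl | rfl
  · exact h.exists_alt_of_two hrq (Or.inl hpq.symm) (Or.inl hxy) ⟨Ne.symm hq.1, hne.1.symm⟩
      ⟨hy.2.2.1, hy.2.2.2⟩ hy.1 hy.2.1
  · refine h.exists_alt_of_two hrq (Or.inl hpq.symm) (Or.inl hxy) ⟨Ne.symm hq.2, hne.2.symm⟩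
      ⟨hy.2.2.1, hy.2.2.2⟩ hy.2.1 ?_
    rw [h.invol r hr]
    exact hy.1
  · exact h.exists_alt_of_two hrq (Or.inl hpq.symm) (Or.inr hxy) ⟨Ne.symm hq.1, hne.1.symm⟩
      ⟨hy.2.2.1, hy.2.2.2⟩ hy.1 hy.2.1
  · refine h.exists_alt_of_two hrq (Or.inl hpq.symm) (Or.inr hxy) ⟨Ne.symm hq.2, hne.2.symm⟩
      ⟨hy.2.2.1, hy.2.2.2⟩ hy.2.1 ?_
    rw [h.invol r hr]
    exact hy.1

end NoShort

/-- A component covered by a matching with at least `t + 4` edges contains no path on seven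
vertices. -/
theorem IsMatch.length_lt_of_covered (hF : ¬ HasForest G t) (hM : IsMatch G M)
    (ht : t + 4 ≤ M.card) (h2 : ∀ y x, G.Adj y x → ∃ z, z ≠ x ∧ G.Adj y z) {r : V}
    (hr : ∀ v, G.Reachable r v → ¬ Uncov M v) (hl : l.IsChain G.Adj) (hn : l.Nodup)
    (hlr : ∀ v ∈ l, G.Reachable r v) : l.length < 7 := by
  have hex : ∀ v, ∃ w, G.Reachable r v → s(v, w) ∈ M := fun v => by
    by_cases hv : G.Reachable r v
    · obtain ⟨w, hw⟩ := not_uncov_iff.1 (hr v hv)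
      exact ⟨w, fun _ => hw⟩
    · exact ⟨v, fun h => absurd h hv⟩
  choose π hπ using hex
  refine NoShort.length_lt (π := π) ⟨fun v hv => hM.adj (hπ v hv), fun v hv => ?_, h2, ?_⟩ hl hn
    hlr
  · have h1 := hπ v hv
    have h3 := hπ (π v) (hv.trans (hM.adj h1).reachable)
    rw [Sym2.eq_swap] at h1
    exact hM.eq_right h3 h1
  · intro a b c d ha hb hc hd l hl hn hlen hv
    exact hF (hM.hasForest_of_four ht (hπ a ha) (hπ b hb) (hπ c hc) (hπ d hd) hl hn hlen hv)

/-! ### Restricting and combining matchings along components -/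

/-- The edges of `M` inside a vertex set. -/
noncomputable def inside (M : Finset (Sym2 V)) (S : Finset V) : Finset (Sym2 V) :=
  M.filter fun e => ∀ v ∈ e, v ∈ S

lemma mk_mem_inside {S : Finset V} {a b : V} : s(a, b) ∈ inside M S ↔ s(a, b) ∈ M ∧ a ∈ S ∧ b ∈ S := by
  simp [inside]

lemma mem_of_mem_inside {S : Finset V} {e : Sym2 V} {v : V} (he : e ∈ inside M S) (hv : v ∈ e) :
    v ∈ S := by
  unfold inside at he
  rw [Finset.mem_filter] at he
  exact he.2 v hv

lemma inside_subset {S : Finset V} : inside M S ⊆ M := Finset.filter_subset _ _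

/-- `S` is a union of components. -/
def Closed (G : SimpleGraph V) (S : Finset V) : Prop := ∀ v w, G.Adj v w → (v ∈ S ↔ w ∈ S)

lemma Closed.reachable {S : Finset V} (hS : Closed G S) {v w : V} (h : G.Reachable v w)
    (hv : v ∈ S) : w ∈ S := by
  obtain ⟨p⟩ := h
  induction p with
  | nil => exact hv
  | cons hadj _ ih => exact ih ((hS _ _ hadj).1 hv)

lemma Closed.compl [Fintype V] {S : Finset V} (hS : Closed G S) : Closed G Sᶜ := fun v w h => by
  simp [hS v w h]

lemma reachable_of_isChain (h : l.IsChain G.Adj) {v w : V} (hv : v ∈ l) (hw : w ∈ l) :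
    G.Reachable v w := by
  refine (isChain_iff_of_closed (S := fun x => G.Reachable v x) h ?_ v hv w hw).1
    (Reachable.refl _)
  intro a _ b _ hab
  exact ⟨fun h => h.trans hab.reachable, fun h => h.trans hab.symm.reachable⟩

lemma uncov_inside {S : Finset V} (h : IsMatch G M) (hS : Closed G S) {v : V} :
    Uncov (inside M S) v ↔ v ∉ S ∨ Uncov M v := by
  constructor
  · intro hv
    by_contra! hcon
    obtain ⟨w, hw⟩ := not_uncov_iff.1 hcon.2
    exact hv.notMem (mk_mem_inside.2 ⟨hw, hcon.1, (hS _ _ (h.adj hw)).1 hcon.1⟩)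
  · rintro (hv | hv)
    · rw [uncov_iff]
      exact fun w hw => hv (mk_mem_inside.1 hw).2.1
    · exact hv.mono inside_subset

lemma IsMatch.inside {S : Finset V} (h : IsMatch G M) : IsMatch G (inside M S) :=
  h.subset inside_subset

lemma cov_inside {S : Finset V} (h : IsMatch G M) (hS : Closed G S) :
    cov (LinearForestSat.inside M S) = cov M ∩ S := by
  ext v
  rw [mem_cov, uncov_inside h hS, Finset.mem_inter, mem_cov]
  tauto

lemma two_mul_card_inside {S : Finset V} (h : IsMatch G M) (hS : Closed G S) :
    2 * (inside M S).card = (cov M ∩ S).card := by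
  rw [← cov_inside h hS, h.inside.card_cov]

/-- Combining two matchings along a union of components. -/
lemma exists_combine [Fintype V] {S : Finset V} (hM : IsMatch G M) (hN : IsMatch G N)
    (hS : Closed G S) : IsMatch G (inside M S ∪ inside N Sᶜ) ∧
      2 * (inside M S ∪ inside N Sᶜ).card = (cov M ∩ S).card + (cov N ∩ Sᶜ).card ∧
      (∀ v ∈ S, Uncov M v → Uncov (inside M S ∪ inside N Sᶜ) v) ∧
      (∀ v ∉ S, Uncov N v → Uncov (inside M S ∪ inside N Sᶜ) v) := by
  have hd : ∀ e ∈ inside M S, ∀ v ∈ e, Uncov (inside N Sᶜ) v := by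
    intro e he v hv
    rw [uncov_inside hN hS.compl]
    left
    have := mem_of_mem_inside he hv
    simpa using this
  refine ⟨hM.inside.union hN.inside hd, ?_, ?_, ?_⟩
  · rw [Finset.card_union_of_disjoint (disjoint_of_uncov hd), mul_add,
      two_mul_card_inside hM hS, two_mul_card_inside hN hS.compl]
  · intro v hv hu e he
    rcases Finset.mem_union.1 he with he | he
    · exact (uncov_inside hM hS).2 (Or.inr hu) e he
    · exact (uncov_inside hN hS.compl).2 (Or.inl (by simpa using hv)) e he
  · intro v hv hu e he
    rcases Finset.mem_union.1 he with he | he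
    · exact (uncov_inside hM hS).2 (Or.inl hv) e he
    · exact (uncov_inside hN hS.compl).2 (Or.inr hu) e he

/-- The vertex set of a component. -/
noncomputable def comp [Fintype V] (G : SimpleGraph V) (z : V) : Finset V :=
  Finset.univ.filter fun v => G.Reachable z v

lemma mem_comp [Fintype V] {z v : V} : v ∈ comp G z ↔ G.Reachable z v := by simp [comp]

lemma closed_comp [Fintype V] {z : V} : Closed G (comp G z) := by
  intro v w h
  rw [mem_comp, mem_comp]
  exact ⟨fun h' => h'.trans h.reachable, fun h' => h'.trans h.symm.reachable⟩

lemma card_comp_le_of_not_big [Fintype V] {z : V} (h : ¬ Big G z) : (comp G z).card ≤ 5 := by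
  unfold Big at h
  push Not at h
  obtain ⟨a, b, c, d, e, h⟩ := h
  refine (Finset.card_le_card (t := [a, b, c, d, e].toFinset) ?_).trans (List.toFinset_card_le _)
  intro v hv
  rw [List.mem_toFinset]
  exact h v (mem_comp.1 hv)

lemma length_le_card_comp [Fintype V] {z : V} (hn : l.Nodup) (hl : ∀ v ∈ l, G.Reachable z v) :
    l.length ≤ (comp G z).card := by
  rw [← List.toFinset_card_of_nodup hn]
  apply Finset.card_le_card
  intro v hv
  exact mem_comp.2 (hl v (List.mem_toFinset.1 hv))

/-- By Gallai's lemma `z` is the only uncovered vertex of its component. In particular the order of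
the component is odd. -/
lemma card_comp_of_missing [Fintype V] (hD : MissClosed G) (hM : MaxM G M) {z : V}
    (hz : Uncov M z) : (comp G z).card = (cov M ∩ comp G z).card + 1 := by
  have : cov M ∩ comp G z = (comp G z).erase z := by
    ext v
    rw [Finset.mem_inter, Finset.mem_erase, and_congr_left_iff]
    intro hv
    constructor
    · rintro hvM rfl
      exact notMem_cov.2 hz hvM
    · intro hvz
      rw [mem_cov, not_uncov_iff]
      exact hD.exists_mate (mem_comp.1 hv) hM hz hvz.symm
  have hzc : z ∈ comp G z := mem_comp.2 (Reachable.refl _)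
  rw [this, Finset.card_erase_of_mem hzc]
  have := Finset.card_pos.2 ⟨z, hzc⟩
  omega

/-- Every component of missable vertices contains exactly one uncovered vertex. -/
lemma MissClosed.exists_uncov [Fintype V] (hD : MissClosed G) (hM : MaxM G M) {y : V}
    (hy : Missable G y) : ∃ z, G.Reachable y z ∧ Uncov M z := by
  by_contra! hcon
  obtain ⟨N, hN, hyN⟩ := hy
  -- The matching `N`, which misses `y`, shows that the component has odd order; if `M` covered all
  -- of it, the order would be even.
  have h1 := card_comp_of_missing hD hN hyN
  have h2 := two_mul_card_inside hN.1 (closed_comp (G := G) (z := y))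
  have h3 := two_mul_card_inside hM.1 (closed_comp (G := G) (z := y))
  have h4 : cov M ∩ comp G y = comp G y := by
    rw [Finset.inter_eq_right]
    intro v hv
    exact mem_cov.2 (hcon v (mem_comp.1 hv))
  rw [h4] at h3
  omega

/-- Small components of missable vertices are complete. -/
lemma Sat.adj_of_small [Fintype V] (h : Sat G t) (hD : MissClosed G) {v w : V} (hv : Missable G v)
    (hs : ¬ Big G v) (hvw : v ≠ w) (hr : G.Reachable v w) : G.Adj v w := by
  by_contra hadj
  have hcard := card_comp_le_of_not_big hs
  rcases h.cases hvw hadj with ⟨l, M', hF, hl, hM', hvl, hwl, hMv, hMw⟩ | ⟨p, q, M', hS⟩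
  · obtain ⟨N, hN, hvN⟩ := hv
    have hlC : ∀ x ∈ l, x ∉ comp G v := by
      intro x hx hxC
      have := length_le_card_comp (z := v) hF.nodup
        fun y hy => (mem_comp.1 hxC).trans (reachable_of_isChain hF.chain hx hy)
      omega
    -- The path avoids the small component, where `M'` misses both `v` and `w`. Replacing `M'` there
    -- by `N`, which misses only `v`, gains the missing edge.
    obtain ⟨h1, h2, -, h4⟩ := exists_combine hN.1 hF.isMatch (closed_comp (G := G) (z := v))
    refine h.free (Forest.hasForest ⟨hF.chain, hF.nodup, h1,
      fun x hx => h4 x (hlC x hx) (hF.avoid x hx)⟩ hl.ge ?_)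
    have h5 := card_comp_of_missing hD hN hvN
    have h6 := two_mul_card_inside hN.1 (closed_comp (G := G) (z := v))
    have h7 := two_mul_card_inside hF.isMatch (closed_comp (G := G) (z := v))
    have h8 : (cov M' ∩ comp G v).card + 2 ≤ (comp G v).card := by
      have hsub : cov M' ∩ comp G v ⊆ ((comp G v).erase v).erase w := by
        intro x hx
        rw [Finset.mem_inter, mem_cov] at hx
        rw [Finset.mem_erase, Finset.mem_erase]
        exact ⟨fun h => hx.1 (h ▸ hMw), fun h => hx.1 (h ▸ hMv), hx.2⟩
      have := Finset.card_le_card hsub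
      rw [Finset.card_erase_of_mem, Finset.card_erase_of_mem] at this
      · have : 1 < (comp G v).card :=
          Finset.one_lt_card.2 ⟨v, mem_comp.2 (Reachable.refl _), w, mem_comp.2 hr, hvw⟩
        omega
      · exact mem_comp.2 (Reachable.refl _)
      · exact Finset.mem_erase.2 ⟨hvw.symm, mem_comp.2 hr⟩
    have h9 : 2 * M'.card = (cov M' ∩ comp G v).card + (cov M' ∩ (comp G v)ᶜ).card := by
      rw [← hF.isMatch.card_cov, ← Finset.sdiff_eq_inter_compl,
        Finset.card_inter_add_card_sdiff]
    omega
  · have := length_le_card_comp (z := v) hS.nodup fun x hx => by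
      rcases List.mem_append.1 hx with hx | hx
      · exact reachable_of_isChain hS.left (by simp) hx
      · exact hr.trans (reachable_of_isChain hS.right (by simp) hx)
    have h2 := hS.length
    simp at this
    omega

/-! ### Counting edges in the presence of two isolated vertices -/

/-- `z` is adjacent to all other vertices of its component. -/
def Dominating (G : SimpleGraph V) (z : V) : Prop := ∀ y, G.Reachable z y → y ≠ z → G.Adj z y

lemma IsFan.dominating {z : V} {π : V → V} (h : IsFan G z π) : Dominating G z :=
  fun y hy hyz => (((h y hy hyz).2.2.2 z).2 (Or.inl rfl)).symm

/-- Some maximum matching misses only dominating vertices. -/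
lemma Sat.exists_dominating [Fintype V] (h : Sat G t) (hm : ∀ M, MaxM G M → t + 3 ≤ M.card)
    (hD : MissClosed G) : ∃ M, MaxM G M ∧ ∀ z, Uncov M z → Dominating G z := by
  obtain ⟨M₀, hM₀⟩ := exists_maxM G
  -- Take a maximum matching missing as many dominating vertices as possible. If it missed a leaf of
  -- a fan, one exchange inside that triangle would expose the centre instead.
  obtain ⟨M, hM, hmax⟩ := Finset.exists_max_image
    (Finset.univ.filter fun M : Finset (Sym2 V) => MaxM G M)
    (fun M => (Finset.univ.filter fun z => Uncov M z ∧ Dominating G z).card)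
    ⟨M₀, by simpa using hM₀⟩
  simp only [Finset.mem_filter, Finset.mem_univ, true_and] at hM hmax
  refine ⟨M, hM, fun z hz => ?_⟩
  by_contra hdom
  have hzm : Missable G z := ⟨M, hM, hz⟩
  by_cases hbig : Big G z
  · obtain ⟨y, π, hzy, hfan⟩ := exists_isFan h.free hm hD hzm hbig
    have hyz : z ≠ y := by
      rintro rfl
      exact hdom hfan.dominating
    have h1 := hfan z hzy.symm hyz
    have hadj : G.Adj z (π z) := (h1.2.2.2 _).2 (Or.inr rfl)
    obtain ⟨c, hc⟩ := hM.exists_mate hz hadj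
    have h2 := hfan (π z) (hzy.symm.trans hadj.reachable) h1.1
    have hcy : c = y := by
      rcases (h2.2.2.2 c).1 (hM.1.adj hc) with rfl | rfl
      · rfl
      · rw [h1.2.2.1, Sym2.eq_swap] at hc
        exact absurd hc hz.notMem
    subst hcy
    obtain ⟨h3, h4⟩ := hM.swap hz hadj hc
    refine absurd (hmax _ h3) (not_le.2 (Finset.card_lt_card ?_))
    rw [Finset.ssubset_iff_of_subset]
    · refine ⟨c, by simpa using ⟨h4, hfan.dominating⟩, ?_⟩
      simp only [Finset.mem_filter, Finset.mem_univ, true_and, not_and]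
      rw [Sym2.eq_swap] at hc
      exact fun h => absurd hc h.notMem
    · intro x hx
      simp only [Finset.mem_filter, Finset.mem_univ, true_and] at hx ⊢
      refine ⟨uncov_swapM hx.1 ?_ ?_, hx.2⟩
      · rintro rfl
        exact hdom hx.2
      · rintro rfl
        exact absurd hc hx.1.notMem
  · exact hdom fun y hy hyz => h.adj_of_small hD hzm hbig hyz.symm hy

lemma sum_degree_eq [Fintype V] : ∑ v, G.degree v = 2 * G.edgeSet.ncard := by
  rw [sum_degrees_eq_twice_card_edges, Set.ncard_eq_toFinset_card']
  simp [edgeFinset]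

/-- Covered vertices with an uncovered neighbour can be charged to the uncovered vertices. -/
lemma sum_degree_ge [Fintype V] {S : Finset V}
    (hz : ∀ v ∈ S, ∃ z, Uncov M z ∧ G.Adj v z) :
    ∑ v ∈ cov M, G.degree v + S.card ≤ 2 * G.edgeSet.ncard := by
  rw [← sum_degree_eq, ← Finset.sum_add_sum_compl (cov M), add_le_add_iff_left]
  have : S ⊆ (cov M)ᶜ.biUnion fun z => G.neighborFinset z := by
    intro v hv
    obtain ⟨z, h1, h2⟩ := hz v hv
    rw [Finset.mem_biUnion]
    exact ⟨z, by simpa [mem_cov] using h1, by simpa using h2.symm⟩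
  exact (Finset.card_le_card this).trans Finset.card_biUnion_le

/-- The edge between two isolated vertices would be a component by itself, so it cannot belong to
the seven-vertex path. -/
lemma Sat.exists_path_of_isolated {u₁ u₂ : V} (h : Sat G t) (hu : u₁ ≠ u₂) (h1 : ∀ w, ¬ G.Adj u₁ w)
    (h2 : ∀ w, ¬ G.Adj u₂ w) : ∃ l : List V, l.IsChain G.Adj ∧ l.Nodup ∧ l.length = 7 := by
  rcases h.cases hu (h1 u₂) with ⟨l, M', hF, hl, -⟩ | ⟨p, q, M', hS⟩
  · exact ⟨l, hF.chain, hF.nodup, hl⟩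
  · exfalso
    have hlen := hS.length
    rcases p with _ | ⟨a, p⟩
    · rcases q with _ | ⟨b, q⟩
      · simp at hlen
      · exact h2 b (List.isChain_cons_cons.1 hS.right).1
    · exact h1 a (List.isChain_cons_cons.1 hS.left).1

/-- The components outside `X` have a centre `ζ`, and the remaining vertices are paired by `π`. -/
structure Fans (G : SimpleGraph V) (X : Finset V) (ζ π : V → V) : Prop where
  closed : Closed G X
  center_notMem : ∀ y ∉ X, ζ y ∉ X
  center_center : ∀ y ∉ X, ζ (ζ y) = ζ y
  not_adj_center : ∀ y ∉ X, ∀ w ∉ X, ζ y = y → ζ w = w → ¬ G.Adj y w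
  pair_notMem : ∀ y ∉ X, ζ y ≠ y → π y ∉ X
  center_pair : ∀ y ∉ X, ζ y ≠ y → ζ (π y) = ζ y
  pair_ne_center : ∀ y ∉ X, ζ y ≠ y → π y ≠ ζ y
  pair_ne : ∀ y ∉ X, ζ y ≠ y → π y ≠ y
  pair_pair : ∀ y ∉ X, ζ y ≠ y → π (π y) = y
  adj : ∀ y ∉ X, ζ y ≠ y → ∀ w, G.Adj y w ↔ w = ζ y ∨ w = π y

section TwoIsolated

variable [Fintype V] {u₁ u₂ : V}

/-- A matching avoiding part of a closed covered set. -/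
lemma MaxM.card_avoid_le {X S : Finset V} (hM : MaxM G M) (hX : Closed G X)
    (hcov : ∀ v ∈ X, ¬ Uncov M v) (hN : IsMatch G N) (hSX : S ⊆ X) (hS : ∀ v ∈ S, Uncov N v) :
    2 * N.card + S.card ≤ 2 * M.card := by
  obtain ⟨h1, h2, -⟩ := exists_combine hM.1 hN hX
  have h3 := hM.2 _ h1
  have h4 : cov M ∩ X = X := Finset.inter_eq_right.2 fun v hv => mem_cov.2 (hcov v hv)
  have h5 : 2 * N.card = (cov N ∩ X).card + (cov N ∩ Xᶜ).card := by
    rw [← hN.card_cov, ← Finset.sdiff_eq_inter_compl, Finset.card_inter_add_card_sdiff]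
  have h6 : (cov N ∩ X).card + S.card ≤ X.card := by
    rw [← Finset.card_union_of_disjoint]
    · exact Finset.card_le_card (Finset.union_subset Finset.inter_subset_right hSX)
    · rw [Finset.disjoint_left]
      intro v hv hvS
      rw [Finset.mem_inter, mem_cov] at hv
      exact hv.1 (hS v hvS)
  rw [h4] at h2
  omega

/-- The vertices outside `X` which are not centres. -/
noncomputable def leafSet (X : Finset V) (ζ : V → V) : Finset V :=
  Finset.univ.filter fun y => y ∉ X ∧ ζ y ≠ y

/-- The vertices outside `X` with the same centre as `y`. -/
noncomputable def fiberSet (X : Finset V) (ζ : V → V) (y : V) : Finset V :=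
  Finset.univ.filter fun w => w ∉ X ∧ ζ w = ζ y

lemma mem_leafSet {X : Finset V} {ζ : V → V} {y : V} :
    y ∈ leafSet X ζ ↔ y ∉ X ∧ ζ y ≠ y := by simp [leafSet]

lemma mem_fiberSet {X : Finset V} {ζ : V → V} {y w : V} :
    w ∈ fiberSet X ζ y ↔ w ∉ X ∧ ζ w = ζ y := by simp [fiberSet]

/-- The extremal graphs: an `8`-clique, and small components with centres and pairings. -/
structure Mill (G : SimpleGraph V) (t : ℕ) (X : Finset V) (ζ π : V → V) : Prop
    extends Fans G X ζ π where
  card : X.card = 8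
  clique : ∀ v ∈ X, ∀ w ∈ X, v ≠ w → G.Adj v w
  fiber : ∀ y ∉ X, (fiberSet X ζ y).card ≠ 5
  leaves : (leafSet X ζ).card + 2 = 2 * t

/-- All components are complete, and two of them have at least seven vertices. Their covered
vertices have degree at least 6 instead of 2, and there are at least six of them in each; the count
gives at least `3 * t + 30` edges. -/
lemma Sat.large_of_card_eq (h : Sat G t) (hu : u₁ ≠ u₂) (h1 : ∀ w, ¬ G.Adj u₁ w)
    (h2 : ∀ w, ¬ G.Adj u₂ w) (hM : MaxM G M) (hc : M.card = t + 2) :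
    3 * t + 25 < G.edgeSet.ncard := by
  -- The added edge must belong to the `t + 3` disjoint edges it creates; without it they form a
  -- maximum matching that misses both ends.
  have hjoint : ∀ v w, v ≠ w → ¬ G.Adj v w → Joint G v w := by
    intro v w hvw hadj
    obtain ⟨N, hN, hNc⟩ := (h.add v w hvw hadj).exists_match
    have hvwN : s(v, w) ∈ N := by
      by_contra hcon
      have := hM.2 _ (isMatch_of_sup_edge hN hcon)
      omega
    refine ⟨N.erase s(v, w), ⟨hN.erase_sup_edge, fun K hK => ?_⟩, hN.uncov_erase_left hvwN,
      hN.uncov_erase_right hvwN⟩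
    rw [Finset.card_erase_of_mem hvwN]
    have := hM.2 _ hK
    omega
  have hmiss : ∀ v, Missable G v := by
    intro v
    by_cases hv : v = u₁
    · subst hv
      obtain ⟨N, h3, h4, -⟩ := hjoint v u₂ hu (h1 u₂)
      exact ⟨N, h3, h4⟩
    · obtain ⟨N, h3, -, h4⟩ := hjoint u₁ v (Ne.symm hv) (h1 v)
      exact ⟨N, h3, h4⟩
  have hD : MissClosed G := fun _ s _ _ => hmiss s
  have hadj : ∀ v w, G.Reachable v w → v ≠ w → G.Adj v w := by
    intro v w hr hvw
    by_contra hadj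
    exact hD.not_joint hr (hmiss v) hvw (hjoint v w hvw hadj)
  -- If the new edge ended the path, the six path vertices from `x` on and the `t` single edges
  -- would contain `t + 3` disjoint edges of `G`.
  have hedge : ∀ x, (∃ y, G.Adj x y) → EdgeCase G t u₁ x := by
    intro x hx
    have hux : u₁ ≠ x := by
      rintro rfl
      obtain ⟨y, hy⟩ := hx
      exact h1 y hy
    rcases h.cases_isolated h1 hux with h3 | ⟨q, M', hS⟩
    · exact h3
    · exfalso
      have h4 : Forest G (x :: q) M' := ⟨hS.right, hS.nodup.sublist (by simp), hS.isMatch,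
        fun w hw => hS.avoid w (by simp at hw ⊢; tauto)⟩
      obtain ⟨N, h5, h6, -⟩ := h4.exists_match
      have h7 := hM.2 _ h5
      have h8 := hS.length
      have h9 := hS.card
      simp at h6 h8
      omega
  obtain ⟨l, hlc, hln, hl⟩ := h.exists_path_of_isolated hu h1 h2
  obtain ⟨x, hx⟩ := List.exists_mem_of_length_pos (l := l) (by omega)
  obtain ⟨y, -, hxy⟩ := exists_adj_of_mem_chain hlc (by omega) hx
  obtain ⟨l₂, M', hF, hl₂, hM', -, hxl, -, hxM⟩ := hedge x ⟨y, hxy⟩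
  obtain ⟨Mx, hMx, hxMx⟩ := hmiss x
  have hpar := card_comp_of_missing hD hMx hxMx
  have hpar2 := two_mul_card_inside hMx.1 (closed_comp (G := G) (z := x))
  -- The component has odd order, so the number of its vertices that `M'` misses is odd. If they
  -- included the seven path vertices and `x`, there would be a ninth, adjacent to `x`, and joining
  -- it to `x` completes a forbidden forest.
  have hsep : ∀ z ∈ l₂, ¬ G.Reachable x z := by
    intro z hz hxz
    have hpar3 := two_mul_card_inside hF.isMatch (closed_comp (G := G) (z := x))
    have hsub : l₂.toFinset ∪ {x} ⊆ comp G x \ cov M' := by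
      intro v hv
      rw [Finset.mem_sdiff, mem_comp, notMem_cov]
      rw [Finset.mem_union, List.mem_toFinset, Finset.mem_singleton] at hv
      rcases hv with hv | rfl
      · exact ⟨hxz.trans (reachable_of_isChain hF.chain hz hv), hF.avoid v hv⟩
      · exact ⟨Reachable.refl _, hxM⟩
    have hcard8 : (l₂.toFinset ∪ {x}).card = 8 := by
      rw [Finset.card_union_of_disjoint, List.toFinset_card_of_nodup hF.nodup, hl₂]
      · rfl
      · simpa using hxl
    have h3 := Finset.card_inter_add_card_sdiff (comp G x) (cov M')
    rw [Finset.inter_comm] at h3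
    have hlt : (l₂.toFinset ∪ {x}).card < (comp G x \ cov M').card := by
      have := Finset.card_le_card hsub
      omega
    obtain ⟨r, hr, hr'⟩ := Finset.exists_mem_notMem_of_card_lt_card hlt
    rw [Finset.mem_sdiff, mem_comp, notMem_cov] at hr
    rw [Finset.mem_union, List.mem_toFinset, Finset.mem_singleton, not_or] at hr'
    refine h.free ⟨l₂, insert s(x, r) M', ⟨hF.chain, hF.nodup,
      hF.isMatch.insert (hadj x r hr.1 (Ne.symm hr'.2)) hxM hr.2, ?_⟩, hl₂, ?_⟩
    · intro v hv
      rw [uncov_insert]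
      exact ⟨⟨fun h => hxl (h ▸ hv), fun h => hr'.1 (h ▸ hv)⟩, hF.avoid v hv⟩
    · rw [card_insert_uncov hxM, hM']
  obtain ⟨z, hz⟩ := List.exists_mem_of_length_pos (l := l₂) (by omega)
  have hsum := sum_degree_ge (G := G) (M := M) (S := cov M) fun v hv => by
    obtain ⟨w, hw, hwM⟩ := hD.exists_uncov hM (hmiss v)
    exact ⟨w, hwM, hadj v w hw (by rintro rfl; exact mem_cov.1 hv hwM)⟩
  have hdeg : ∀ v, (comp G v).card ≤ G.degree v + 1 := by
    intro v
    have : comp G v ⊆ insert v (G.neighborFinset v) := by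
      intro w hw
      rw [Finset.mem_insert, mem_neighborFinset]
      by_cases hwv : w = v
      · exact Or.inl hwv
      · exact Or.inr (hadj v w (mem_comp.1 hw) (Ne.symm hwv))
    exact (Finset.card_le_card this).trans (Finset.card_insert_le _ _)
  have hcx := length_le_card_comp hln fun v hv => reachable_of_isChain hlc hx hv
  have hcz := length_le_card_comp hF.nodup fun v hv => reachable_of_isChain hF.chain hz hv
  have hMcx : ∀ x, 7 ≤ (comp G x).card → 6 ≤ (cov M ∩ comp G x).card := by
    intro x hx
    obtain ⟨w, hw, hwM⟩ := hD.exists_uncov hM (hmiss x)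
    have h3 := card_comp_of_missing hD hM hwM
    have h4 : comp G w = comp G x := by
      ext v
      rw [mem_comp, mem_comp]
      exact ⟨fun h => hw.trans h, fun h => hw.symm.trans h⟩
    rw [h4] at h3
    omega
  have hlow : ∀ v ∈ cov M, 2 + 4 * (if v ∈ comp G x then 1 else 0) +
      4 * (if v ∈ comp G z then 1 else 0) ≤ G.degree v := by
    intro v hv
    have h3 : ∀ x, v ∈ comp G x → comp G v = comp G x := by
      intro x hx
      rw [mem_comp] at hx
      ext w
      rw [mem_comp, mem_comp]
      exact ⟨fun h => hx.trans h, fun h => hx.symm.trans h⟩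
    have h4 := hdeg v
    split_ifs with hvx hvz hvz
    · exact absurd ((mem_comp.1 hvx).trans (mem_comp.1 hvz).symm) (hsep z hz)
    · rw [h3 x hvx] at h4
      omega
    · rw [h3 z hvz] at h4
      omega
    · rw [mem_cov, not_uncov_iff] at hv
      obtain ⟨w, hw⟩ := hv
      obtain ⟨w', hw', hvw'⟩ := h.exists_second_neighbour h1 (hM.1.adj hw)
      have : ({w, w'} : Finset V) ⊆ G.neighborFinset v := by
        intro a ha
        rw [Finset.mem_insert, Finset.mem_singleton] at ha
        rw [mem_neighborFinset]
        rcases ha with rfl | rfl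
        · exact hM.1.adj hw
        · exact hvw'
      have := Finset.card_le_card this
      rw [Finset.card_pair (Ne.symm hw')] at this
      simpa using this
  have hlow' := Finset.sum_le_sum hlow
  simp only [Finset.sum_add_distrib, ← Finset.mul_sum, Finset.sum_boole, Finset.sum_const,
    smul_eq_mul, Finset.filter_mem_eq_inter, Nat.cast_id] at hlow'
  have h5 := hM.1.card_cov
  have h6 := hMcx x (by omega)
  have h7 := hMcx z (by omega)
  omega

/-- A saturated graph with two isolated vertices has at least `3t + 25` edges. -/
theorem Sat.large_of_isolated (h : Sat G t) (hu : u₁ ≠ u₂) (h1 : ∀ w, ¬ G.Adj u₁ w)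
    (h2 : ∀ w, ¬ G.Adj u₂ w) : 3 * t + 25 ≤ G.edgeSet.ncard ∧
      (G.edgeSet.ncard = 3 * t + 25 → ∃ X ζ π, Mill G t X ζ π) := by
  obtain ⟨M₀, hM₀⟩ := exists_maxM G
  by_cases hc : M₀.card = t + 2
  · have := h.large_of_card_eq hu h1 h2 hM₀ hc
    exact ⟨this.le, fun h => by omega⟩
  have hm : ∀ M, MaxM G M → t + 3 ≤ M.card := by
    intro M hM
    have := h.two_le hM hu (h1 u₂)
    have := hM.card_eq hM₀
    omega
  have hD : MissClosed G := fun d s hd hds => h.missable_of_adj h1 hm hd hds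
  obtain ⟨M, hM, hdom⟩ := h.exists_dominating hm hD
  -- Components of missable vertices are fans or have at most five vertices, and thus are too small
  -- for a path on seven vertices.
  have hess : ∀ l : List V, l.IsChain G.Adj → l.Nodup → l.length = 7 →
      ∀ v ∈ l, ¬ Missable G v := by
    intro l hlc hln hl v hv hvm
    have hlr : ∀ w ∈ l, G.Reachable v w := fun w hw => reachable_of_isChain hlc hv hw
    by_cases hbig : Big G v
    · obtain ⟨y, π, hvy, hfan⟩ := exists_isFan h.free hm hD hvm hbig
      have := hfan.length_le hlc hln fun w hw => hvy.symm.trans (hlr w hw)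
      omega
    · have := card_comp_le_of_not_big hbig
      have := length_le_card_comp hln hlr
      omega
  set X : Finset V := Finset.univ.filter fun v => ¬ Missable G v with hXdef
  have hmX : ∀ v, v ∈ X ↔ ¬ Missable G v := by simp [X]
  have hX : Closed G X := by
    intro v w hvw
    rw [hmX, hmX, not_iff_not]
    exact ⟨fun hv => hD v w hv hvw, fun hw => hD w v hw hvw.symm⟩
  have hXcov : ∀ v ∈ X, ¬ Uncov M v := fun v hv hvM => (hmX v).1 hv ⟨M, hM, hvM⟩
  have hXpar : 2 * (inside M X).card = X.card := by
    rw [two_mul_card_inside hM.1 hX, Finset.inter_eq_right.2 fun v hv => mem_cov.2 (hXcov v hv)]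
  obtain ⟨l, hlc, hln, hl⟩ := h.exists_path_of_isolated hu h1 h2
  have hlX : l.toFinset ⊆ X := by
    intro v hv
    exact (hmX v).2 (hess l hlc hln hl v (List.mem_toFinset.1 hv))
  have hX8 : 8 ≤ X.card := by
    have := Finset.card_le_card hlX
    rw [List.toFinset_card_of_nodup hln] at this
    omega
  -- The covered set `X` contains a path on seven vertices, which `IsMatch.length_lt_of_covered`
  -- excludes once there are `t + 4` matching edges.
  have hMc : M.card = t + 3 := by
    by_contra hne
    obtain ⟨x, hx⟩ := List.exists_mem_of_length_pos (l := l) (by omega)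
    have := hM.1.length_lt_of_covered h.free (by have := hm M hM; omega)
      (fun y x hyx => h.exists_second_neighbour h1 hyx) (r := x)
      (fun v hv => hXcov v (hX.reachable hv (hlX (List.mem_toFinset.2 hx)))) hlc hln
      (fun v hv => reachable_of_isChain hlc hx hv)
    omega
  -- A missing edge inside `X` would give `t - 1` edges missing nine vertices of `X`, or `t` edges
  -- missing seven. Since `X` is perfectly matched by `M`, either is too many for a maximum matching
  -- with `t + 3` edges.
  have hclique : ∀ v ∈ X, ∀ w ∈ X, v ≠ w → G.Adj v w := by
    intro v hv w hw hvw
    by_contra hadj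
    have key : ∀ (L : List V) (N : Finset (Sym2 V)), IsMatch G N → L.Nodup → (∀ x ∈ L, x ∈ X) →
        (∀ x ∈ L, Uncov N x) → 2 * N.card + L.length ≤ 2 * (t + 3) := by
      intro L N hN hL hLX hLN
      rw [← hMc, ← List.toFinset_card_of_nodup hL]
      exact hM.card_avoid_le hX hXcov hN (fun x hx => hLX x (List.mem_toFinset.1 hx))
        (fun x hx => hLN x (List.mem_toFinset.1 hx))
    rcases h.cases hvw hadj with ⟨l, M', hF, hl, hM', hvl, hwl, hMv, hMw⟩ | ⟨p, q, M', hS⟩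
    · have := key (v :: w :: l) M' hF.isMatch ?_ ?_ ?_
      · simp at this
        omega
      · have := hF.nodup
        simp only [List.nodup_cons, List.mem_cons, not_or]
        exact ⟨⟨hvw, hvl⟩, hwl, this⟩
      · simp only [List.mem_cons]
        rintro x (rfl | rfl | hx)
        · exact hv
        · exact hw
        · exact (hmX x).2 (hess l hF.chain hF.nodup hl x hx)
      · simp only [List.mem_cons]
        rintro x (rfl | rfl | hx)
        · exact hMv
        · exact hMw
        · exact hF.avoid x hx
    · have := key _ M' hS.isMatch hS.nodup ?_ hS.avoid
      · have h3 := hS.length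
        have h4 := hS.card
        simp at this
        omega
      · intro x hx
        rcases List.mem_append.1 hx with hx | hx
        · exact hX.reachable (reachable_of_isChain hS.left (by simp) hx) hv
        · exact hX.reachable (reachable_of_isChain hS.right (by simp) hx) hw
  -- The centre `ζ y` is the unique vertex of the component of `y` missed by `M`, and `π` is the
  -- mate in `M`; values elsewhere are placeholders.
  have hzeta : ∀ y, ∃ z, y ∉ X → G.Reachable y z ∧ Uncov M z := by
    intro y
    by_cases hy : y ∈ X
    · exact ⟨y, fun h => absurd hy h⟩
    · obtain ⟨z, hz⟩ := hD.exists_uncov hM (not_not.1 fun h' => hy ((hmX y).2 h'))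
      exact ⟨z, fun _ => hz⟩
  choose ζ hζ using hzeta
  have hpi : ∀ y, ∃ w, ¬ Uncov M y → s(y, w) ∈ M := by
    intro y
    by_cases hy : Uncov M y
    · exact ⟨y, fun h => absurd hy h⟩
    · obtain ⟨w, hw⟩ := not_uncov_iff.1 hy
      exact ⟨w, fun _ => hw⟩
  choose π hπ using hpi
  have hmissX : ∀ y ∉ X, Missable G y := fun y hy => not_not.1 fun h' => hy ((hmX y).2 h')
  have huniq : ∀ y ∉ X, ∀ z, G.Reachable y z → Uncov M z → z = ζ y := by
    intro y hy z hyz hz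
    by_contra hne
    have h3 := hζ y hy
    exact hD.not_joint (hyz.symm.trans h3.1) ⟨M, hM, hz⟩ hne ⟨M, hM, hz, h3.2⟩
  have hcovy : ∀ y ∉ X, ζ y ≠ y → ¬ Uncov M y := by
    intro y hy hne hyM
    exact hne (huniq y hy y (Reachable.refl _) hyM).symm
  have hζX : ∀ y ∉ X, ζ y ∉ X := fun y hy hz => hy (hX.reachable (hζ y hy).1.symm hz)
  have hζadj : ∀ y ∉ X, ζ y ≠ y → G.Adj y (ζ y) := fun y hy hne =>
    (hdom _ (hζ y hy).2 y (hζ y hy).1.symm hne.symm).symm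
  have hsum := sum_degree_ge (G := G) (M := M) (S := cov M \ X) fun v hv => by
    rw [Finset.mem_sdiff, mem_cov] at hv
    refine ⟨ζ v, (hζ v hv.2).2, hζadj v hv.2 ?_⟩
    intro h3
    exact hv.1 (h3 ▸ (hζ v hv.2).2)
  have hXsub : X ⊆ cov M := fun v hv => mem_cov.2 (hXcov v hv)
  rw [← Finset.sum_sdiff hXsub] at hsum
  have hdegX : ∑ v ∈ X, (X.card - 1) ≤ ∑ v ∈ X, G.degree v := by
    refine Finset.sum_le_sum fun v hv => ?_
    rw [← Finset.card_erase_of_mem hv]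
    refine Finset.card_le_card fun w hw => ?_
    rw [Finset.mem_erase] at hw
    rw [mem_neighborFinset]
    exact hclique v hv w hw.2 hw.1.symm
  rw [Finset.sum_const, smul_eq_mul] at hdegX
  have hpair : ∀ v, ¬ Uncov M v → ∀ z, Uncov M z → G.Adj v z →
      ({z, π v} : Finset V) ⊆ G.neighborFinset v ∧ ({z, π v} : Finset V).card = 2 := by
    intro v hv z hz hvz
    constructor
    · intro a ha
      rw [Finset.mem_insert, Finset.mem_singleton] at ha
      rw [mem_neighborFinset]
      rcases ha with rfl | rfl
      · exact hvz
      · exact hM.1.adj (hπ v hv)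
    · rw [Finset.card_pair]
      rintro rfl
      have := hπ v hv
      rw [Sym2.eq_swap] at this
      exact hz.notMem this
  have hdegY : ∀ v ∈ cov M \ X, 2 ≤ G.degree v := by
    intro v hv
    rw [Finset.mem_sdiff, mem_cov] at hv
    obtain ⟨h3, h4⟩ := hpair v hv.1 (ζ v) (hζ v hv.2).2
      (hζadj v hv.2 fun h3 => hv.1 (h3 ▸ (hζ v hv.2).2))
    rw [← h4]
    exact Finset.card_le_card h3
  have hsumY := Finset.sum_le_sum hdegY
  rw [Finset.sum_const, smul_eq_mul] at hsumY
  have hcardY : (cov M \ X).card + X.card = 2 * (t + 3) := by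
    rw [Finset.card_sdiff_add_card_eq_card hXsub, hM.1.card_cov, hMc]
  -- The order of `X` is even and at least seven. The resulting lower bound increases strictly with
  -- `j`, so equality forces `j = 0`.
  obtain ⟨j, hj⟩ : ∃ j, X.card = 8 + 2 * j := ⟨(X.card - 8) / 2, by omega⟩
  have hXX : X.card * (X.card - 1) = 56 + 30 * j + 4 * (j * j) := by
    rw [hj, show 8 + 2 * j - 1 = 7 + 2 * j by omega]
    ring
  rw [hXX] at hdegX
  refine ⟨by omega, fun heq => ?_⟩
  have hj0 : j = 0 := by omega
  subst hj0
  have hdeg2 : ∀ v ∈ cov M \ X, 2 = G.degree v :=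
    (Finset.sum_eq_sum_iff_of_le hdegY).1 (by
      rw [Finset.sum_const, smul_eq_mul]
      omega)
  have hadjY : ∀ y ∉ X, ζ y ≠ y → ∀ w, G.Adj y w ↔ w = ζ y ∨ w = π y := by
    intro y hy hne w
    obtain ⟨h3, h4⟩ := hpair y (hcovy y hy hne) (ζ y) (hζ y hy).2 (hζadj y hy hne)
    have h5 := hdeg2 y (by rw [Finset.mem_sdiff, mem_cov]; exact ⟨hcovy y hy hne, hy⟩)
    have h6 := Finset.eq_of_subset_of_card_le h3 (by rw [h4, h5]; rfl)
    rw [← mem_neighborFinset, ← h6, Finset.mem_insert, Finset.mem_singleton]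
  have hπadj : ∀ y ∉ X, ζ y ≠ y → G.Adj y (π y) := fun y hy hne => (hadjY y hy hne _).2 (Or.inr rfl)
  have hζreach : ∀ y ∉ X, ∀ w ∉ X, (ζ w = ζ y ↔ G.Reachable y w) := by
    intro y hy w hw
    constructor
    · intro h3
      exact (hζ y hy).1.trans (h3 ▸ (hζ w hw).1.symm)
    · intro h3
      exact huniq y hy _ (h3.trans (hζ w hw).1) (hζ w hw).2
  have hπX : ∀ y ∉ X, ζ y ≠ y → π y ∉ X := fun y hy hne h3 =>
    hy ((hX _ _ (hπadj y hy hne)).2 h3)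
  refine ⟨X, ζ, π, ⟨hX, hζX, ?_, ?_, hπX, ?_, ?_, ?_, ?_, hadjY⟩, hj, hclique, ?_, ?_⟩
  · intro y hy
    exact (hζreach y hy _ (hζX y hy)).2 (hζ y hy).1
  · intro y hy w hw h3 h4
    exact hM.not_adj (h3 ▸ (hζ y hy).2) (h4 ▸ (hζ w hw).2)
  · intro y hy hne
    exact (hζreach y hy _ (hπX y hy hne)).2 (hπadj y hy hne).reachable
  · intro y hy hne h3
    have := hπ y (hcovy y hy hne)
    rw [Sym2.eq_swap] at this
    exact (hζ y hy).2.notMem (h3 ▸ this)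
  · intro y hy hne
    exact (hπadj y hy hne).ne'
  · intro y hy hne
    have h3 := hπ y (hcovy y hy hne)
    rw [Sym2.eq_swap] at h3
    have h4 := hπ (π y) fun h4 => h4.notMem h3
    exact hM.1.eq_right h4 h3
  -- A component with five vertices is small and hence complete, so its leaves would have degree
  -- four instead of two.
  · intro y hy h5
    have hcomp : fiberSet X ζ y = comp G y := by
      ext w
      rw [mem_comp, mem_fiberSet]
      constructor
      · rintro ⟨hw, h3⟩
        exact (hζreach y hy w hw).1 h3
      · intro h3
        have hw : w ∉ X := fun hw => hy (hX.reachable h3.symm hw)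
        exact ⟨hw, (hζreach y hy w hw).2 h3⟩
    rw [hcomp] at h5
    obtain ⟨w, hw, hwz⟩ := Finset.exists_mem_ne (s := comp G y) (by omega) (ζ y)
    rw [mem_comp] at hw
    have hwX : w ∉ X := fun h3 => hy (hX.reachable hw.symm h3)
    have hζw := (hζreach y hy w hwX).2 hw
    have hne : ζ w ≠ w := by
      rw [hζw]
      exact Ne.symm hwz
    have h3 := hdeg2 w (by rw [Finset.mem_sdiff, mem_cov]; exact ⟨hcovy w hwX hne, hwX⟩)
    have hnb : ¬ Big G w := by
      intro hb
      obtain ⟨L, hL⟩ : ∃ L : List V, L.toFinset = comp G y ∧ L.length = 5 :=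
        ⟨(comp G y).toList, by simp, by simp [h5]⟩
      obtain ⟨a, b, c, d, e, rfl⟩ : ∃ a b c d e, L = [a, b, c, d, e] := by
        rcases L with _ | ⟨a, _ | ⟨b, _ | ⟨c, _ | ⟨d, _ | ⟨e, _ | _⟩⟩⟩⟩⟩ <;> simp at hL ⊢
      obtain ⟨v, hv, hv'⟩ := hb a b c d e
      rw [← List.mem_toFinset, hL.1, mem_comp] at hv'
      exact hv' (hw.trans hv)
    have h4 : (comp G y).erase w ⊆ G.neighborFinset w := by
      intro v hv
      rw [Finset.mem_erase, mem_comp] at hv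
      rw [mem_neighborFinset]
      exact h.adj_of_small hD (hmissX w hwX) hnb hv.1.symm (hw.symm.trans hv.2)
    have h6 := Finset.card_le_card h4
    rw [Finset.card_erase_of_mem (mem_comp.2 hw), h5] at h6
    have h7 : (G.neighborFinset w).card = G.degree w := rfl
    omega
  · have : leafSet X ζ = cov M \ X := by
      ext y
      rw [Finset.mem_sdiff, mem_cov, mem_leafSet]
      constructor
      · rintro ⟨hy, hne⟩
        exact ⟨hcovy y hy hne, hy⟩
      · rintro ⟨hyM, hy⟩
        exact ⟨hy, fun h3 => hyM (h3 ▸ (hζ y hy).2)⟩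
    rw [this]
    omega

end TwoIsolated

/-! ### Components with centres and pairs -/

namespace Fans

variable {X : Finset V} {ζ π : V → V} (h : Fans G X ζ π)

include h

lemma pair_ne_self_center {y : V} (hy : y ∉ X) (hne : ζ y ≠ y) : ζ (π y) ≠ π y := by
  rw [h.center_pair y hy hne]
  exact (h.pair_ne_center y hy hne).symm

lemma center_eq_of_adj {y w : V} (hy : y ∉ X) (hyw : G.Adj y w) : ζ w = ζ y := by
  have hw : w ∉ X := fun hw => hy ((h.closed _ _ hyw).2 hw)
  by_cases hy' : ζ y = y
  · have hw' : ζ w ≠ w := fun hw' => h.not_adj_center y hy w hw hy' hw' hyw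
    rcases (h.adj w hw hw' y).1 hyw.symm with h1 | h1
    · rw [hy']
      exact h1.symm
    · rw [h1, h.center_pair w hw hw']
  · rcases (h.adj y hy hy' w).1 hyw with h1 | h1
    · rw [h1, h.center_center y hy]
    · rw [h1, h.center_pair y hy hy']

lemma adj_center {y w : V} (hy : y ∉ X) (hy' : ζ y = y) :
    G.Adj y w ↔ w ∉ X ∧ ζ w = y ∧ w ≠ y := by
  constructor
  · intro hyw
    exact ⟨fun hw => hy ((h.closed _ _ hyw).2 hw), by rw [h.center_eq_of_adj hy hyw, hy'], hyw.ne'⟩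
  · rintro ⟨hw, hwy, hne⟩
    exact ((h.adj w hw (by rw [hwy]; exact hne.symm) y).2 (Or.inl hwy.symm)).symm

lemma center_eq_of_reachable {y w : V} (hy : y ∉ X) (hr : G.Reachable y w) :
    w ∉ X ∧ ζ w = ζ y := by
  obtain ⟨p⟩ := hr
  induction p with
  | nil => exact ⟨hy, rfl⟩
  | cons hadj p ih =>
    have h1 := ih fun hw => hy ((h.closed _ _ hadj).2 hw)
    exact ⟨h1.1, h1.2.trans (h.center_eq_of_adj hy hadj)⟩

lemma isFan {y : V} (hy : y ∉ X) : IsFan G (ζ y) π := by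
  intro w hr hne
  obtain ⟨hw, hζ⟩ := h.center_eq_of_reachable (h.center_notMem y hy) hr
  rw [h.center_center y hy] at hζ
  have hne' : ζ w ≠ w := by
    rw [hζ]
    exact hne.symm
  have h1 := h.pair_ne_center w hw hne'
  have h2 := h.adj w hw hne'
  rw [hζ] at h1 h2
  exact ⟨h1, h.pair_ne w hw hne', h.pair_pair w hw hne', h2⟩

lemma center_reachable {y : V} (hy : y ∉ X) : G.Reachable (ζ y) y := by
  by_cases hne : ζ y = y
  · rw [hne]
  · exact ((h.adj y hy hne _).2 (Or.inl rfl)).symm.reachable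

lemma length_le {l : List V} (hc : l.IsChain G.Adj) (hn : l.Nodup) {y : V} (hy : y ∉ X)
    (hyl : y ∈ l) : l.length ≤ 5 :=
  (h.isFan hy).length_le hc hn fun _ hv =>
    (h.center_reachable hy).trans (reachable_of_isChain hc hyl hv)

variable [Fintype V]

omit h in
/-- The matching formed by the pairs. -/
noncomputable def pairs (X : Finset V) (ζ π : V → V) : Finset (Sym2 V) :=
  (leafSet X ζ).image fun y => s(y, π y)

omit h in
lemma mk_mem_pairs {y : V} (hy : y ∉ X) (hne : ζ y ≠ y) : s(y, π y) ∈ pairs X ζ π :=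
  Finset.mem_image.2 ⟨y, mem_leafSet.2 ⟨hy, hne⟩, rfl⟩

lemma isMatch_pairs : IsMatch G (pairs X ζ π) := by
  constructor
  · intro e he
    obtain ⟨y, hy, rfl⟩ := Finset.mem_image.1 he
    rw [mem_leafSet] at hy
    exact (h.adj y hy.1 hy.2 _).2 (Or.inr rfl)
  · intro e he f hf v hve hvf
    obtain ⟨y, hy, rfl⟩ := Finset.mem_image.1 he
    obtain ⟨w, hw, rfl⟩ := Finset.mem_image.1 hf
    rw [mem_leafSet] at hy hw
    have h1 := h.pair_pair y hy.1 hy.2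
    have h2 := h.pair_pair w hw.1 hw.2
    rw [Sym2.mem_iff] at hve hvf
    rw [Sym2.eq_iff]
    grind

lemma cov_pairs : cov (pairs X ζ π) = leafSet X ζ := by
  ext v
  rw [mem_cov, not_uncov_iff]
  constructor
  · rintro ⟨w, hw⟩
    obtain ⟨y, hy, he⟩ := Finset.mem_image.1 hw
    rw [mem_leafSet] at hy
    rcases Sym2.eq_iff.1 he with ⟨rfl, rfl⟩ | ⟨rfl, rfl⟩
    · exact mem_leafSet.2 hy
    · exact mem_leafSet.2 ⟨h.pair_notMem y hy.1 hy.2, h.pair_ne_self_center hy.1 hy.2⟩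
  · intro hv
    rw [mem_leafSet] at hv
    exact ⟨π v, mk_mem_pairs hv.1 hv.2⟩

lemma two_mul_card_pairs : 2 * (pairs X ζ π).card = (leafSet X ζ).card := by
  rw [← h.isMatch_pairs.card_cov, h.cov_pairs]

lemma uncov_pairs {v : V} (hv : v ∈ X ∨ ζ v = v) : Uncov (pairs X ζ π) v := by
  rw [← notMem_cov, h.cov_pairs, mem_leafSet]
  tauto

/-- A matching outside `X` covers at most as many vertices as there are leaves. -/
lemma card_cov_le (hN : IsMatch G N) : (cov N ∩ Xᶜ).card ≤ (leafSet X ζ).card := by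
  have hmate : ∀ v, ∃ w, v ∈ cov N → s(v, w) ∈ N := fun v => by
    by_cases hv : v ∈ cov N
    · obtain ⟨w, hw⟩ := not_uncov_iff.1 (mem_cov.1 hv)
      exact ⟨w, fun _ => hw⟩
    · exact ⟨v, fun h => absurd h hv⟩
  choose μ hμ using hmate
  have key : ∀ v ∈ cov N, v ∉ X → ζ v = v →
      (μ v ∉ X ∧ ζ (μ v) ≠ μ v ∧ ζ (μ v) = v ∧ π (μ v) ∉ cov N) := by
    intro v hv hvX hζv
    have h1 := hμ v hv
    have hadj := hN.adj h1
    obtain ⟨h2, h3, h4⟩ := (h.adj_center hvX hζv).1 hadj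
    have h5 : ζ (μ v) ≠ μ v := by
      rw [h3]
      exact h4.symm
    refine ⟨h2, h5, h3, fun hcov => ?_⟩
    have h6 := hμ _ hcov
    have h7 := h.center_pair _ h2 h5
    have h8 := (h.adj _ (h.pair_notMem _ h2 h5) (h.pair_ne_self_center h2 h5) _).1 (hN.adj h6)
    rw [h.pair_pair _ h2 h5, h7, h3] at h8
    have h9 := h.pair_ne_center _ h2 h5
    have h10 := h.pair_ne _ h2 h5
    rw [Sym2.eq_swap] at h6
    rcases h8 with h8 | h8
    · rw [h8] at h6
      exact h10 (hN.eq_right h6 h1)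
    · rw [h8] at h6
      rw [Sym2.eq_swap] at h1
      have := hN.eq_right h6 h1
      rw [h3] at h9
      exact h9 this
  -- When a centre is matched to a leaf, the partner of that leaf loses both its possible mates and
  -- stays uncovered. Counting this partner in place of the centre gives an injection into the
  -- leaves.
  refine Finset.card_le_card_of_injOn (fun v => if ζ v = v then π (μ v) else v) ?_ ?_
  · intro v hv
    rw [Finset.mem_coe, Finset.mem_inter, Finset.mem_compl] at hv
    rw [Finset.mem_coe, mem_leafSet]
    dsimp only
    split_ifs with hζv
    · obtain ⟨h1, h2, -, -⟩ := key v hv.1 hv.2 hζv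
      exact ⟨h.pair_notMem _ h1 h2, h.pair_ne_self_center h1 h2⟩
    · exact ⟨hv.2, hζv⟩
  · intro v hv w hw hvw
    rw [Finset.mem_coe, Finset.mem_inter, Finset.mem_compl] at hv hw
    dsimp only at hvw
    split_ifs at hvw with h1 h2 h2
    · obtain ⟨h3, h4, h5, -⟩ := key v hv.1 hv.2 h1
      obtain ⟨h6, h7, h8, -⟩ := key w hw.1 hw.2 h2
      rw [← h5, ← h8, ← h.center_pair _ h3 h4, ← h.center_pair _ h6 h7, hvw]
    · exact absurd (hvw ▸ hw.1) (key v hv.1 hv.2 h1).2.2.2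
    · exact absurd (hvw ▸ hv.1) (key w hw.1 hw.2 h2).2.2.2
    · exact hvw

omit [Fintype V] in
/-- Uncovering a prescribed vertex of a component. -/
lemma exists_expose (hN : IsMatch G N) {w : V} (hw : w ∉ X)
    (hp : ∀ y ∉ X, ζ y ≠ y → ζ y = ζ w → s(y, π y) ∈ N) (hz : Uncov N (ζ w)) :
    ∃ N', IsMatch G N' ∧ N'.card = N.card ∧ Uncov N' w ∧
      (∀ x, x ∈ X ∨ ζ x ≠ ζ w → Uncov N x → Uncov N' x) ∧
      ∀ y ∉ X, ζ y ≠ ζ w → s(y, π y) ∈ N → s(y, π y) ∈ N' := by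
  by_cases hne : ζ w = w
  · exact ⟨N, hN, rfl, hne ▸ hz, fun _ _ h => h, fun _ _ _ h => h⟩
  · have h1 := hp w hw hne rfl
    have h2 := h.pair_notMem w hw hne
    have h3 := h.pair_ne_self_center hw hne
    have h4 := h.center_pair w hw hne
    rw [Sym2.eq_swap] at h1
    have hadj : G.Adj (ζ w) (π w) := ((h.adj _ h2 h3 _).2 (Or.inl h4.symm)).symm
    obtain ⟨h5, h6, h7⟩ := hN.swap hz hadj h1
    refine ⟨_, h5, h6, h7, ?_, ?_⟩
    · intro x hx hxN
      refine uncov_swapM hxN ?_ ?_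
      · rintro rfl
        rcases hx with hx | hx
        · exact h.center_notMem w hw hx
        · exact hx (h.center_center w hw)
      · rintro rfl
        rcases hx with hx | hx
        · exact h2 hx
        · exact hx h4
    · intro y hy hyw hyN
      refine mem_swapM hyN ?_
      intro he
      have : y ∈ s(π w, w) := he ▸ Sym2.mem_mk_left _ _
      rcases Sym2.mem_iff.1 this with rfl | rfl
      · exact hyw h4
      · exact hyw rfl

end Fans

/-! ### The extremal graphs are saturated and have `3t + 25` edges -/

namespace Mill

open Fans

variable [Fintype V] {X : Finset V} {ζ π : V → V} (h : Mill G t X ζ π)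

include h

lemma card_leafSet : (leafSet X ζ).card + 2 = 2 * t := h.leaves

/-- Outside `X` paths have at most five vertices, so the seven-vertex path lies in `X` and leaves
one vertex there. All matching edges are then outside `X`, where at most `t - 1` fit. -/
lemma not_hasForest : ¬ HasForest G t := by
  rintro ⟨l, M, hF, hl, hM⟩
  have hlX : ∀ v ∈ l, v ∈ X := by
    intro v hv
    by_contra hvX
    have := h.length_le hF.chain hF.nodup hvX hv
    omega
  have h1 : 2 * M.card = (cov M ∩ X).card + (cov M ∩ Xᶜ).card := by
    rw [← hF.isMatch.card_cov, ← Finset.sdiff_eq_inter_compl, Finset.card_inter_add_card_sdiff]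
  have h2 := h.card_cov_le hF.isMatch
  have h3 : (cov M ∩ X).card + l.toFinset.card ≤ X.card := by
    rw [← Finset.card_union_of_disjoint]
    · refine Finset.card_le_card (Finset.union_subset Finset.inter_subset_right ?_)
      intro v hv
      exact hlX v (List.mem_toFinset.1 hv)
    · rw [Finset.disjoint_left]
      intro v hv hvl
      rw [Finset.mem_inter, mem_cov] at hv
      exact hv.1 (hF.avoid v (List.mem_toFinset.1 hvl))
  -- The number of covered vertices in `X` is even and at most one, hence zero.
  have h4 := two_mul_card_inside hF.isMatch h.closed
  have h5 := h.card
  have h6 := h.card_leafSet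
  rw [List.toFinset_card_of_nodup hF.nodup] at h3
  omega

lemma isChain_of_subset {S : Finset V} (hS : S ⊆ X) : S.toList.IsChain G.Adj := by
  refine (List.Pairwise.imp_of_mem (R := fun a b => a ≠ b) ?_ S.nodup_toList).isChain
  intro a b ha hb hab
  exact h.clique a (hS (by simpa using ha)) b (hS (by simpa using hb)) hab

/-- A matching with `t - 1` edges missing two vertices in different components. -/
lemma exists_match_missing {v w : V} (hw : w ∉ X) (hvw : v ∈ X ∨ ζ v ≠ ζ w) :
    ∃ N, IsMatch G N ∧ N.card + 1 = t ∧ (∀ x ∈ X, Uncov N x) ∧ Uncov N v ∧ Uncov N w := by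
  have h1 := h.isMatch_pairs
  have h2 := h.two_mul_card_pairs
  have h3 := h.card_leafSet
  obtain ⟨N, hN, hNc, hNw, hNu, hNp⟩ := h.exists_expose h1 hw
    (fun y hy hne _ => mk_mem_pairs hy hne)
    (h.uncov_pairs (Or.inr (h.center_center w hw)))
  have hNX : ∀ x ∈ X, Uncov N x := fun x hx => hNu x (Or.inl hx) (h.uncov_pairs (Or.inl hx))
  by_cases hvX : v ∈ X
  · exact ⟨N, hN, by omega, hNX, hNX v hvX, hNw⟩
  · have hvw := hvw.resolve_left hvX
    obtain ⟨N', hN', hNc', hNv', hNu', -⟩ := h.exists_expose hN hvX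
      (fun y hy hne hyv => hNp y hy (by rw [hyv]; exact hvw) (mk_mem_pairs hy hne))
      (hNu _ (Or.inr (by rw [h.center_center v hvX]; exact hvw))
        (h.uncov_pairs (Or.inr (h.center_center v hvX))))
    exact ⟨N', hN', by omega, fun x hx => hNu' x (Or.inl hx) (hNX x hx), hNv',
      hNu' w (Or.inr hvw.symm) hNw⟩

/-- The new edge joins a matching of `t - 1` edges outside `X` missing both its ends, and `X`
without `v` still has seven vertices for the path. -/
lemma hasForest_of_ne {v w : V} (hne : v ≠ w) (hw : w ∉ X) (hvw : v ∈ X ∨ ζ v ≠ ζ w) :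
    HasForest (G ⊔ edge v w) t := by
  obtain ⟨N, hN, hNc, hNX, hNv, hNw⟩ := h.exists_match_missing hw hvw
  have h7 : 7 ≤ (X.erase v).card := by
    have := Finset.pred_card_le_card_erase (s := X) (a := v)
    rw [h.card] at this
    omega
  have hadj : (G ⊔ edge v w).Adj v w := by
    rw [sup_adj, edge_adj]
    exact Or.inr ⟨Or.inl ⟨rfl, rfl⟩, hne⟩
  refine Forest.hasForest (l := (X.erase v).toList) (M := insert s(v, w) N)
    ⟨(h.isChain_of_subset (Finset.erase_subset _ _)).imp fun _ _ h => le_sup_left (a := G) h,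
      Finset.nodup_toList _, (hN.mono le_sup_left).insert hadj hNv hNw, ?_⟩ (by simpa using h7) ?_
  · intro x hx
    rw [Finset.mem_toList, Finset.mem_erase] at hx
    rw [uncov_insert]
    exact ⟨⟨hx.1, fun hxw => hw (hxw ▸ hx.2)⟩, hNX x hx.2⟩
  · rw [card_insert_uncov hNv]
    omega

/-- Nonadjacent vertices of one fan lie in two different triangles. The new edge, these triangles
and a third one contain the seven-vertex path; it costs three pairs, while the 8-clique contributes
four edges, so `(t - 1) - 3 + 4 = t` edges remain. -/
lemma hasForest_of_eq {v w : V} (hne : v ≠ w) (hv : v ∉ X) (hw : w ∉ X) (hvw : ζ v = ζ w)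
    (hadj : ¬ G.Adj v w) : HasForest (G ⊔ edge v w) t := by
  have hv' : ζ v ≠ v := by
    intro hv'
    exact hadj ((h.adj_center hv hv').2 ⟨hw, by rw [← hvw, hv'], hne.symm⟩)
  have hw' : ζ w ≠ w := by
    intro hw'
    exact hadj ((h.adj_center hw hw').2 ⟨hv, by rw [hvw, hw'], hne⟩).symm
  have hπ : w ≠ π v := fun hπ => hadj ((h.adj v hv hv' w).2 (Or.inr hπ))
  have hπ' : v ≠ π w := by
    rintro hπ'
    apply hπ
    rw [hπ', h.pair_pair w hw hw']
  have hππ : π v ≠ π w := by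
    intro hππ
    apply hne
    rw [← h.pair_pair v hv hv', hππ, h.pair_pair w hw hw']
  have e1 := h.pair_ne_center v hv hv'
  have e2 := h.pair_ne v hv hv'
  have e3 := h.pair_ne_center w hw hw'
  have e4 := h.pair_ne w hw hw'
  -- The third triangle exists because the component does not have exactly five vertices. This is
  -- why fans with two triangles are excluded.
  obtain ⟨b, hbX, hbζ, hbm⟩ : ∃ b, b ∉ X ∧ ζ b = ζ v ∧ b ∉ ({ζ v, v, π v, w, π w} : Finset V) := by
    by_contra! hcon
    apply h.fiber v hv
    rw [show fiberSet X ζ v = {ζ v, v, π v, w, π w} from ?_]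
    · rw [Finset.card_insert_of_notMem, Finset.card_insert_of_notMem,
        Finset.card_insert_of_notMem, Finset.card_pair] <;> simp <;> grind
    · ext u
      rw [mem_fiberSet]
      constructor
      · rintro ⟨h1, h2⟩
        exact hcon u h1 h2
      · intro hu
        simp only [Finset.mem_insert, Finset.mem_singleton] at hu
        rcases hu with rfl | rfl | rfl | rfl | rfl
        · exact ⟨h.center_notMem v hv, h.center_center v hv⟩
        · exact ⟨hv, rfl⟩
        · exact ⟨h.pair_notMem v hv hv', h.center_pair v hv hv'⟩
        · exact ⟨hw, hvw.symm⟩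
        · exact ⟨h.pair_notMem w hw hw', by rw [h.center_pair w hw hw', hvw]⟩
  simp only [Finset.mem_insert, Finset.mem_singleton, not_or] at hbm
  have hb' : ζ b ≠ b := by
    rw [hbζ]
    exact Ne.symm hbm.1
  have e5 := h.pair_ne_center b hbX hb'
  have e6 := h.pair_ne b hbX hb'
  have e7 := h.pair_pair b hbX hb'
  have e8 := h.pair_pair v hv hv'
  have e9 := h.pair_pair w hw hw'
  have hle : G ≤ G ⊔ edge v w := le_sup_left
  have a1 : G.Adj b (π b) := (h.adj b hbX hb' _).2 (Or.inr rfl)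
  have a2 : G.Adj b (ζ v) := (h.adj b hbX hb' _).2 (Or.inl hbζ.symm)
  have a3 : G.Adj (π v) (ζ v) := (h.adj _ (h.pair_notMem v hv hv')
    (h.pair_ne_self_center hv hv') _).2 (Or.inl (h.center_pair v hv hv').symm)
  have a4 : G.Adj v (π v) := (h.adj v hv hv' _).2 (Or.inr rfl)
  have a5 : (G ⊔ edge v w).Adj v w := by
    rw [sup_adj, edge_adj]
    exact Or.inr ⟨Or.inl ⟨rfl, rfl⟩, hne⟩
  have a6 : G.Adj w (π w) := (h.adj w hw hw' _).2 (Or.inr rfl)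
  set S : Finset (Sym2 V) := {s(b, π b), s(v, π v), s(w, π w)} with hS
  have hunc : ∀ x, (x = ζ v ∨ (x = b ∨ x = π b) ∨ (x = v ∨ x = π v) ∨ (x = w ∨ x = π w)) →
      Uncov (pairs X ζ π \ S) x := by
    have key : ∀ u ∉ X, ζ u ≠ u → s(u, π u) ∈ S → ∀ x, (x = u ∨ x = π u) →
        Uncov (pairs X ζ π \ S) x := by
      intro u hu hu' huS x hx
      rw [uncov_iff]
      intro y hy
      rw [Finset.mem_sdiff] at hy
      have h1 := mk_mem_pairs (π := π) hu hu'
      rcases hx with rfl | rfl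
      · rw [h.isMatch_pairs.eq_right hy.1 h1] at hy
        exact hy.2 huS
      · rw [Sym2.eq_swap] at h1 huS
        rw [h.isMatch_pairs.eq_right hy.1 h1] at hy
        exact hy.2 huS
    rintro x (rfl | hx | hx | hx)
    · exact (h.uncov_pairs (Or.inr (h.center_center v hv))).mono Finset.sdiff_subset
    · exact key b hbX hb' (by simp [S]) x hx
    · exact key v hv hv' (by simp [S]) x hx
    · exact key w hw hw' (by simp [S]) x hx
  have hX : Forest G X.toList (pairs X ζ π \ S) := ⟨h.isChain_of_subset subset_rfl,
    Finset.nodup_toList _, h.isMatch_pairs.subset Finset.sdiff_subset, fun x hx =>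
      (h.uncov_pairs (Or.inl (by simpa using hx))).mono Finset.sdiff_subset⟩
  obtain ⟨N, hN, hNc, hNu, -, -⟩ := hX.exists_match
  rw [Finset.length_toList, h.card] at hNc
  refine Forest.hasForest (M := N) ⟨isChain_seven (hle a1.symm) (hle a2) (hle a3.symm)
    (hle a4.symm) a5 (hle a6), ?_, hN.mono hle, ?_⟩ (by simp) ?_
  · simp only [List.nodup_cons, List.mem_cons, List.not_mem_nil]
    rw [hbζ] at e5
    rw [← hvw] at e3
    have := h.center_notMem v hv
    grind
  · have o1 := h.center_notMem v hv
    have o2 := h.pair_notMem v hv hv'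
    have o3 := h.pair_notMem w hw hw'
    have o4 := h.pair_notMem b hbX hb'
    intro x hx
    simp only [List.mem_cons, List.not_mem_nil, or_false] at hx
    refine hNu x ?_ (hunc x (by tauto))
    rw [Finset.mem_toList]
    rcases hx with rfl | rfl | rfl | rfl | rfl | rfl | rfl <;> assumption
  · have h1 := h.two_mul_card_pairs
    have h2 := h.card_leafSet
    have h3 : S.card ≤ 3 := Finset.card_le_three
    have h4 := Finset.le_card_sdiff S (pairs X ζ π)
    omega

lemma sat : Sat G t := by
  refine ⟨h.not_hasForest, fun v w hne hadj => ?_⟩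
  by_cases hv : v ∈ X <;> by_cases hw : w ∈ X
  · exact absurd (h.clique v hv w hw hne) hadj
  · exact h.hasForest_of_ne hne hw (Or.inl hv)
  · rw [edge_comm]
    exact h.hasForest_of_ne hne.symm hv (Or.inl hw)
  · by_cases hζ : ζ v = ζ w
    · exact h.hasForest_of_eq hne hv hw hζ hadj
    · exact h.hasForest_of_ne hne hw (Or.inr hζ)

/-- The degree sum is `8 * 7` on the clique, twice the number of leaves on the leaves, and once that
number on the centres; there are `2 * t - 2` leaves. -/
lemma ncard_edgeSet : G.edgeSet.ncard = 3 * t + 25 := by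
  have h1 := sum_degree_eq (G := G)
  have hX : ∀ v ∈ X, G.degree v = 7 := by
    intro v hv
    have : G.neighborFinset v = X.erase v := by
      ext w
      rw [mem_neighborFinset, Finset.mem_erase]
      constructor
      · intro hvw
        exact ⟨hvw.ne', (h.closed _ _ hvw).1 hv⟩
      · rintro ⟨hne, hw⟩
        exact h.clique v hv w hw hne.symm
    rw [← card_neighborFinset_eq_degree, this, Finset.card_erase_of_mem hv, h.card]
  have hL : ∀ v ∈ leafSet X ζ, G.degree v = 2 := by
    intro v hv
    rw [mem_leafSet] at hv
    have : G.neighborFinset v = {ζ v, π v} := by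
      ext w
      rw [mem_neighborFinset, h.adj v hv.1 hv.2, Finset.mem_insert, Finset.mem_singleton]
    rw [← card_neighborFinset_eq_degree, this, Finset.card_pair (h.pair_ne_center v hv.1 hv.2).symm]
  have hC : ∀ v ∈ Xᶜ \ leafSet X ζ, G.degree v = ((leafSet X ζ).filter fun w => ζ w = v).card := by
    intro v hv
    rw [Finset.mem_sdiff, mem_leafSet, Finset.mem_compl] at hv
    have hv' : ζ v = v := by tauto
    rw [← card_neighborFinset_eq_degree]
    congr 1
    ext w
    rw [mem_neighborFinset, h.adj_center hv.1 hv', Finset.mem_filter, mem_leafSet]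
    constructor
    · rintro ⟨h2, h3, h4⟩
      exact ⟨⟨h2, by rw [h3]; exact h4.symm⟩, h3⟩
    · rintro ⟨⟨h2, h3⟩, h4⟩
      exact ⟨h2, h4, by rw [← h4]; exact h3.symm⟩
  have hsub : leafSet X ζ ⊆ Xᶜ := fun v hv => by
    rw [Finset.mem_compl]
    exact (mem_leafSet.1 hv).1
  have hfib : (leafSet X ζ).card =
      ∑ v ∈ Xᶜ \ leafSet X ζ, ((leafSet X ζ).filter fun w => ζ w = v).card := by
    convert Finset.card_eq_sum_card_fiberwise (f := ζ) (t := Xᶜ \ leafSet X ζ) ?_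
    intro v hv
    rw [Finset.mem_coe, mem_leafSet] at hv
    rw [Finset.mem_coe, Finset.mem_sdiff, mem_leafSet, Finset.mem_compl, h.center_center v hv.1]
    exact ⟨h.center_notMem v hv.1, by simp⟩
  rw [← Finset.sum_add_sum_compl X, ← Finset.sum_sdiff hsub, Finset.sum_congr rfl hX,
    Finset.sum_congr rfl hL, Finset.sum_congr rfl hC, ← hfib] at h1
  simp only [Finset.sum_const, smul_eq_mul, h.card] at h1
  have := h.card_leafSet
  omega

end Mill

/-! ### Matching numbers and transport along isomorphisms -/

/-- A matching as a subgraph. -/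
def IsMatch.toSubgraph (h : IsMatch G M) : G.Subgraph where
  verts := {v | ¬ Uncov M v}
  Adj a b := s(a, b) ∈ M
  adj_sub hab := h.adj hab
  edge_vert hab := not_uncov_iff.2 ⟨_, hab⟩
  symm := ⟨fun a b hab => by rwa [Sym2.eq_swap]⟩

lemma matchingNumber_eq [Finite V] (hM : MaxM G M) : matchingNumber G = M.card := by
  refine IsGreatest.csSup_eq ⟨⟨hM.1.toSubgraph, ?_, ?_⟩, ?_⟩
  · intro v hv
    obtain ⟨w, hw⟩ := not_uncov_iff.1 hv
    exact ⟨w, hw, fun w' hw' => hM.1.eq_right hw' hw⟩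
  · refine Eq.trans ?_ (Set.ncard_coe_finset M)
    congr 1
    ext e
    induction e with
    | _ a b => rfl
  · rintro m ⟨K, hK, rfl⟩
    rw [Set.ncard_eq_toFinset_card K.edgeSet (Set.toFinite _)]
    refine hM.2 _ ⟨fun e he => ?_, fun e he f hf v hve hvf => ?_⟩
    · rw [Set.Finite.mem_toFinset] at he
      exact K.edgeSet_subset he
    · rw [Set.Finite.mem_toFinset] at he hf
      obtain ⟨a, rfl⟩ := Sym2.mem_iff_exists.1 hve
      obtain ⟨b, rfl⟩ := Sym2.mem_iff_exists.1 hvf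
      rw [Subgraph.mem_edgeSet] at he hf
      rw [(hK (K.edge_vert he)).unique he hf]

lemma Fans.two_mul_matchingNumber [Fintype V] {ζ π : V → V} (h : Fans G ∅ ζ π) :
    2 * matchingNumber G = (leafSet ∅ ζ).card := by
  have hmax : MaxM G (Fans.pairs ∅ ζ π) := by
    refine ⟨h.isMatch_pairs, fun N hN => ?_⟩
    have h1 := h.card_cov_le hN
    rw [Finset.compl_empty, Finset.inter_univ, hN.card_cov, ← h.two_mul_card_pairs] at h1
    omega
  rw [matchingNumber_eq hmax, h.two_mul_card_pairs]

section Transport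

variable {G' : SimpleGraph W} {ζ π : W → W}

lemma Mill.comap [Fintype V] [Fintype W] {X : Finset W} (h : Mill G' t X ζ π) (e : G ≃g G') :
    Mill G t (X.map e.symm.toEquiv.toEmbedding) (fun v => e.symm (ζ (e v)))
      (fun v => e.symm (π (e v))) := by
  have hX : ∀ v, v ∈ X.map e.symm.toEquiv.toEmbedding ↔ e v ∈ X := by
    intro v
    rw [Finset.mem_map_equiv]
    rfl
  have he : ∀ v w, e.symm v = w ↔ v = e w := fun v w => e.toEquiv.symm_apply_eq
  have hcard : ∀ (S : Finset V) (T : Finset W), (∀ v, v ∈ S ↔ e v ∈ T) → S.card = T.card := by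
    intro S T hST
    refine Finset.card_bij (fun v _ => e v) (fun v hv => (hST v).1 hv) ?_ ?_
    · intro v _ w _ hvw
      exact e.injective hvw
    · intro w hw
      exact ⟨e.symm w, (hST _).2 (by simpa using hw), by simp⟩
  constructor
  · constructor
    · intro v w hvw
      rw [hX, hX]
      exact h.closed _ _ (e.map_rel_iff.2 hvw)
    · intro y hy
      rw [hX] at hy ⊢
      simpa using h.center_notMem _ hy
    · intro y hy
      rw [hX] at hy
      simp [h.center_center _ hy]
    · intro y hy w hw hy' hw'
      rw [hX] at hy hw
      rw [he] at hy' hw'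
      rw [← e.map_rel_iff]
      exact h.not_adj_center _ hy _ hw hy' hw'
    · intro y hy hy'
      rw [hX] at hy ⊢
      rw [Ne, he] at hy'
      simpa using h.pair_notMem _ hy hy'
    · intro y hy hy'
      rw [hX] at hy
      rw [Ne, he] at hy'
      simp [h.center_pair _ hy hy']
    · intro y hy hy'
      rw [hX] at hy
      rw [Ne, he] at hy'
      simpa using h.pair_ne_center _ hy hy'
    · intro y hy hy'
      rw [hX] at hy
      rw [Ne, he] at hy'
      rw [Ne, he]
      exact h.pair_ne _ hy hy'
    · intro y hy hy'
      rw [hX] at hy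
      rw [Ne, he] at hy'
      rw [he]
      simpa using h.pair_pair _ hy hy'
    · intro y hy hy' w
      rw [hX] at hy
      rw [Ne, he] at hy'
      rw [← e.map_rel_iff, h.adj _ hy hy', eq_comm (a := w), he, eq_comm (a := w), he,
        eq_comm (a := ζ _), eq_comm (a := π _)]
  · rw [Finset.card_map, h.card]
  · intro v hv w hw hvw
    rw [hX] at hv hw
    rw [← e.map_rel_iff]
    exact h.clique _ hv _ hw (fun h => hvw (e.injective h))
  · intro y hy
    rw [hX] at hy
    rw [hcard _ (fiberSet X ζ (e y))]
    · exact h.fiber _ hy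
    · intro v
      rw [mem_fiberSet, mem_fiberSet, hX, e.symm.injective.eq_iff]
  · rw [hcard _ (leafSet X ζ)]
    · exact h.leaves
    · intro v
      rw [mem_leafSet, mem_leafSet, hX, Ne, he]

/-- Adjacency is expressed through `X`, `ζ` and `π` alone, so a bijection compatible with these data
is a graph isomorphism. -/
lemma Fans.adj_iff {X : Finset W} (h : Fans G' X ζ π)
    (hX : ∀ v ∈ X, ∀ w ∈ X, v ≠ w → G'.Adj v w) (v w : W) :
    G'.Adj v w ↔ v ≠ w ∧ ((v ∈ X ∧ w ∈ X) ∨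
      (v ∉ X ∧ w ∉ X ∧ ζ v = ζ w ∧ (ζ v = v ∨ ζ w = w ∨ w = π v))) := by
  constructor
  · intro hvw
    refine ⟨hvw.ne, ?_⟩
    have h1 := h.closed _ _ hvw
    by_cases hv : v ∈ X
    · exact Or.inl ⟨hv, h1.1 hv⟩
    · right
      have h2 := h.center_eq_of_adj hv hvw
      refine ⟨hv, fun hw => hv (h1.2 hw), h2.symm, ?_⟩
      by_cases hv' : ζ v = v
      · exact Or.inl hv'
      · rcases (h.adj v hv hv' w).1 hvw with h3 | h3
        · exact Or.inr (Or.inl (by rw [h3, h.center_center v hv]))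
        · exact Or.inr (Or.inr h3)
  · rintro ⟨hne, ⟨hv, hw⟩ | ⟨hv, hw, h1, h2⟩⟩
    · exact hX v hv w hw hne
    · by_cases hv' : ζ v = v
      · exact (h.adj_center hv hv').2 ⟨hw, by rw [← h1, hv'], hne.symm⟩
      · rw [h.adj v hv hv']
        rcases h2 with h2 | h2 | h2
        · exact absurd h2 hv'
        · exact Or.inl (by rw [h1, h2])
        · exact Or.inr h2

end Transport

/-! ### The explicit graphs `K_8 + cK_3 + F + mK_1` -/

section Model

variable {c f : ℕ} {k : Fin f → ℕ} {m : ℕ}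

/-- The vertices of `K_8 + cK_3 + F + mK_1`. -/
abbrev ModelVertex (c : ℕ) {f : ℕ} (k : Fin f → ℕ) (m : ℕ) : Type :=
  Fin 8 ⊕ (((Fin c × Fin 3) ⊕ (Σ j : Fin f, FanVertex (k j))) ⊕ Fin m)

/-- The centre of the component of a vertex of `cK_3 + F`. -/
def modelCenter : (Fin c × Fin 3) ⊕ (Σ j : Fin f, FanVertex (k j)) →
    (Fin c × Fin 3) ⊕ (Σ j : Fin f, FanVertex (k j))
  | Sum.inl x => Sum.inl (x.1, 0)
  | Sum.inr x => Sum.inr ⟨x.1, none⟩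

/-- The pairing of the other vertices of `cK_3 + F`. -/
def modelPair : (Fin c × Fin 3) ⊕ (Σ j : Fin f, FanVertex (k j)) →
    (Fin c × Fin 3) ⊕ (Σ j : Fin f, FanVertex (k j))
  -- Negation modulo three fixes the chosen centre `0` and exchanges `1` and `2`; below, adding one
  -- in `Fin 2` exchanges the outer vertices of a blade.
  | Sum.inl x => Sum.inl (x.1, -x.2)
  | Sum.inr ⟨j, none⟩ => Sum.inr ⟨j, none⟩
  | Sum.inr ⟨j, some x⟩ => Sum.inr ⟨j, some (x.1, x.2 + 1)⟩

lemma fanUnion_adj {j : Fin f} {u : FanVertex (k j)} {b : Σ j : Fin f, FanVertex (k j)} :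
    (fanUnion k).Adj ⟨j, u⟩ b ↔ ∃ v, (fan (k j)).Adj u v ∧ b = ⟨j, v⟩ := by
  constructor
  · rintro ⟨j', u', v, h, h1, rfl⟩
    cases h1
    exact ⟨v, h, rfl⟩
  · rintro ⟨v, h, rfl⟩
    exact ⟨j, u, v, h, rfl, rfl⟩

lemma fin_two_ne_iff {a b : Fin 2} : a ≠ b ↔ b = a + 1 := by
  revert a b; decide

lemma fans_model : Fans (copies c (completeGraph (Fin 3)) ⊕g fanUnion k) ∅ modelCenter modelPair := by
  constructor
  · intro v w _
    simp
  · simp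
  · rintro (y | y) - <;> rfl
  · rintro (⟨i, a⟩ | ⟨j, u⟩) - (⟨i', a'⟩ | ⟨j', u'⟩) - h1 h2
    · simp [modelCenter] at h1 h2
      subst h1 h2
      simp [copies]
    · simp
    · simp
    · simp only [modelCenter, Sum.inr.injEq, Sigma.mk.injEq, heq_eq_eq, true_and] at h1 h2
      subst h1 h2
      simp only [sum_adj, fanUnion_adj]
      rintro ⟨v, hv, h3⟩
      cases h3
      exact hv
  · simp
  · rintro (⟨i, a⟩ | ⟨j, _ | u⟩) - - <;> rfl
  · rintro (⟨i, a⟩ | ⟨j, _ | u⟩) - h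
    · simp [modelCenter, modelPair] at h ⊢
      exact Ne.symm h
    · simp [modelCenter] at h
    · simp [modelCenter, modelPair]
  · rintro (⟨i, a⟩ | ⟨j, _ | ⟨u, b⟩⟩) - h
    · simp only [modelCenter, modelPair, ne_eq, Sum.inl.injEq, Prod.mk.injEq, true_and] at h ⊢
      revert a; decide
    · simp [modelCenter] at h
    · simp [modelPair]
  · rintro (⟨i, a⟩ | ⟨j, _ | ⟨u, b⟩⟩) - h
    · simp [modelPair]
    · rfl
    · simp only [modelPair]
      have : b + 1 + 1 = b := by clear h; revert b; decide
      rw [this]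
  · rintro (⟨i, a⟩ | ⟨j, _ | ⟨u, b⟩⟩) - h (⟨i', a'⟩ | ⟨j', u'⟩)
    · simp only [modelCenter, modelPair, ne_eq, Sum.inl.injEq, Prod.mk.injEq, true_and, sum_adj,
        copies, completeGraph, top_adj] at h ⊢
      rw [eq_comm (a := i), ← and_or_left, and_congr_right_iff]
      intro _
      revert a a'; decide
    · simp [modelCenter, modelPair]
    · simp [modelCenter] at h
    · simp [modelCenter] at h
    · simp [modelCenter, modelPair]
    · simp only [modelCenter, modelPair, Sum.inr.injEq, sum_adj, fanUnion_adj]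
      constructor
      · rintro ⟨_ | ⟨u', b'⟩, hv, h3⟩
        · exact Or.inl h3
        · right
          obtain ⟨h4, h5⟩ := hv
          simp only at h4 h5
          rw [h3, h4, fin_two_ne_iff.1 h5]
      · rintro (h3 | h3)
        · exact ⟨none, trivial, h3⟩
        · exact ⟨some (u, b + 1), ⟨rfl, fin_two_ne_iff.2 rfl⟩, h3⟩

variable {U : Type*} {H : SimpleGraph U} {ζ π : U → U}

/-- The vertices of the first summand. -/
def firstSet (A B : Type*) [Fintype A] : Finset (A ⊕ B) := Finset.univ.map Function.Embedding.inl

lemma mem_firstSet {A B : Type*} [Fintype A] {x : A ⊕ B} : x ∈ firstSet A B ↔ ∃ a, x = Sum.inl a := by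
  simp only [firstSet, Finset.mem_map, Finset.mem_univ, true_and, Function.Embedding.inl_apply,
    eq_comm]

/-- The added isolated vertices count as components consisting of a centre only. -/
lemma Fans.extend (h : Fans H ∅ ζ π) :
    Fans (completeGraph (Fin 8) ⊕g (H ⊕g emptyGraph (Fin m))) (firstSet (Fin 8) (U ⊕ Fin m))
      (Sum.map id (Sum.map ζ id)) (Sum.map id (Sum.map π id)) := by
  constructor
  · rintro (v | v) (w | w) hvw
    · simp [mem_firstSet]
    · simp at hvw
    · simp at hvw
    · simp [mem_firstSet]
  · rintro (y | y | y) hy <;> simp [mem_firstSet] at hy ⊢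
  · rintro (y | y | y) hy <;> simp [mem_firstSet, h.center_center] at hy ⊢
  · rintro (y | y | y) hy (w | w | w) hw hy' hw' <;> simp [mem_firstSet] at hy hw hy' hw' ⊢
    exact h.not_adj_center y (by simp) w (by simp) hy' hw'
  · rintro (y | y | y) hy <;> simp [mem_firstSet] at hy ⊢
  · rintro (y | y | y) hy hy' <;> simp [mem_firstSet] at hy hy' ⊢
    exact h.center_pair y (by simp) hy'
  · rintro (y | y | y) hy hy' <;> simp [mem_firstSet] at hy hy' ⊢
    exact h.pair_ne_center y (by simp) hy'
  · rintro (y | y | y) hy hy' <;> simp [mem_firstSet] at hy hy' ⊢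
    exact h.pair_ne y (by simp) hy'
  · rintro (y | y | y) hy hy' <;> simp [mem_firstSet] at hy hy' ⊢
    exact h.pair_pair y (by simp) hy'
  · rintro (y | y | y) hy hy' (w | w | w) <;> simp [mem_firstSet] at hy hy' ⊢
    exact h.adj y (by simp) hy' w

lemma card_leafSet_extend [Fintype U] (ζ : U → U) :
    (leafSet (firstSet (Fin 8) (U ⊕ Fin m)) (Sum.map id (Sum.map ζ id))).card =
      (leafSet ∅ ζ).card := by
  refine (Finset.card_bij (fun y _ => Sum.inr (Sum.inl y)) ?_ ?_ ?_).symm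
  · intro y hy
    simpa [mem_firstSet, mem_leafSet] using hy
  · intro y _ w _ hyw
    simpa using hyw
  · rintro (y | y | y) hy
    · simp [mem_leafSet] at hy
    · exact ⟨y, by simpa [mem_firstSet, mem_leafSet] using hy, rfl⟩
    · simp [mem_leafSet] at hy

/-- Outside the clique the components have order 1, 3 or at least 7, never 5, and the leaves are
twice the matching number. -/
lemma mill_model (hk : ∀ j, 7 ≤ Fintype.card (FanVertex (k j)))
    (ht : matchingNumber (copies c (completeGraph (Fin 3)) ⊕g fanUnion k) + 1 = t) :
    Mill (completeGraph (Fin 8) ⊕g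
        ((copies c (completeGraph (Fin 3)) ⊕g fanUnion k) ⊕g emptyGraph (Fin m))) t
      (firstSet (Fin 8) _) (Sum.map id (Sum.map modelCenter id))
      (Sum.map id (Sum.map modelPair id)) := by
  refine ⟨fans_model.extend, ?_, ?_, ?_, ?_⟩
  · simp [firstSet]
  · intro v hv w hw hvw
    obtain ⟨v, rfl⟩ := mem_firstSet.1 hv
    obtain ⟨w, rfl⟩ := mem_firstSet.1 hw
    simpa [completeGraph] using hvw
  · rintro (y | (⟨i, a⟩ | ⟨j, u⟩) | y) hy h5
    · simp [mem_firstSet] at hy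
    · have hsub : fiberSet (V := ModelVertex c k m) (firstSet (Fin 8) _) (Sum.map id (Sum.map modelCenter id))
          (Sum.inr (Sum.inl (Sum.inl (i, a)))) ⊆ (Finset.univ : Finset (Fin 3)).map
            ⟨fun b : Fin 3 => Sum.inr (Sum.inl (Sum.inl (i, b))), fun b b' h => by simpa using h⟩ := by
        intro w hw
        rw [mem_fiberSet] at hw
        revert hw
        rcases w with w | (⟨i', b⟩ | ⟨j, u⟩) | w <;> simp [modelCenter, mem_firstSet, eq_comm]
        rintro rfl
        exact ⟨b, rfl⟩
      have := Finset.card_le_card hsub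
      rw [h5, Finset.card_map] at this
      simp at this
    · have hsub : (Finset.univ : Finset (FanVertex (k j))).map
          ⟨fun v => Sum.inr (Sum.inl (Sum.inr ⟨j, v⟩)), fun b b' h => by simpa using h⟩ ⊆
          fiberSet (V := ModelVertex c k m) (firstSet (Fin 8) _) (Sum.map id (Sum.map modelCenter id))
            (Sum.inr (Sum.inl (Sum.inr ⟨j, u⟩))) := by
        intro w hw
        obtain ⟨v, -, rfl⟩ := Finset.mem_map.1 hw
        exact mem_fiberSet.2 ⟨by simp [mem_firstSet], rfl⟩
      have h6 := Finset.card_le_card hsub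
      rw [h5, Finset.card_map, Finset.card_univ] at h6
      have := hk j
      omega
    · have hsub : fiberSet (V := ModelVertex c k m) (firstSet (Fin 8) _) (Sum.map id (Sum.map modelCenter id))
          (Sum.inr (Sum.inr y)) ⊆ {Sum.inr (Sum.inr y)} := by
        intro w hw
        rw [mem_fiberSet] at hw
        revert hw
        rcases w with w | w | w <;> simp [mem_firstSet]
      have := Finset.card_le_card hsub
      rw [h5] at this
      simp at this
  · rw [card_leafSet_extend, ← fans_model.two_mul_matchingNumber]
    omega

end Model

/-! ### Identifying a graph with centres and pairs as an explicit one -/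

/-- A fixed-point-free involution pairs up the elements of a finite set. -/
lemma exists_pairing [Fintype V] (S : Finset V) (π : V → V) (hS : ∀ v ∈ S, π v ∈ S)
    (hne : ∀ v ∈ S, π v ≠ v) (hinv : ∀ v ∈ S, π (π v) = v) :
    ∃ (k : ℕ) (e : Fin k × Fin 2 → V), Function.Injective e ∧ (∀ v, v ∈ S ↔ ∃ p, e p = v) ∧
      ∀ p, π (e p) = e (p.1, p.2 + 1) := by
  -- An arbitrary linear order on the vertices selects the smaller element of each pair as its
  -- representative.
  let φ := Fintype.equivFin V
  let R := S.filter fun v => φ v < φ (π v)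
  have hR : ∀ v, v ∈ R ↔ v ∈ S ∧ φ v < φ (π v) := by simp [R]
  let ψ := R.equivFin.symm
  have hψ : ∀ i, (ψ i : V) ∈ S ∧ φ (ψ i) < φ (π (ψ i)) := fun i => (hR _).1 (ψ i).2
  have hψi : ∀ i j, (ψ i : V) = ψ j → i = j := fun i j hij => ψ.injective (Subtype.ext hij)
  have hψs : ∀ v, v ∈ R → ∃ i, (ψ i : V) = v := fun v hv =>
    ⟨ψ.symm ⟨v, hv⟩, by simp⟩
  refine ⟨R.card, fun p => if p.2 = 0 then ψ p.1 else π (ψ p.1), ?_, ?_, ?_⟩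
  · have key : ∀ i j, (ψ i : V) ≠ π (ψ j) := by
      intro i j hij
      have h1 := (hψ i).2
      have h2 := (hψ j).2
      rw [hij, hinv _ (hψ j).1] at h1
      exact lt_asymm h1 h2
    rintro ⟨i, a⟩ ⟨j, b⟩ hij
    dsimp only at hij
    have h01 : ∀ a : Fin 2, a ≠ 0 → a = 1 := by decide
    split_ifs at hij with ha hb hb
    · rw [hψi i j hij, ha, hb]
    · exact absurd hij (key i j)
    · exact absurd hij.symm (key j i)
    · have := congrArg π hij
      rw [hinv _ (hψ i).1, hinv _ (hψ j).1] at this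
      rw [hψi i j this, h01 a ha, h01 b hb]
  · intro v
    constructor
    · intro hv
      rcases lt_trichotomy (φ v) (φ (π v)) with h | h | h
      · obtain ⟨i, hi⟩ := hψs v ((hR v).2 ⟨hv, h⟩)
        exact ⟨(i, 0), by simpa using hi⟩
      · exact absurd (φ.injective h).symm (hne v hv)
      · obtain ⟨i, hi⟩ := hψs (π v) ((hR _).2 ⟨hS v hv, by rwa [hinv v hv]⟩)
        exact ⟨(i, 1), by simp [hi, hinv v hv]⟩
    · rintro ⟨⟨i, a⟩, rfl⟩
      dsimp only
      split_ifs
      · exact (hψ i).1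
      · exact hS _ (hψ i).1
  · rintro ⟨i, a⟩
    have h2 : a = 0 ∨ a = 1 := by revert a; decide
    rcases h2 with rfl | rfl
    · simp
    · simp [hinv _ (hψ i).1]

/-- A centre with `k` pairs is an isolated vertex for `k = 0`, belongs to a triangle for `k = 1`,
and is the centre of a fan of order at least seven for `k ≥ 3`; the value `k = 2` does not occur.
Numbering clique, centres and pairs gives the isomorphism. -/
lemma Mill.isK8K3FanGraph [Fintype V] {X : Finset V} {ζ π : V → V} (h : Mill G t X ζ π) :
    IsK8K3FanGraph t G := by
  have hpair : ∀ z, ∃ (k : ℕ) (e : Fin k × Fin 2 → V), Function.Injective e ∧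
      (∀ v, (v ∈ leafSet X ζ ∧ ζ v = z) ↔ ∃ p, e p = v) ∧ ∀ p, π (e p) = e (p.1, p.2 + 1) := by
    intro z
    have hmem : ∀ v, v ∈ (leafSet X ζ).filter (fun v => ζ v = z) ↔ v ∈ leafSet X ζ ∧ ζ v = z :=
      fun v => Finset.mem_filter
    have hmem' : ∀ v, v ∈ (leafSet X ζ).filter (fun v => ζ v = z) →
        (v ∉ X ∧ ζ v ≠ v) ∧ ζ v = z := fun v hv => by
      rwa [hmem, mem_leafSet] at hv
    obtain ⟨k, e, h1, h2, h3⟩ := exists_pairing ((leafSet X ζ).filter fun v => ζ v = z) π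
      (fun v hv => by
        have hv := hmem' v hv
        rw [hmem, mem_leafSet]
        exact ⟨⟨h.pair_notMem v hv.1.1 hv.1.2, h.pair_ne_self_center hv.1.1 hv.1.2⟩,
          by rw [h.center_pair v hv.1.1 hv.1.2, hv.2]⟩)
      (fun v hv => h.pair_ne v (hmem' v hv).1.1 (hmem' v hv).1.2)
      (fun v hv => h.pair_pair v (hmem' v hv).1.1 (hmem' v hv).1.2)
    exact ⟨k, e, h1, fun v => by rw [← h2, hmem], h3⟩
  choose k e hinj hrange hswap using hpair
  have heX : ∀ z p, e z p ∉ X ∧ ζ (e z p) = z ∧ e z p ≠ z := by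
    intro z p
    have h1 := (hrange z (e z p)).2 ⟨p, rfl⟩
    rw [mem_leafSet] at h1
    exact ⟨h1.1.1, h1.2, fun h2 => h1.1.2 (h1.2.trans h2.symm)⟩
  have hk2 : ∀ z ∉ X, ζ z = z → k z ≠ 2 := by
    intro z hz hz' hk
    apply h.fiber z hz
    have : fiberSet X ζ z = insert z (Finset.univ.map ⟨e z, hinj z⟩) := by
      ext v
      rw [mem_fiberSet, Finset.mem_insert, Finset.mem_map, hz']
      constructor
      · rintro ⟨h1, h2⟩
        by_cases hvz : v = z
        · exact Or.inl hvz
        · obtain ⟨p, hp⟩ := (hrange z v).1 ⟨mem_leafSet.2 ⟨h1, by rw [h2]; exact Ne.symm hvz⟩, h2⟩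
          exact Or.inr ⟨p, Finset.mem_univ _, hp⟩
      · rintro (rfl | ⟨p, -, rfl⟩)
        · exact ⟨hz, hz'⟩
        · exact ⟨(heX z p).1, (heX z p).2.1⟩
    rw [this, Finset.card_insert_of_notMem, Finset.card_map, Finset.card_univ]
    · simp [hk]
    · rw [Finset.mem_map]
      rintro ⟨p, -, hp⟩
      exact (heX z p).2.2 hp
  -- Centres are sorted by their number of pairs, one class for each kind of component.
  let C : (ℕ → Prop) → Type _ := fun P => {z : V // (z ∉ X ∧ ζ z = z) ∧ P (k z)}
  let ε0 := (Fintype.equivFin (C fun k => k = 0)).symm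
  let ε1 := (Fintype.equivFin (C fun k => k = 1)).symm
  let ε2 := (Fintype.equivFin (C fun k => 3 ≤ k)).symm
  let εX := (X.equivFinOfCardEq h.card).symm
  let one : ∀ i, Fin (k (ε1 i).1) := fun i => ⟨0, by rw [(ε1 i).2.2]; exact one_pos⟩
  let kk := fun j => k (ε2 j).1
  let tri : Fin _ → Fin 3 → V := fun i a =>
    if a = 0 then (ε1 i).1 else e (ε1 i).1 (one i, if a = 1 then 0 else 1)
  let blade : ∀ j, FanVertex (kk j) → V := fun j u => Option.elim u (ε2 j).1 (e (ε2 j).1)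
  let g : ModelVertex _ kk _ → V := Sum.elim (fun i => (εX i).1)
    (Sum.elim (Sum.elim (fun x => tri x.1 x.2) fun x => blade x.1 x.2) fun i => (ε0 i).1)
  have htri : ∀ i a, tri i a ∉ X ∧ ζ (tri i a) = ε1 i := by
    intro i a
    dsimp only [tri]
    split_ifs
    · exact (ε1 i).2.1
    · exact ⟨(heX _ _).1, (heX _ _).2.1⟩
    · exact ⟨(heX _ _).1, (heX _ _).2.1⟩
  have hblade : ∀ j u, blade j u ∉ X ∧ ζ (blade j u) = ε2 j := by
    rintro j (_ | p)
    · exact (ε2 j).2.1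
    · exact ⟨(heX _ _).1, (heX _ _).2.1⟩
  have hgX : ∀ x, g x ∈ X ↔ x ∈ firstSet (Fin 8) _ := by
    rintro (i | (⟨i, a⟩ | ⟨j, u⟩) | i)
    · simp [g, mem_firstSet]
    · simpa [g, mem_firstSet] using (htri i a).1
    · simpa [g, mem_firstSet] using (hblade j u).1
    · simpa [g, mem_firstSet] using (ε0 i).2.1.1
  have hgζ : ∀ x ∉ firstSet (Fin 8) _, ζ (g x) = g (Sum.map id (Sum.map modelCenter id) x) := by
    rintro (i | (⟨i, a⟩ | ⟨j, u⟩) | i) hx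
    · simp [mem_firstSet] at hx
    · exact (htri i a).2
    · exact (hblade j u).2
    · exact (ε0 i).2.1.2
  have hgπ : ∀ x ∉ firstSet (Fin 8) _, Sum.map id (Sum.map modelCenter id) x ≠ x →
      π (g x) = g (Sum.map id (Sum.map modelPair id) x) := by
    rintro (i | (⟨i, a⟩ | ⟨j, _ | u⟩) | i) hx hx'
    · simp [mem_firstSet] at hx
    · have h0 : a ≠ 0 := by
        rintro rfl
        exact hx' rfl
      have h12 : a = 1 ∨ a = 2 := by
        clear hx hx'
        revert a; decide
      rcases h12 with rfl | rfl
      · exact hswap _ _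
      · have h3 : π (e (ε1 i).1 (one i, 1)) = e (ε1 i).1 (one i, 1 + 1) := hswap _ _
        rw [show (1 : Fin 2) + 1 = 0 by decide] at h3
        exact h3
    · exact absurd rfl hx'
    · exact hswap _ _
    · exact absurd rfl hx'
  have hginj : Function.Injective g := by
    have hcat : ∀ x y, g x = g y → x ∉ firstSet (Fin 8) _ → y ∉ firstSet (Fin 8) _ →
        g (Sum.map id (Sum.map modelCenter id) x) = g (Sum.map id (Sum.map modelCenter id) y) := by
      intro x y hxy hx hy
      rw [← hgζ x hx, ← hgζ y hy, hxy]
    have hk : ∀ x y, g x = g y → x ∉ firstSet (Fin 8) _ → y ∉ firstSet (Fin 8) _ →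
        k (g (Sum.map id (Sum.map modelCenter id) x)) =
          k (g (Sum.map id (Sum.map modelCenter id) y)) := fun x y hxy hx hy => by
      rw [hcat x y hxy hx hy]
    have k1 : ∀ i, k (ε1 i).1 = 1 := fun i => (ε1 i).2.2
    have k0 : ∀ i, k (ε0 i).1 = 0 := fun i => (ε0 i).2.2
    have k2 : ∀ i, 3 ≤ k (ε2 i).1 := fun i => (ε2 i).2.2
    intro x y hxy
    by_cases hx : x ∈ firstSet (Fin 8) _
    · have hy := (hgX y).1 (hxy ▸ (hgX x).2 hx)
      obtain ⟨i, rfl⟩ := mem_firstSet.1 hx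
      obtain ⟨j, rfl⟩ := mem_firstSet.1 hy
      rw [εX.injective (Subtype.ext hxy)]
    · have hy : y ∉ firstSet (Fin 8) _ := fun hy => hx ((hgX x).1 (hxy ▸ (hgX y).2 hy))
      have h1 := hcat x y hxy hx hy
      have h2 := hk x y hxy hx hy
      rcases x with i | (⟨i, a⟩ | ⟨i, u⟩) | i
      · simp [mem_firstSet] at hx
      all_goals
        rcases y with j | (⟨j, b⟩ | ⟨j, v⟩) | j
        · simp [mem_firstSet] at hy
      · obtain rfl : i = j := ε1.injective (Subtype.ext h1)
        have h3 : tri i a = tri i b := hxy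
        have h4 : a = b := by
          have h5 := fun p => (heX (ε1 i).1 p).2.2
          have h6 := fun p q => @hinj (ε1 i).1 p q
          have h012 : ∀ a : Fin 3, a = 0 ∨ a = 1 ∨ a = 2 := by decide
          rcases h012 a with rfl | rfl | rfl <;> rcases h012 b with rfl | rfl | rfl
          · rfl
          · exact absurd h3.symm (h5 _)
          · exact absurd h3.symm (h5 _)
          · exact absurd h3 (h5 _)
          · rfl
          · exact absurd (congrArg Prod.snd (h6 (_, 0) (_, 1) h3)) zero_ne_one
          · exact absurd h3 (h5 _)
          · exact absurd (congrArg Prod.snd (h6 (_, 1) (_, 0) h3)) one_ne_zero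
          · rfl
        rw [h4]
      · have h3 : k (ε1 i).1 = k (ε2 j).1 := h2
        have := k1 i
        have := k2 j
        omega
      · have h3 : k (ε1 i).1 = k (ε0 j).1 := h2
        have := k1 i
        have := k0 j
        omega
      · have h3 : k (ε2 i).1 = k (ε1 j).1 := h2
        have := k1 j
        have := k2 i
        omega
      · obtain rfl : i = j := ε2.injective (Subtype.ext h1)
        have h3 : blade i u = blade i v := hxy
        have h5 := fun p => (heX (ε2 i).1 p).2.2
        have h4 : u = v := by
          rcases u with _ | u <;> rcases v with _ | v
          · rfl
          · exact absurd h3.symm (h5 _)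
          · exact absurd h3 (h5 _)
          · rw [hinj _ h3]
        rw [h4]
      · have h3 : k (ε2 i).1 = k (ε0 j).1 := h2
        have := k2 i
        have := k0 j
        omega
      · have h3 : k (ε0 i).1 = k (ε1 j).1 := h2
        have := k1 j
        have := k0 i
        omega
      · have h3 : k (ε0 i).1 = k (ε2 j).1 := h2
        have := k2 j
        have := k0 i
        omega
      · obtain rfl : i = j := ε0.injective (Subtype.ext h1)
        rfl
  have hgsurj : Function.Surjective g := by
    intro v
    by_cases hv : v ∈ X
    · exact ⟨Sum.inl (εX.symm ⟨v, hv⟩), by simp [g]⟩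
    · have hz := h.center_notMem v hv
      have hz' := h.center_center v hv
      have hcases : v = ζ v ∨ ∃ p, e (ζ v) p = v := by
        by_cases hne : ζ v = v
        · exact Or.inl hne.symm
        · exact Or.inr ((hrange _ _).1 ⟨mem_leafSet.2 ⟨hv, hne⟩, rfl⟩)
      have hk := hk2 _ hz hz'
      generalize ζ v = z at *
      rcases (by omega : k z = 0 ∨ k z = 1 ∨ 3 ≤ k z) with h0 | h0 | h0
      · rcases hcases with rfl | ⟨p, -⟩
        · exact ⟨Sum.inr (Sum.inr (ε0.symm ⟨v, ⟨hz, hz'⟩, h0⟩)), by simp [g]⟩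
        · rw [h0] at p
          exact p.1.elim0
      · obtain ⟨i, hi⟩ := ε1.surjective ⟨z, ⟨hz, hz'⟩, h0⟩
        have hi' : (ε1 i).1 = z := by rw [hi]
        subst hi'
        rcases hcases with hv' | ⟨⟨p, b⟩, hp⟩
        · exact ⟨Sum.inr (Sum.inl (Sum.inl (i, 0))), hv'.symm⟩
        · have hp1 : p = one i := Fin.ext (by
            have h1 := p.2
            change p.1 = 0
            omega)
          subst hp1
          have hb : b = 0 ∨ b = 1 := by
            clear hp
            revert b; decide
          rcases hb with rfl | rfl
          · exact ⟨Sum.inr (Sum.inl (Sum.inl (i, 1))), hp⟩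
          · exact ⟨Sum.inr (Sum.inl (Sum.inl (i, 2))), hp⟩
      · obtain ⟨i, hi⟩ := ε2.surjective ⟨z, ⟨hz, hz'⟩, h0⟩
        have hi' : (ε2 i).1 = z := by rw [hi]
        subst hi'
        rcases hcases with hv' | ⟨p, hp⟩
        · exact ⟨Sum.inr (Sum.inl (Sum.inr ⟨i, none⟩)), hv'.symm⟩
        · exact ⟨Sum.inr (Sum.inl (Sum.inr ⟨i, some p⟩)), hp⟩
  have hgc : ∀ x ∉ firstSet (Fin 8) _, (Sum.map id (Sum.map modelCenter id) x = x ↔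
      ζ (g x) = g x) := by
    intro x hx
    rw [hgζ x hx, hginj.eq_iff]
  have hleaf : (leafSet ∅ (modelCenter (c := Fintype.card (C fun k => k = 1)) (k := kk))).card =
      (leafSet X ζ).card := by
    rw [← card_leafSet_extend (m := Fintype.card (C fun k => k = 0))]
    refine Finset.card_bij (fun x _ => g x) ?_ (fun x _ y _ hxy => hginj hxy) ?_
    · intro x hx
      rw [mem_leafSet] at hx ⊢
      exact ⟨fun h' => hx.1 ((hgX x).1 h'), fun h' => hx.2 ((hgc x hx.1).2 h')⟩
    · intro v hv
      obtain ⟨x, rfl⟩ := hgsurj v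
      rw [mem_leafSet] at hv
      have hx : x ∉ firstSet (Fin 8) _ := fun h' => hv.1 ((hgX x).2 h')
      exact ⟨x, mem_leafSet.2 ⟨hx, fun h' => hv.2 ((hgc x hx).1 h')⟩, rfl⟩
  refine ⟨_, _, kk, _, ?_, ?_, ⟨Iso.symm ⟨Equiv.ofBijective g ⟨hginj, hgsurj⟩, ?_⟩⟩⟩
  · intro j
    have : 3 ≤ kk j := (ε2 j).2.2
    simp
    omega
  · have h1 := (fans_model (c := Fintype.card (C fun k => k = 1)) (k := kk)).two_mul_matchingNumber
    have h2 := h.card_leafSet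
    rw [hleaf] at h1
    omega
  · intro x y
    change G.Adj (g x) (g y) ↔ _
    -- Both adjacency relations are now written in terms of clique, centre and pairing, which `g`
    -- respects.
    rw [h.adj_iff h.clique, (fans_model.extend).adj_iff, hginj.ne_iff, hgX, hgX]
    · apply and_congr_right
      intro _
      apply or_congr_right
      apply and_congr_right
      intro hx
      apply and_congr_right
      intro hy
      rw [hgζ x hx, hgζ y hy, hginj.eq_iff, hginj.eq_iff, hginj.eq_iff]
      apply and_congr_right
      intro _
      by_cases hx' : Sum.map id (Sum.map modelCenter id) x = x
      · simp only [hx', true_or]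
      · rw [hgπ x hx hx', hginj.eq_iff]
    · intro v hv w hw hvw
      obtain ⟨v, rfl⟩ := mem_firstSet.1 hv
      obtain ⟨w, rfl⟩ := mem_firstSet.1 hw
      simpa [completeGraph] using hvw

lemma isK8K3FanGraph_iff [Fintype V] :
    IsK8K3FanGraph t G ↔ ∃ X ζ π, Mill G t X ζ π := by
  constructor
  · rintro ⟨c, f, k, m, hk, ht, ⟨e⟩⟩
    exact ⟨_, _, _, (mill_model hk ht).comap e⟩
  · rintro ⟨X, ζ, π, h⟩
    exact h.isK8K3FanGraph

/-! ### Rooted spanning forests and tree components -/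

lemma exists_parent {r v : V} (hr : G.Reachable r v) (hne : v ≠ r) :
    ∃ w, G.Adj v w ∧ G.dist r w + 1 = G.dist r v := by
  obtain ⟨p, hp⟩ := hr.symm.exists_walk_length_eq_dist
  cases p with
  | nil => exact absurd rfl hne
  | @cons _ w _ hadj q =>
    refine ⟨w, hadj, ?_⟩
    rw [Walk.length_cons] at hp
    have h1 := dist_le q
    have h2 := hadj.reachable.dist_triangle_left r
    rw [dist_eq_one_iff_adj.2 hadj] at h2
    rw [dist_comm (u := r) (v := w), dist_comm (u := r) (v := v)]
    omega

/-- All edges of the component of `r` join a vertex to its parent. -/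
def TreeAt (G : SimpleGraph V) (r : V) (p : V → V) : Prop :=
  ∀ v w, G.Reachable r v → G.Adj v w → (v ≠ r ∧ p v = w) ∨ (w ≠ r ∧ p w = v)

/-- A rooted spanning forest: `ρ` gives the roots and `p` the parents. -/
structure Rooted (G : SimpleGraph V) (ρ p : V → V) : Prop where
  reach : ∀ v, G.Reachable (ρ v) v
  eq : ∀ v w, G.Reachable v w → ρ v = ρ w
  leaf : ∀ v, (∃ w, G.Reachable v w ∧ ∃ x, ∀ y, G.Adj w y → y = x) →
    ∃ x, ∀ y, G.Adj (ρ v) y → y = x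
  parent : ∀ v, v ≠ ρ v → G.Adj v (p v) ∧ G.dist (ρ v) (p v) + 1 = G.dist (ρ v) v

/-- The root of a component is chosen to have at most one neighbour whenever some vertex of the
component does; parents are neighbours closer to the root. -/
lemma exists_rooted (G : SimpleGraph V) : ∃ ρ p, Rooted G ρ p := by
  have hroot : ∀ c : G.ConnectedComponent, ∃ r, G.connectedComponentMk r = c ∧
      ((∃ w, G.connectedComponentMk w = c ∧ ∃ x, ∀ y, G.Adj w y → y = x) →
        ∃ x, ∀ y, G.Adj r y → y = x) := by
    intro c
    by_cases h : ∃ w, G.connectedComponentMk w = c ∧ ∃ x, ∀ y, G.Adj w y → y = x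
    · obtain ⟨w, hw, hx⟩ := h
      exact ⟨w, hw, fun _ => hx⟩
    · induction c using ConnectedComponent.ind with
      | h v => exact ⟨v, rfl, fun h' => absurd h' h⟩
  choose r hr hl using hroot
  have hreach : ∀ v, G.Reachable (r (G.connectedComponentMk v)) v := fun v =>
    ConnectedComponent.exact (hr _)
  have hpar : ∀ v, ∃ w, v ≠ r (G.connectedComponentMk v) → G.Adj v w ∧
      G.dist (r (G.connectedComponentMk v)) w + 1 = G.dist (r (G.connectedComponentMk v)) v := by
    intro v
    by_cases hv : v = r (G.connectedComponentMk v)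
    · exact ⟨v, fun h => absurd hv h⟩
    · obtain ⟨w, hw⟩ := exists_parent (hreach v) hv
      exact ⟨w, fun _ => hw⟩
  choose p hp using hpar
  refine ⟨fun v => r (G.connectedComponentMk v), p, hreach, ?_, ?_, hp⟩
  · intro v w hvw
    simp only [ConnectedComponent.sound hvw]
  · rintro v ⟨w, hvw, hx⟩
    exact hl _ ⟨w, (ConnectedComponent.sound hvw).symm, hx⟩

namespace Rooted

variable {ρ p : V → V} (h : Rooted G ρ p)

include h

lemma eq_of_adj {v w : V} (hvw : G.Adj v w) : ρ v = ρ w := h.eq _ _ hvw.reachable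

/-- The roots of the components which are trees. -/
noncomputable def _root_.LinearForestSat.treeRoots [Fintype V] (G : SimpleGraph V) (ρ p : V → V) :
    Finset V := Finset.univ.filter fun r => ρ r = r ∧ TreeAt G r p

omit h in
lemma _root_.LinearForestSat.mem_treeRoots [Fintype V] {r : V} :
    r ∈ treeRoots G ρ p ↔ ρ r = r ∧ TreeAt G r p := by
  simp [treeRoots]

/-- Every vertex other than a root contributes the edge to its parent, and the root of a component
that is not a tree contributes an edge that is not of this kind. Only roots of trees remain
uncounted. -/
lemma card_le [Fintype V] : Fintype.card V ≤ G.edgeSet.ncard + (treeRoots G ρ p).card := by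
  have hex : ∀ r, ∃ e : Sym2 V, ¬ TreeAt G r p → ∃ v w, e = s(v, w) ∧ G.Reachable r v ∧
      G.Adj v w ∧ (v ≠ r → p v ≠ w) ∧ (w ≠ r → p w ≠ v) := by
    intro r
    by_cases hr : TreeAt G r p
    · exact ⟨s(r, r), fun h => absurd hr h⟩
    · have hr' := hr
      unfold TreeAt at hr'
      push Not at hr'
      obtain ⟨v, w, h1, h2, h3, h4⟩ := hr'
      exact ⟨s(v, w), fun _ => ⟨v, w, rfl, h1, h2, h3, h4⟩⟩
  choose ex hex using hex
  set A : Finset V := Finset.univ.filter fun v => v ≠ ρ v with hA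
  set B : Finset V := Finset.univ.filter fun r => ρ r = r ∧ ¬ TreeAt G r p with hB
  have hmA : ∀ v, v ∈ A ↔ v ≠ ρ v := by simp [A]
  have hmB : ∀ v, v ∈ B ↔ ρ v = v ∧ ¬ TreeAt G v p := by simp [B]
  have h1 : (A.image fun v => s(v, p v)).card = A.card := by
    refine Finset.card_image_of_injOn ?_
    intro v hv w hw hvw
    rw [Finset.mem_coe, hmA] at hv hw
    rcases Sym2.eq_iff.1 hvw with ⟨h1, -⟩ | ⟨h1, h2⟩
    · exact h1
    · exfalso
      obtain ⟨h3, h4⟩ := h.parent v hv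
      obtain ⟨-, h5⟩ := h.parent w hw
      rw [h2] at h3 h4
      rw [← h1, ← h.eq_of_adj h3] at h5
      omega
  have h2 : (B.image ex).card = B.card := by
    refine Finset.card_image_of_injOn ?_
    intro r hr s hs hrs
    rw [Finset.mem_coe, hmB] at hr hs
    obtain ⟨v, w, h3, h4, h5, -⟩ := hex r hr.2
    obtain ⟨v', w', h3', h4', h5', -⟩ := hex s hs.2
    rw [h3, h3'] at hrs
    rw [← hr.1, ← hs.1, h.eq _ _ h4, h.eq _ _ h4']
    rcases Sym2.eq_iff.1 hrs with ⟨rfl, -⟩ | ⟨rfl, -⟩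
    · rfl
    · exact (h.eq_of_adj h5').symm
  have h3 : Disjoint (A.image fun v => s(v, p v)) (B.image ex) := by
    rw [Finset.disjoint_left]
    intro e he he'
    obtain ⟨v, hv, rfl⟩ := Finset.mem_image.1 he
    obtain ⟨r, hr, hre⟩ := Finset.mem_image.1 he'
    rw [hmA] at hv
    rw [hmB] at hr
    obtain ⟨a, b, h4, h7, h8, h5, h6⟩ := hex r hr.2
    rw [h4] at hre
    rcases Sym2.eq_iff.1 hre with ⟨rfl, rfl⟩ | ⟨rfl, rfl⟩
    · rw [← h.eq _ _ h7, hr.1] at hv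
      exact h5 hv rfl
    · rw [← h.eq _ _ (h7.trans h8.reachable), hr.1] at hv
      exact h6 hv rfl
  have h4 : (A.image fun v => s(v, p v)) ∪ B.image ex ⊆ G.edgeSet.toFinset := by
    intro e he
    rw [Set.mem_toFinset]
    rcases Finset.mem_union.1 he with he | he
    · obtain ⟨v, hv, rfl⟩ := Finset.mem_image.1 he
      exact (h.parent v ((hmA v).1 hv)).1
    · obtain ⟨r, hr, rfl⟩ := Finset.mem_image.1 he
      obtain ⟨a, b, h4, -, h5, -⟩ := hex r ((hmB r).1 hr).2
      rw [h4]
      exact h5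
  have h5 := Finset.card_le_card h4
  rw [Finset.card_union_of_disjoint h3, h1, h2, ← Set.ncard_eq_toFinset_card'] at h5
  have h6 : Finset.univ ⊆ A ∪ (B ∪ treeRoots G ρ p) := by
    intro v _
    rw [Finset.mem_union, Finset.mem_union, hmA, hmB, mem_treeRoots]
    by_cases hv : v = ρ v
    · right
      by_cases ht : TreeAt G v p
      · exact Or.inr ⟨hv.symm, ht⟩
      · exact Or.inl ⟨hv.symm, ht⟩
    · exact Or.inl hv
  have h7 := Finset.card_le_card h6
  have h8 := Finset.card_union_le A (B ∪ treeRoots G ρ p)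
  have h9 := Finset.card_union_le B (treeRoots G ρ p)
  rw [Finset.card_univ] at h7
  omega

/-- Sizes of disjoint parts of components add up. -/
lemma sum_card_inter_le [Fintype V] (S : Finset V) :
    ∑ r ∈ treeRoots G ρ p, (S ∩ comp G r).card ≤ S.card := by
  rw [← Finset.card_biUnion]
  · apply Finset.card_le_card
    intro v hv
    obtain ⟨r, -, hv⟩ := Finset.mem_biUnion.1 hv
    exact (Finset.mem_inter.1 hv).1
  · intro r hr s hs hrs
    rw [Finset.mem_coe, mem_treeRoots] at hr hs
    rw [Function.onFun, Finset.disjoint_left]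
    intro v hv hv'
    rw [Finset.mem_inter, mem_comp] at hv hv'
    apply hrs
    rw [← hr.1, ← hs.1, h.eq _ _ hv.2, h.eq _ _ hv'.2]

end Rooted

/-! ### Stars, tips and the shape of tree components -/

/-- `c` has besides `a` only neighbours of degree one. -/
def Mid (G : SimpleGraph V) (a c : V) : Prop :=
  G.Adj a c ∧ ∀ x, G.Adj c x → x ≠ a → ∀ w, G.Adj x w → w = c

/-- All neighbours of `a` other than `b` lead only to vertices of degree one. -/
def Tip (G : SimpleGraph V) (a b : V) : Prop :=
  G.Adj a b ∧ ∀ c, G.Adj a c → c ≠ b → Mid G a c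

/-- `s` is the centre of a star. -/
def StarCenter (G : SimpleGraph V) (s : V) : Prop :=
  (∃ x, G.Adj s x) ∧ ∀ x, G.Adj s x → ∀ w, G.Adj x w → w = s

namespace Rooted

variable {ρ p : V → V} (h : Rooted G ρ p)

include h

lemma dist_adj {r v w : V} (hr : ρ r = r) (ht : TreeAt G r p) (hv : G.Reachable r v)
    (hvw : G.Adj v w) : (p v = w ∧ G.dist r w + 1 = G.dist r v) ∨
      (p w = v ∧ G.dist r v + 1 = G.dist r w) := by
  have hρ : ∀ v, G.Reachable r v → ρ v = r := fun v hv => by rw [← h.eq _ _ hv, hr]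
  have hw := hv.trans hvw.reachable
  rcases ht v w hv hvw with ⟨hne, hp⟩ | ⟨hne, hp⟩
  · left
    have := (h.parent v (by rwa [hρ v hv])).2
    rw [hρ v hv, hp] at this
    exact ⟨hp, this⟩
  · right
    have := (h.parent w (by rwa [hρ w hw])).2
    rw [hρ w hw, hp] at this
    exact ⟨hp, this⟩

lemma not_triangle {r u v w : V} (hr : ρ r = r) (ht : TreeAt G r p) (hu : G.Reachable r u)
    (huv : G.Adj u v) (hvw : G.Adj v w) (huw : G.Adj u w) : False := by
  have h1 := h.dist_adj hr ht hu huv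
  have h2 := h.dist_adj hr ht (hu.trans huv.reachable) hvw
  have h3 := h.dist_adj hr ht hu huw
  omega

/-- A tree component is a star or has a tip. -/
lemma star_or_tip [Fintype V] (hiso : ∀ v, ∃ w, G.Adj v w) {r : V}
    (hr : r ∈ treeRoots G ρ p) :
    (∃ s, G.Reachable r s ∧ StarCenter G s) ∨
      ∃ a b c x, G.Reachable r a ∧ Tip G a b ∧ G.Adj a c ∧ c ≠ b ∧ G.Adj c x ∧ x ≠ a := by
  rw [mem_treeRoots] at hr
  obtain ⟨hrr, htree⟩ := hr
  have hedge := fun v w => h.dist_adj (v := v) (w := w) hrr htree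
  obtain ⟨v₀, hv₀, hmax⟩ := Finset.exists_max_image (comp G r) (G.dist r)
    ⟨r, mem_comp.2 (Reachable.refl _)⟩
  have hmax : ∀ v, G.Reachable r v → G.dist r v ≤ G.dist r v₀ := fun v hv =>
    hmax v (mem_comp.2 hv)
  rw [mem_comp] at hv₀
  -- A deepest vertex has only its parent as neighbour, so by the choice of roots the root has at
  -- most one neighbour as well.
  obtain ⟨s, hs⟩ : ∃ x, ∀ y, G.Adj r y → y = x := by
    have := h.leaf v₀ ⟨v₀, Reachable.refl _, p v₀, fun y hy => ?_⟩
    · rwa [← h.eq _ _ hv₀, hrr] at this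
    · rcases hedge v₀ y hv₀ hy with h1 | h1
      · exact h1.1.symm
      · have := hmax y (hv₀.trans hy.reachable)
        omega
  have hrs : G.Adj r s := by
    obtain ⟨w, hw⟩ := hiso r
    rwa [hs w hw] at hw
  have hd1 : G.dist r s = 1 := dist_eq_one_iff_adj.2 hrs
  -- At depth three or more, the grandparent of a deepest vertex is a tip, since everything below it
  -- lies within two levels. At smaller depth, the only neighbour of the root is the centre of a
  -- star.
  by_cases hD : 3 ≤ G.dist r v₀
  · right
    have hstep : ∀ v, G.Reachable r v → 1 ≤ G.dist r v →
        G.Adj v (p v) ∧ G.dist r (p v) + 1 = G.dist r v := by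
      intro v hv hdv
      have hρ : ρ v = r := by rw [← h.eq _ _ hv, hrr]
      have := h.parent v (by
        rw [hρ]
        rintro rfl
        rw [dist_self] at hdv
        omega)
      rwa [hρ] at this
    obtain ⟨a1, d1⟩ := hstep v₀ hv₀ (by omega)
    have r1 := hv₀.trans a1.reachable
    obtain ⟨a2, d2⟩ := hstep _ r1 (by omega)
    have r2 := r1.trans a2.reachable
    obtain ⟨a3, d3⟩ := hstep _ r2 (by omega)
    refine ⟨p (p v₀), p (p (p v₀)), p v₀, v₀, r2, ⟨a3, fun c hc hcb => ⟨hc, fun x hx hxa w hw => ?_⟩⟩,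
      a2.symm, ?_, a1.symm, ?_⟩
    · rcases hedge _ c r2 hc with h1 | h1
      · exact absurd h1.1.symm hcb
      · have rc := r2.trans hc.reachable
        rcases hedge c x rc hx with h2 | h2
        · exact absurd (h2.1.symm.trans h1.1) hxa
        · have rx := rc.trans hx.reachable
          rcases hedge x w rx hw with h3 | h3
          · exact h3.1.symm.trans h2.1
          · have := hmax w (rx.trans hw.reachable)
            omega
    · intro he
      rw [← he] at d3
      omega
    · intro he
      rw [← he] at d2
      omega
  · left
    refine ⟨s, hrs.reachable, ⟨r, hrs.symm⟩, fun x hx w hw => ?_⟩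
    have rx := hrs.reachable.trans hx.reachable
    rcases hedge s x hrs.reachable hx with h1 | h1
    · have : r = x := rx.dist_eq_zero_iff.1 (by omega)
      subst this
      exact hs w hw
    · rcases hedge x w rx hw with h2 | h2
      · exact h2.1.symm.trans h1.1
      · have := hmax w (rx.trans hw.reachable)
        omega

end Rooted

lemma Mid.forall_mem {a d : V} (h : Mid G a d) (hc : l.IsChain G.Adj) (ha : a ∉ l) (hd : d ∈ l) :
    ∀ v ∈ l, v = d ∨ G.Adj d v := by
  intro v hv
  refine (isChain_iff_of_closed (S := fun v => v = d ∨ G.Adj d v) hc ?_ d hd v hv).1 (Or.inl rfl)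
  have key : ∀ v ∈ l, ∀ w ∈ l, G.Adj v w → (v = d ∨ G.Adj d v) → w = d ∨ G.Adj d w := by
    rintro v hv w hw hvw (rfl | hdv)
    · exact Or.inr hvw
    · exact Or.inl (h.2 v hdv (fun hva => ha (hva ▸ hv)) w hvw)
  exact fun v hv w hw hvw => ⟨key v hv w hw hvw, key w hw v hv hvw.symm⟩

lemma Tip.not_adj {a b c : V} (h : Tip G a b) (hc : G.Adj a c) (hcb : c ≠ b) : ¬ G.Adj c b := by
  intro hadj
  have := (h.2 c hc hcb).2 b hadj h.1.ne' a h.1.symm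
  exact hc.ne this

lemma Mid.eq_nil {a c x : V} {q : List V} (h : Mid G a c) (hq : (a :: c :: x :: q).IsChain G.Adj)
    (hn : (a :: c :: x :: q).Nodup) : q = [] := by
  rcases q with _ | ⟨y, q⟩
  · rfl
  · simp only [List.isChain_cons_cons] at hq
    have := h.2 x hq.2.1 (by grind) y hq.2.2.1
    grind

lemma notMem_of_neighbour {x c : V} (hx : ∀ w, G.Adj x w → w = c) (hc : l.IsChain G.Adj)
    (hl : 2 ≤ l.length) (hcl : c ∉ l) : x ∉ l := by
  intro hxl
  obtain ⟨w, hw, hxw⟩ := exists_adj_of_mem_chain hc hl hxl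
  exact hcl (hx w hxw ▸ hw)

/-- The other branch at `a`, a path leaving `b`, and a matching with `t + 4` edges. -/
lemma Sat.exists_branch (h : Sat G t) {a b c x : V} (hT : Tip G a b) (hac : G.Adj a c)
    (hcb : c ≠ b) (hcx : G.Adj c x) (hxa : x ≠ a) :
    ∃ y y' z z', (G.Adj a y ∧ y ≠ b ∧ y ≠ c ∧ G.Adj y y' ∧ y' ≠ a) ∧
      (G.Adj b z ∧ z ≠ a ∧ G.Adj z z' ∧ z' ≠ b) ∧ ∃ N, IsMatch G N ∧ N.card = t + 4 := by
  have hmid := hT.2 c hac hcb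
  have hx := hmid.2 x hcx hxa
  have hcb' := hT.not_adj hac hcb
  have hxb : x ≠ b := fun he => hcb' (he ▸ hcx)
  -- The edge `cb` is added. It cannot serve as a matching edge, because `cx` would do as well. So
  -- it lies on the path, and the rest of the proof determines how the path passes `a`.
  rcases h.cases hcb hcb' with hE | ⟨p, q, M, hS⟩
  · exact absurd (hE.hasForest_of_adj hcx fun w hw => Or.inl (hx w hw)) h.free
  have hn := hS.nodup
  have hlen := hS.length
  have hleft := hS.left
  have hright := hS.right
  have hav := hS.avoid
  have hxM : Uncov M x := hS.isMatch.uncov_of_adj fun w hw => by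
    rw [hx w hw]
    exact hav c (by simp)
  have hn1 : (c :: p).Nodup := (List.nodup_append.1 hn).1
  have hn2 : (b :: q).Nodup := (List.nodup_append.1 hn).2.1
  have hdis : ∀ v ∈ c :: p, v ∉ b :: q := fun v hv hv' => (List.nodup_append.1 hn).2.2 v hv v hv' rfl
  have hp1 : ∀ u p', p = u :: p' → u ≠ a → p' = [] := by
    rintro u p' rfl hu
    rcases p' with _ | ⟨w, p'⟩
    · rfl
    · simp only [List.isChain_cons_cons] at hleft
      have := hmid.2 u hleft.1 hu w hleft.2.1
      grind
  have hp2 : a ∉ p → p.length ≤ 1 := by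
    intro ha
    rcases p with _ | ⟨u, p⟩
    · simp
    · rw [hp1 u p rfl (fun hu => ha (by simp [hu]))]
      simp
  -- If the path beyond `b` continued with `a`, at most two vertices could follow, which makes it
  -- too short. It cannot reach `a` later, since the neighbours of `a` other than `b` do not lead
  -- back to `b` without passing `a`.
  have haq : a ∉ b :: q := by
    intro haq
    have hap : a ∉ p := fun hap => hdis a (by simp [hap]) haq
    have := hp2 hap
    have haq' : a ∈ q := by
      rcases List.mem_cons.1 haq with he | he
      · exact absurd he hT.1.ne
      · exact he
    obtain ⟨q1, q2, rfl⟩ := List.append_of_mem haq'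
    rcases List.eq_nil_or_concat q1 with rfl | ⟨q1, d, rfl⟩
    · rcases q2 with _ | ⟨e, _ | ⟨f, q2⟩⟩
      · simp at hlen; omega
      · simp at hlen; omega
      · simp only [List.nil_append] at hright hn2
        have hae := (List.isChain_cons_cons.1 (List.isChain_cons_cons.1 hright).2).1
        have := (hT.2 e hae (by grind)).eq_nil hright.tail (List.nodup_cons.1 hn2).2
        subst this
        simp at hlen
        omega
    · have hch : (b :: (q1.concat d ++ a :: q2)).IsChain G.Adj := hright
      rw [← List.cons_append, List.isChain_append] at hch
      have had : G.Adj a d := (hch.2.2 d (by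
        rw [List.concat_eq_append]
        exact List.getLast?_concat (l := b :: q1)) a (by simp)).symm
      have hdb : d ≠ b := by grind
      rcases (hT.2 d had hdb).forall_mem hch.1 (by grind) (by simp) b (by simp) with he | he
      · exact hdb he.symm
      · exact hT.not_adj had hdb he
  have hca : c ∉ b :: q := hdis c (by simp)
  have hxq : x ∉ b :: q := by
    by_cases hq : q = []
    · rw [hq]
      simpa using hxb
    · exact notMem_of_neighbour hx hright (by have := List.length_pos_iff.2 hq; simp; omega) hca
  by_cases hap : a ∈ p
  · obtain ⟨p', rfl⟩ : ∃ p', p = a :: p' := by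
      rcases p with _ | ⟨u, p'⟩
      · simp at hap
      · by_cases hu : u = a
        · exact ⟨p', by rw [hu]⟩
        · rw [hp1 u p' rfl hu] at hap
          exact absurd (by simpa using hap) (Ne.symm hu)
    -- If at most one vertex follows `a`, the path `x, c, a, b` followed by `q` already has seven
    -- vertices. Otherwise the lengths are forced: `c, a, y, y'` on one side and `b, z, z'` on the
    -- other.
    by_cases hp' : p'.length ≤ 1
    · refine absurd (Forest.hasForest (l := x :: c :: a :: b :: q) (M := M) ⟨?_, ?_, hS.isMatch, ?_⟩
        ?_ hS.card.ge) h.free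
      · simp only [List.isChain_cons_cons]
        exact ⟨hcx.symm, hac.symm, hT.1, hright⟩
      · have := hcx.ne
        have := hac.ne
        rw [List.nodup_cons, List.nodup_cons, List.nodup_cons]
        refine ⟨?_, ?_, haq, hn2⟩
        · rw [List.mem_cons, List.mem_cons]
          grind
        · rw [List.mem_cons]
          grind
      · intro v hv
        rcases List.mem_cons.1 hv with rfl | hv
        · exact hxM
        · apply hav
          simp only [List.mem_cons, List.mem_append] at hv ⊢
          tauto
      · simp at hlen ⊢
        omega
    · obtain ⟨y, y', p'', rfl⟩ : ∃ y y' p'', p' = y :: y' :: p'' := by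
        rcases p' with _ | ⟨y, _ | ⟨y', p''⟩⟩
        · simp at hp'
        · simp at hp'
        · exact ⟨y, y', p'', rfl⟩
      have hay := (List.isChain_cons_cons.1 (List.isChain_cons_cons.1 hleft).2).1
      have hyb : y ≠ b := fun he => hdis y (by simp) (by simp [he])
      have := (hT.2 y hay hyb).eq_nil hleft.tail (List.nodup_cons.1 hn1).2
      subst this
      obtain ⟨z, z', rfl⟩ : ∃ z z', q = [z, z'] := by
        rcases q with _ | ⟨z, _ | ⟨z', _ | ⟨_, _⟩⟩⟩
        · simp at hlen
        · simp at hlen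
        · exact ⟨z, z', rfl⟩
        · simp at hlen
          omega
      simp only [List.isChain_cons_cons] at hleft hright
      have hyy := hleft.2.2.1
      have hbz := hright.1
      have hzz := hright.2.1
      simp only [List.cons_append, List.nil_append, List.nodup_cons, List.mem_cons,
        List.not_mem_nil, or_false, not_or] at hn
      simp only [List.cons_append, List.nil_append, List.mem_cons, List.not_mem_nil, or_false] at hav
      have x1 : x ≠ y := by
        rintro rfl
        exact hac.ne (hx a hay.symm)
      have x2 : x ≠ y' := by
        rintro rfl
        have := hx y hyy.symm
        grind
      have x3 : x ≠ z := by
        rintro rfl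
        exact hcb (hx b hbz.symm).symm
      have x4 : x ≠ z' := by
        rintro rfl
        have := hx z hzz.symm
        grind
      -- As `x` is unused, the edges `cx`, `ab`, `yy'` and `zz'` can all be added to the `t` edges
      -- of `M`.
      have m1 := hS.isMatch.insert hcx (hav c (by simp)) hxM
      have m2 := m1.insert hT.1
        (uncov_insert.2 ⟨⟨hac.ne, hxa.symm⟩, hav a (by simp)⟩)
        (uncov_insert.2 ⟨⟨hcb.symm, hxb.symm⟩, hav b (by simp)⟩)
      have u1 : Uncov (insert s(a, b) (insert s(c, x) M)) y :=
        uncov_insert.2 ⟨⟨hay.ne', hyb⟩, uncov_insert.2 ⟨⟨by grind, x1.symm⟩, hav y (by simp)⟩⟩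
      have m3 := m2.insert hyy u1
        (uncov_insert.2 ⟨⟨by grind, by grind⟩, uncov_insert.2 ⟨⟨by grind, x2.symm⟩,
          hav y' (by simp)⟩⟩)
      have u2 : Uncov (insert s(y, y') (insert s(a, b) (insert s(c, x) M))) z :=
        uncov_insert.2 ⟨⟨by grind, by grind⟩, uncov_insert.2 ⟨⟨by grind, by grind⟩,
          uncov_insert.2 ⟨⟨by grind, x3.symm⟩, hav z (by simp)⟩⟩⟩
      have m4 := m3.insert hzz u2
        (uncov_insert.2 ⟨⟨by grind, by grind⟩, uncov_insert.2 ⟨⟨by grind, by grind⟩,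
          uncov_insert.2 ⟨⟨by grind, x4.symm⟩, hav z' (by simp)⟩⟩⟩)
      refine ⟨y, y', z, z', ⟨hay, hyb, by grind, hyy, by grind⟩, ⟨hbz, by grind, hzz, by grind⟩,
        _, m4, ?_⟩
      rw [card_insert_uncov u2, card_insert_uncov u1,
        card_insert_uncov (uncov_insert.2 ⟨⟨hac.ne, hxa.symm⟩, hav a (by simp)⟩),
        card_insert_uncov (hav c (by simp)), hS.card]
  · exfalso
    have hp := hp2 hap
    -- With `a` off the path: if it is uncovered, it can be inserted between `c` and `b`. If it is
    -- matched to `w`, the path `w, a, b` followed by `q` is long enough, and `cx` makes up for the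
    -- lost edge `aw`.
    by_cases haM : Uncov M a
    · refine h.free (Forest.hasForest (l := (c :: p).reverse ++ a :: b :: q) (M := M)
        ⟨isChain_join hac.symm hleft (List.isChain_cons_cons.2 ⟨hT.1, hright⟩), ?_, hS.isMatch, ?_⟩
        ?_ hS.card.ge)
      · have := hac.ne
        simp only [List.nodup_append, List.nodup_reverse, List.mem_reverse] at hn ⊢
        refine ⟨hn1, List.nodup_cons.2 ⟨haq, hn2⟩, ?_⟩
        grind
      · intro v hv
        by_cases hva : v = a
        · exact hva ▸ haM
        · apply hav
          simp at hv ⊢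
          tauto
      · simp
        omega
    · obtain ⟨w, hw⟩ := not_uncov_iff.1 haM
      have hwM : ∀ v, Uncov M v → v ≠ w := by
        rintro v hv rfl
        rw [Sym2.eq_swap] at hw
        exact hv.notMem hw
      have hMe : Uncov (M.erase s(a, w)) c := (hav c (by simp)).mono (Finset.erase_subset _ _)
      have hMex : Uncov (M.erase s(a, w)) x := hxM.mono (Finset.erase_subset _ _)
      refine h.free (Forest.hasForest (l := w :: a :: b :: q) (M := insert s(c, x) (M.erase s(a, w)))
        ⟨?_, ?_, (hS.isMatch.subset (Finset.erase_subset _ _)).insert hcx hMe hMex, ?_⟩ ?_ ?_)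
      · simp only [List.isChain_cons_cons]
        exact ⟨(hS.isMatch.adj hw).symm, hT.1, hright⟩
      · rw [List.nodup_cons, List.nodup_cons]
        refine ⟨?_, haq, hn2⟩
        rw [List.mem_cons, not_or]
        refine ⟨(hS.isMatch.adj hw).ne', fun hwq => hwM w (hav w ?_) rfl⟩
        rw [List.mem_append]
        exact Or.inr hwq
      · intro v hv
        rw [uncov_insert]
        rcases List.mem_cons.1 hv with rfl | hv
        · exact ⟨⟨(hwM c (hav c (by simp))).symm, (hwM x hxM).symm⟩,
            hS.isMatch.uncov_erase_right hw⟩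
        rcases List.mem_cons.1 hv with rfl | hv
        · exact ⟨⟨hac.ne, hxa.symm⟩, hS.isMatch.uncov_erase_left hw⟩
        · refine ⟨⟨fun he => hca (he ▸ hv), fun he => hxq (he ▸ hv)⟩,
            (hav v ?_).mono (Finset.erase_subset _ _)⟩
          rw [List.mem_append]
          exact Or.inr hv
      · simp
        omega
      · rw [card_insert_uncov hMe, Finset.card_erase_of_mem hw, hS.card]
        omega

/-- With a single leaf, `c` would have degree two and its neighbours `a` and `x` would be adjacent,
contrary to `x` being a leaf. -/
lemma Sat.exists_other_leaf (h : Sat G t) {a c x : V} (hm : Mid G a c) (hcx : G.Adj c x)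
    (hxa : x ≠ a) : ∃ x', x' ≠ x ∧ x' ≠ a ∧ G.Adj c x' := by
  by_contra! hcon
  have := h.adj_of_degree_two hxa hcx hm.1.symm fun w hw => by
    by_contra! hne
    exact hcon w hne.1 hne.2 hw
  exact hm.1.ne (hm.2 x hcx hxa a this)

/-- A tip in a component without triangles and without paths on seven vertices is double. -/
lemma Tip.symm_of_short {a b c x : V} (hT : Tip G a b) (hac : G.Adj a c) (hcb : c ≠ b)
    (hcx : G.Adj c x) (hxa : x ≠ a)
    (hP : ∀ l : List V, l.IsChain G.Adj → l.Nodup → a ∈ l → l.length ≠ 7)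
    (htri : ∀ u v, G.Adj b u → G.Adj u v → ¬ G.Adj b v) : Tip G b a := by
  refine ⟨hT.1.symm, fun c' hc' hca' => ⟨hc', fun x' hx' hxb' w hw => ?_⟩⟩
  by_contra hne
  have hmid := hT.2 c hac hcb
  have hx := hmid.2 x hcx hxa
  have hcb' := hT.not_adj hac hcb
  have hxb : x ≠ b := fun he => hcb' (he ▸ hcx)
  have hca : c' ≠ c := fun he => hcb' (he ▸ hc'.symm)
  have hcx' : c' ≠ x := by
    rintro rfl
    exact hcb (hx b hc'.symm).symm
  have hx1 : x' ≠ x := by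
    rintro rfl
    exact hca (hx c' hx'.symm)
  have hx2 : x' ≠ c := by
    rintro rfl
    exact hcb (hmid.2 c' hx'.symm hca' b hc'.symm).symm
  have hx3 : x' ≠ a := by
    rintro rfl
    have hcb2 : c' ≠ b := hc'.ne'
    exact hT.not_adj hx'.symm hcb2 hc'.symm
  have hw1 : w ≠ x := by
    rintro rfl
    exact hx2 (hx x' hw.symm)
  have hw2 : w ≠ c := by
    rintro rfl
    exact hca (hmid.2 x' hw.symm hx3 c' hx'.symm)
  have hw3 : w ≠ a := by
    rintro rfl
    exact hxb' ((hT.2 x' hw.symm hxb').2 c' hx'.symm hca' b hc'.symm).symm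
  have hw4 : w ≠ b := by
    rintro rfl
    exact htri c' x' hc' hx' hw.symm
  -- A branch at `b` that reaches one level further than allowed extends the path coming from the
  -- branch at `a` to seven vertices.
  refine hP [x, c, a, b, c', x', w] (isChain_seven hcx.symm hac.symm hT.1 hc' hx' hw) ?_
    (by simp) rfl
  have := hcx.ne
  have := hac.ne
  have := hT.1.ne
  have := hc'.ne
  have := hx'.ne
  have := hw.ne
  simp only [List.nodup_cons, List.mem_cons, List.not_mem_nil]
  grind

set_option maxHeartbeats 1000000 in
/-- Fourteen vertices and five disjoint edges in a tree without paths on seven vertices. -/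
lemma Sat.exists_fourteen (h : Sat G t) {a b c x : V} (hT : Tip G a b) (hT' : Tip G b a)
    (hac : G.Adj a c) (hcb : c ≠ b) (hcx : G.Adj c x) (hxa : x ≠ a) :
    (∃ L : List V, L.Nodup ∧ L.length = 14 ∧ ∀ v ∈ L, G.Reachable a v) ∧
      ∃ K, IsMatch G K ∧ K.card = 5 ∧ ∀ v, ¬ Uncov K v → G.Reachable a v := by
  obtain ⟨y, y₁, z, z₁, ⟨hay, hyb, hyc, hy₁, hya⟩, ⟨hbz, hza, hz₁, hzb⟩, -⟩ :=
    h.exists_branch hT hac hcb hcx hxa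
  -- Used from both ends, `exists_branch` gives two further neighbours at each of `a` and `b`. Each
  -- of these four carries at least two leaves, so there are `2 + 4 + 8` vertices.
  obtain ⟨w, w₁, -, -, ⟨hbw, hwa, hwz, hw₁, hwb⟩, -, -⟩ := h.exists_branch hT' hbz hza hz₁ hzb
  have mc := hT.2 c hac hcb
  have my := hT.2 y hay hyb
  have mz := hT'.2 z hbz hza
  have mw := hT'.2 w hbw hwa
  have bc := hT.not_adj hac hcb
  have bY := hT.not_adj hay hyb
  have lx := mc.2 x hcx hxa
  have ly := my.2 y₁ hy₁ hya
  have lz := mz.2 z₁ hz₁ hzb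
  have lw := mw.2 w₁ hw₁ hwb
  obtain ⟨x₂, hx₂, hxa₂, hcx₂⟩ := h.exists_other_leaf mc hcx hxa
  obtain ⟨y₂, hy₂, hya₂, hyy₂⟩ := h.exists_other_leaf my hy₁ hya
  obtain ⟨z₂, hz₂, hzb₂, hzz₂⟩ := h.exists_other_leaf mz hz₁ hzb
  obtain ⟨w₂, hw₂, hwb₂, hww₂⟩ := h.exists_other_leaf mw hw₁ hwb
  have lx₂ := mc.2 x₂ hcx₂ hxa₂
  have ly₂ := my.2 y₂ hyy₂ hya₂
  have lz₂ := mz.2 z₂ hzz₂ hzb₂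
  have lw₂ := mw.2 w₂ hww₂ hwb₂
  have ab := hT.1
  have n1 : [a, b, c, y, z, w].Nodup := by
    have := ab.ne
    have := hac.ne
    have := hay.ne
    have := hbz.ne
    have := hbw.ne
    have h1 : c ≠ z := fun he => bc (he ▸ hbz.symm)
    have h2 : c ≠ w := fun he => bc (he ▸ hbw.symm)
    have h3 : y ≠ z := fun he => bY (he ▸ hbz.symm)
    have h4 : y ≠ w := fun he => bY (he ▸ hbw.symm)
    simp only [List.nodup_cons, List.mem_cons, List.not_mem_nil]
    grind
  have key : ∀ m s, m ∈ [c, y, z, w] → G.Adj m s → (∀ v, G.Adj s v → v = m) →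
      s ∉ [a, b, c, y, z, w] := by
    intro m s hm hms hs hmem
    simp only [List.nodup_cons, List.mem_cons, List.not_mem_nil, or_false, not_or] at n1 hmem hm
    have hne := hms.ne
    rcases hmem with rfl | rfl | rfl | rfl | rfl | rfl
    · have := hs _ ab
      grind
    · have := hs _ ab.symm
      grind
    · have := hs _ hac.symm
      grind
    · have := hs _ hay.symm
      grind
    · have := hs _ hbz.symm
      grind
    · have := hs _ hbw.symm
      grind
  have k1 := key c x (by simp) hcx lx
  have k2 := key c x₂ (by simp) hcx₂ lx₂
  have k3 := key y y₁ (by simp) hy₁ ly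
  have k4 := key y y₂ (by simp) hyy₂ ly₂
  have k5 := key z z₁ (by simp) hz₁ lz
  have k6 := key z z₂ (by simp) hzz₂ lz₂
  have k7 := key w w₁ (by simp) hw₁ lw
  have k8 := key w w₂ (by simp) hww₂ lw₂
  have key2 : ∀ {m m' s s' : V}, G.Adj m s → (∀ v, G.Adj s' v → v = m') → m ≠ m' → s ≠ s' := by
    rintro m m' s s' h1 h2 h3 rfl
    exact h3 (h2 m h1.symm)
  have hn : [x, x₂, y₁, y₂, z₁, z₂, w₁, w₂, a, b, c, y, z, w].Nodup := by
    have n2 := n1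
    simp only [List.nodup_cons, List.mem_cons, List.not_mem_nil, or_false, not_or] at n2
    have cz : c ≠ z := by grind
    have cw : c ≠ w := by grind
    have yz : y ≠ z := by grind
    have yw : y ≠ w := by grind
    simp only [List.nodup_cons (l := _ :: _)] at n1 ⊢
    refine ⟨?_, ?_, ?_, ?_, ?_, ?_, ?_, k8, n1⟩
    all_goals
      simp only [List.mem_cons (a := x), List.mem_cons (a := x₂), List.mem_cons (a := y₁),
        List.mem_cons (a := y₂), List.mem_cons (a := z₁), List.mem_cons (a := z₂),
        List.mem_cons (a := w₁), not_or] at k1 k2 k3 k4 k5 k6 k7 ⊢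
    · exact ⟨hx₂.symm, key2 hcx ly hyc.symm, key2 hcx ly₂ hyc.symm, key2 hcx lz cz,
        key2 hcx lz₂ cz, key2 hcx lw cw, key2 hcx lw₂ cw, k1⟩
    · exact ⟨key2 hcx₂ ly hyc.symm, key2 hcx₂ ly₂ hyc.symm, key2 hcx₂ lz cz,
        key2 hcx₂ lz₂ cz, key2 hcx₂ lw cw, key2 hcx₂ lw₂ cw, k2⟩
    · exact ⟨hy₂.symm, key2 hy₁ lz yz, key2 hy₁ lz₂ yz, key2 hy₁ lw yw, key2 hy₁ lw₂ yw, k3⟩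
    · exact ⟨key2 hyy₂ lz yz, key2 hyy₂ lz₂ yz, key2 hyy₂ lw yw, key2 hyy₂ lw₂ yw, k4⟩
    · exact ⟨hz₂.symm, key2 hz₁ lw hwz.symm, key2 hz₁ lw₂ hwz.symm, k5⟩
    · exact ⟨key2 hzz₂ lw hwz.symm, key2 hzz₂ lw₂ hwz.symm, k6⟩
    · exact ⟨hw₂.symm, k7⟩
  have ra := Reachable.refl (G := G) a
  have rb := ab.reachable
  have rc := hac.reachable
  have ry := hay.reachable
  have rz := rb.trans hbz.reachable
  have rw' := rb.trans hbw.reachable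
  have hreach : ∀ v ∈ [x, x₂, y₁, y₂, z₁, z₂, w₁, w₂, a, b, c, y, z, w], G.Reachable a v := by
    intro v hv
    simp only [List.mem_cons, List.not_mem_nil, or_false] at hv
    rcases hv with rfl | rfl | rfl | rfl | rfl | rfl | rfl | rfl | rfl | rfl | rfl | rfl | rfl | rfl
    exacts [rc.trans hcx.reachable, rc.trans hcx₂.reachable, ry.trans hy₁.reachable,
      ry.trans hyy₂.reachable, rz.trans hz₁.reachable, rz.trans hzz₂.reachable,
      rw'.trans hw₁.reachable, rw'.trans hww₂.reachable, ra, rb, rc, ry, rz, rw']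
  refine ⟨⟨_, hn, rfl, hreach⟩, ?_⟩
  have hsub : [x, c, y₁, y, a, b, z₁, z, w₁, w].Nodup := by
    clear key key2 hreach
    simp only [List.nodup_cons, List.mem_cons, List.not_mem_nil, or_false, not_or] at hn ⊢
    grind
  have hE : ∀ {u v : V} {L : List V}, (∃ K, IsMatch G K ∧ 2 * K.card = L.length ∧
      ∀ s, ¬ Uncov K s ↔ s ∈ L) → G.Adj u v → (u :: v :: L).Nodup →
      ∃ K, IsMatch G K ∧ 2 * K.card = (u :: v :: L).length ∧ ∀ s, ¬ Uncov K s ↔ s ∈ u :: v :: L := by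
    rintro u v L ⟨K, hK, hKc, hKu⟩ huv hL
    rw [List.nodup_cons, List.mem_cons, not_or, List.nodup_cons] at hL
    have hu : Uncov K u := not_not.1 fun h' => hL.1.2 ((hKu u).1 h')
    have hv : Uncov K v := not_not.1 fun h' => hL.2.1 ((hKu v).1 h')
    refine ⟨_, hK.insert huv hu hv, ?_, fun s => ?_⟩
    · rw [card_insert_uncov hu]
      simp
      omega
    · rw [uncov_insert, List.mem_cons, List.mem_cons, ← hKu]
      tauto
  have h0 : ∃ K, IsMatch G K ∧ 2 * K.card = ([] : List V).length ∧
      ∀ s : V, ¬ Uncov K s ↔ s ∈ ([] : List V) := ⟨∅, IsMatch.empty, by simp, by simp [Uncov]⟩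
  have h1 := hE h0 hw₁.symm (hsub.sublist (List.drop_sublist 8 [x, c, y₁, y, a, b, z₁, z, w₁, w]))
  have h2 := hE h1 hz₁.symm (hsub.sublist (List.drop_sublist 6 [x, c, y₁, y, a, b, z₁, z, w₁, w]))
  have h3 := hE h2 ab (hsub.sublist (List.drop_sublist 4 [x, c, y₁, y, a, b, z₁, z, w₁, w]))
  have h4 := hE h3 hy₁.symm (hsub.sublist (List.drop_sublist 2 [x, c, y₁, y, a, b, z₁, z, w₁, w]))
  obtain ⟨K, hK, hKc, hKu⟩ := hE h4 hcx.symm hsub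
  refine ⟨K, hK, by simp at hKc; omega, fun s hs => hreach s ?_⟩
  have := (hKu s).1 hs
  simp only [List.mem_cons, List.not_mem_nil, or_false] at this ⊢
  tauto

lemma StarCenter.length_le {s : V} {p : List V} (hs : StarCenter G s)
    (hc : (s :: p).IsChain G.Adj) (hn : (s :: p).Nodup) : p.length ≤ 1 := by
  rcases p with _ | ⟨x, _ | ⟨y, p⟩⟩
  · simp
  · simp
  · simp only [List.isChain_cons_cons] at hc
    have := hs.2 x hc.1 y hc.2.1
    simp [this] at hn

/-- For centres in different components, the edge `ss'` could be replaced by a star edge if it were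
a matching edge, and a path through it has at most four vertices. -/
lemma Sat.reachable_starCenter (h : Sat G t) {s s' : V} (hs : StarCenter G s)
    (hs' : StarCenter G s') : G.Reachable s s' := by
  by_contra hne
  have hss : s ≠ s' := fun he => hne (he ▸ Reachable.refl s)
  rcases h.cases hss (fun hadj => hne hadj.reachable) with hE | ⟨p, q, M, hS⟩
  · obtain ⟨x, hx⟩ := hs.1
    exact h.free (hE.hasForest_of_adj hx fun w hw => Or.inl (hs.2 x hx w hw))
  · have := hs.length_le hS.left (List.nodup_append.1 hS.nodup).1
    have := hs'.length_le hS.right (List.nodup_append.1 hS.nodup).2.1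
    have := hS.length
    omega

/-- The edge `sa` must lie on the path, which has at most two vertices on the side of the star. The
remaining five or more start with `a, b`; putting `x, c` in front of them gives a seven-vertex path
in `G` itself. -/
lemma Sat.exists_path_of_star_of_tip (h : Sat G t) {s a b c x : V} (hs : StarCenter G s)
    (hne : ¬ G.Reachable s a) (hT : Tip G a b) (hac : G.Adj a c) (hcb : c ≠ b) (hcx : G.Adj c x)
    (hxa : x ≠ a) : ∃ l : List V, l.IsChain G.Adj ∧ l.Nodup ∧ l.length = 7 := by
  have hsa : s ≠ a := fun he => hne (he ▸ Reachable.refl s)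
  rcases h.cases hsa (fun hadj => hne hadj.reachable) with hE | ⟨p, q, M, hS⟩
  · obtain ⟨x, hx⟩ := hs.1
    exact absurd (hE.hasForest_of_adj hx fun w hw => Or.inl (hs.2 x hx w hw)) h.free
  · have hp := hs.length_le hS.left (List.nodup_append.1 hS.nodup).1
    have hlen := hS.length
    have hright := hS.right
    have hn := (List.nodup_append.1 hS.nodup).2.1
    obtain ⟨q', rfl⟩ : ∃ q', q = b :: q' := by
      rcases q with _ | ⟨d, _ | ⟨e, q⟩⟩
      · simp at hlen
        omega
      · simp at hlen
        omega
      · by_cases hd : d = b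
        · exact ⟨e :: q, by rw [hd]⟩
        · have := (hT.2 d (List.isChain_cons_cons.1 hright).1 hd).eq_nil hright hn
          subst this
          simp at hlen
          omega
    have hmid := hT.2 c hac hcb
    have hbc := hT.not_adj hac hcb
    rw [List.nodup_cons] at hn
    have hcq : c ∉ b :: q' := by
      intro hcq
      rcases hmid.forall_mem hright.tail hn.1 hcq b (by simp) with he | he
      · exact hcb he.symm
      · exact hbc he
    have hxq : x ∉ b :: q' :=
      notMem_of_neighbour (hmid.2 x hcx hxa) hright.tail (by simp at hlen ⊢; omega) hcq
    refine ⟨(x :: c :: a :: b :: q').take 7, List.IsChain.take ?_ 7,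
      List.Nodup.sublist (List.take_sublist 7 _) ?_, ?_⟩
    · rw [List.isChain_cons_cons, List.isChain_cons_cons]
      exact ⟨hcx.symm, hac.symm, hright⟩
    · have h1 : c ∉ a :: b :: q' := List.not_mem_cons_of_ne_of_not_mem hac.ne' hcq
      exact List.nodup_cons.2 ⟨List.not_mem_cons_of_ne_of_not_mem hcx.ne'
        (List.not_mem_cons_of_ne_of_not_mem hxa hxq),
        List.nodup_cons.2 ⟨h1, List.nodup_cons.2 hn⟩⟩
    · simp at hlen ⊢
      omega

/-- Removing from a matching the edges that meet a given set. -/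
lemma IsMatch.hasForest_of_cover (h : IsMatch G M) (hc : l.IsChain G.Adj) (hn : l.Nodup)
    (hl : 7 ≤ l.length) (T : Finset V) (hT : ∀ v ∈ l, ∀ w, s(v, w) ∈ M → v ∈ T ∨ w ∈ T)
    (hcard : t + T.card ≤ M.card) : HasForest G t := by
  refine h.hasForest_of_touch hc hn hl (M.filter fun e => ∃ v ∈ T, v ∈ e) (fun v hv w hw => ?_) ?_
  · rw [Finset.mem_filter]
    rcases hT v hv w hw with h' | h'
    · exact ⟨hw, v, h', Sym2.mem_mk_left _ _⟩
    · exact ⟨hw, w, h', Sym2.mem_mk_right _ _⟩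
  · have hex : ∀ e : Sym2 V, ∃ v, (∃ v ∈ T, v ∈ e) → v ∈ T ∧ v ∈ e := fun e => by
      by_cases he : ∃ v ∈ T, v ∈ e
      · obtain ⟨v, hv⟩ := he
        exact ⟨v, fun _ => hv⟩
      · induction e with
        | _ a b => exact ⟨a, fun h' => absurd h' he⟩
    choose f hf using hex
    have : (M.filter fun e => ∃ v ∈ T, v ∈ e).card ≤ T.card := by
      refine Finset.card_le_card_of_injOn f (fun e he => ?_) fun e he e' he' hee => ?_
      · exact (hf e (Finset.mem_filter.1 he).2).1
      · rw [Finset.mem_coe, Finset.mem_filter] at he he'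
        exact h.disj e he.1 e' he'.1 (f e) (hf e he.2).2 (hee ▸ (hf e' he'.2).2)
    omega

/-- Some path on seven vertices touches at most six matching edges. This holds for the given one
unless its first vertex has a mate off the path, and then the path is shifted by one step to include
that mate. -/
lemma Sat.card_le_of_path (h : Sat G t) (hM : IsMatch G M) (hc : l.IsChain G.Adj) (hn : l.Nodup)
    (hl : l.length = 7) : M.card ≤ t + 5 := by
  by_contra! hcon
  apply h.free
  rcases l with _ | ⟨a, l⟩
  · simp at hl
  have hl' : l.toFinset.card ≤ 6 := (List.toFinset_card_le l).trans (by simp at hl; omega)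
  by_cases ha : ∃ w, s(a, w) ∈ M ∧ w ∉ l
  · obtain ⟨w, hw, hwl⟩ := ha
    have hsub : List.Sublist ((a :: l).take 6) (a :: l) := List.take_sublist 6 _
    have hT : ((a :: l).take 6).toFinset.card ≤ 6 :=
      (List.toFinset_card_le _).trans (by simp)
    refine hM.hasForest_of_cover (l := w :: (a :: l).take 6) ?_ ?_ ?_
      ((a :: l).take 6).toFinset ?_ (by omega)
    · have := hc.take 6
      rw [List.take_succ_cons] at this ⊢
      exact List.isChain_cons_cons.2 ⟨(hM.adj hw).symm, this⟩
    · rw [List.nodup_cons]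
      refine ⟨fun h' => ?_, hn.sublist hsub⟩
      rcases List.mem_cons.1 (hsub.subset h') with rfl | h'
      · exact (hM.adj hw).ne rfl
      · exact hwl h'
    · simp at hl ⊢
      omega
    · intro v hv u hu
      rw [List.mem_toFinset, List.mem_toFinset]
      rcases List.mem_cons.1 hv with rfl | hv
      · rw [Sym2.eq_swap] at hw
        rw [hM.eq_right hu hw]
        right
        simp
      · exact Or.inl hv
  · push Not at ha
    refine hM.hasForest_of_cover hc hn hl.ge l.toFinset ?_ (by omega)
    intro v hv u hu
    rw [List.mem_toFinset, List.mem_toFinset]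
    rcases List.mem_cons.1 hv with rfl | hv
    · exact Or.inr (ha u hu)
    · exact Or.inl hv

/-- If the component contains a path on seven vertices and at most four edges of `M`, these can be
dropped from `M`, which has at least `t + 4` edges by `exists_branch`. If it contains no such path,
it contains five disjoint edges by `exists_fourteen`, and `M` is maximum on each component. -/
lemma Sat.ten_le_cov [Fintype V] (h : Sat G t) (hM : MaxM G M) {a b c x : V} (hT : Tip G a b)
    (hac : G.Adj a c) (hcb : c ≠ b) (hcx : G.Adj c x) (hxa : x ≠ a)
    (htri : ∀ u v, G.Adj b u → G.Adj u v → ¬ G.Adj b v) : 10 ≤ (cov M ∩ comp G a).card := by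
  rw [← two_mul_card_inside hM.1 closed_comp]
  by_contra! hcon
  by_cases hP : ∃ l : List V, l.IsChain G.Adj ∧ l.Nodup ∧ a ∈ l ∧ l.length = 7
  · obtain ⟨l, hc, hn, ha, hl⟩ := hP
    obtain ⟨y, y', z, z', -, -, N, hN, hNc⟩ := h.exists_branch hT hac hcb hcx hxa
    have := hM.2 N hN
    refine h.free (hM.1.hasForest_of_touch hc hn hl.ge (inside M (comp G a)) ?_ (by omega))
    intro v hv w hw
    have hr := reachable_of_isChain hc ha hv
    rw [mk_mem_inside, mem_comp, mem_comp]
    exact ⟨hw, hr, hr.trans (hM.1.adj hw).reachable⟩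
  · push Not at hP
    have hT' := hT.symm_of_short hac hcb hcx hxa hP htri
    obtain ⟨-, K, hK, hKc, hKr⟩ := h.exists_fourteen hT hT' hac hcb hcx hxa
    obtain ⟨h1, h2, -⟩ := exists_combine hK hM.1 (closed_comp (G := G) (z := a))
    have h3 := hM.2 _ h1
    have h4 : cov K ∩ comp G a = cov K := by
      rw [Finset.inter_eq_left]
      intro v hv
      exact mem_comp.2 (hKr v (mem_cov.1 hv))
    have h5 := Finset.card_inter_add_card_sdiff (cov M) (comp G a)
    rw [h4, hK.card_cov, ← Finset.sdiff_eq_inter_compl] at h2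
    rw [← two_mul_card_inside hM.1 closed_comp, hM.1.card_cov] at h5
    omega

lemma StarCenter.two_le_cov [Fintype V] {s : V} (hs : StarCenter G s) (hM : MaxM G M) :
    2 ≤ (cov M ∩ comp G s).card := by
  rw [← two_mul_card_inside hM.1 closed_comp]
  obtain ⟨x, hx⟩ := hs.1
  have hr := Reachable.refl (G := G) s
  have : (inside M (comp G s)).Nonempty := by
    by_contra hcon
    rw [Finset.not_nonempty_iff_eq_empty] at hcon
    have hun : ∀ v, G.Reachable s v → Uncov M v := by
      intro v hv
      rw [uncov_iff]
      intro w hw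
      have : s(v, w) ∈ inside M (comp G s) := by
        rw [mk_mem_inside, mem_comp, mem_comp]
        exact ⟨hw, hv, hv.trans (hM.1.adj hw).reachable⟩
      simp [hcon] at this
    exact hM.not_adj (hun s hr) (hun x hx.reachable) hx
  have := Finset.card_pos.2 this
  omega

lemma comp_eq_of_reachable [Fintype V] {a b : V} (h : G.Reachable a b) : comp G a = comp G b := by
  ext v
  rw [mem_comp, mem_comp]
  exact ⟨fun h' => h.symm.trans h', fun h' => h.trans h'⟩

/-- Too few edges force many tree components, all but at most one of which have a tip. Whether or
not `G` contains a path on seven vertices, they need too many matching edges or too many vertices.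
-/
theorem Sat.large_of_no_isolated [Fintype V] (h : Sat G t) (hiso : ∀ v, ∃ w, G.Adj v w)
    (hn : 14 * t + 135 ≤ 5 * Fintype.card V) :
    Fintype.card V - Fintype.card V / 14 ≤ G.edgeSet.ncard := by
  by_contra! hcon
  obtain ⟨ρ, p, hR⟩ := exists_rooted G
  have hcard := hR.card_le
  set n := Fintype.card V
  set R := treeRoots G ρ p with hRdef
  have hτ : n + 1 ≤ 14 * R.card := by omega
  -- With one possible star, the trees need at least `5 * (R.card - 1) + 1` matching edges, which
  -- exceeds the bound `t + 5`.
  have hτ' : t + 10 ≤ 5 * R.card := by omega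
  have hroot : ∀ r ∈ R, ∀ r' ∈ R, G.Reachable r r' → r = r' := by
    intro r hr r' hr' hrr
    have := hR.eq _ _ hrr
    rwa [(mem_treeRoots.1 hr).1, (mem_treeRoots.1 hr').1] at this
  have htri : ∀ r ∈ R, ∀ a b, G.Reachable r a → G.Adj a b →
      ∀ u v, G.Adj b u → G.Adj u v → ¬ G.Adj b v := by
    intro r hr a b hra hab u v hbu huv hbv
    rw [hRdef, mem_treeRoots] at hr
    exact hR.not_triangle hr.1 hr.2 (hra.trans hab.reachable) hbu huv hbv
  have hcase : ∀ r ∈ R, (∃ s, G.Reachable r s ∧ StarCenter G s) ∨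
      ∃ a b c x, G.Reachable r a ∧ Tip G a b ∧ G.Adj a c ∧ c ≠ b ∧ G.Adj c x ∧ x ≠ a :=
    fun r hr => hR.star_or_tip hiso hr
  set B := R.filter fun r => ∃ s, G.Reachable r s ∧ StarCenter G s with hB
  have hB1 : B.card ≤ 1 := by
    rw [Finset.card_le_one]
    intro r hr r' hr'
    rw [hB, Finset.mem_filter] at hr hr'
    obtain ⟨hr, s, hs, hsc⟩ := hr
    obtain ⟨hr', s', hs', hsc'⟩ := hr'
    exact hroot r hr r' hr' (hs.trans ((h.reachable_starCenter hsc hsc').trans hs'.symm))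
  have hsplit := Finset.card_filter_add_card_filter_not (s := R)
    (fun r => ∃ s, G.Reachable r s ∧ StarCenter G s)
  rw [← hB] at hsplit
  set T := R.filter fun r => ¬ ∃ s, G.Reachable r s ∧ StarCenter G s with hT
  have htip : ∀ r ∈ T,
      ∃ a b c x, G.Reachable r a ∧ Tip G a b ∧ G.Adj a c ∧ c ≠ b ∧ G.Adj c x ∧ x ≠ a := by
    intro r hr
    rw [hT, Finset.mem_filter] at hr
    exact (hcase r hr.1).resolve_left hr.2
  have hTR : ∀ r ∈ T, r ∈ R := fun r hr => (Finset.mem_filter.1 hr).1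
  by_cases hP : ∃ l : List V, l.IsChain G.Adj ∧ l.Nodup ∧ l.length = 7
  · obtain ⟨l, hc, hn, hl⟩ := hP
    obtain ⟨M, hM⟩ := exists_maxM G
    have hMc := h.card_le_of_path hM.1 hc hn hl
    have hsum := hR.sum_card_inter_le (cov M)
    rw [hM.1.card_cov, ← hRdef, ← Finset.sum_filter_add_sum_filter_not R
      (fun r => ∃ s, G.Reachable r s ∧ StarCenter G s)] at hsum
    have h1 : B.card * 2 ≤ ∑ r ∈ B, (cov M ∩ comp G r).card := by
      refine Finset.card_nsmul_le_sum B _ 2 fun r hr => ?_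
      obtain ⟨s, hs, hsc⟩ := (Finset.mem_filter.1 hr).2
      rw [comp_eq_of_reachable hs]
      exact hsc.two_le_cov hM
    have h2 : T.card * 10 ≤ ∑ r ∈ T, (cov M ∩ comp G r).card := by
      refine Finset.card_nsmul_le_sum T _ 10 fun r hr => ?_
      obtain ⟨a, b, c, x, hra, hT, hac, hcb, hcx, hxa⟩ := htip r hr
      rw [comp_eq_of_reachable hra]
      exact h.ten_le_cov hM hT hac hcb hcx hxa (htri r (hTR r hr) a b hra hT.1)
    rw [← hB, ← hT] at hsum
    omega
  -- Without a path on seven vertices no star can coexist with a tip. So every tree has fourteen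
  -- vertices, contrary to `n < 14 * R.card`.
  · have hTne : T.Nonempty := by
      rw [← Finset.card_pos]
      omega
    obtain ⟨r₀, hr₀⟩ := hTne
    have hB0 : B = ∅ := by
      rw [← Finset.not_nonempty_iff_eq_empty]
      rintro ⟨r, hr⟩
      have hrB := Finset.mem_filter.1 hr
      obtain ⟨s, hs, hsc⟩ := hrB.2
      obtain ⟨a, b, c, x, hra, hT', hac, hcb, hcx, hxa⟩ := htip r₀ hr₀
      refine hP (h.exists_path_of_star_of_tip hsc (fun hsa => ?_) hT' hac hcb hcx hxa)
      have := hroot r hrB.1 r₀ (hTR _ hr₀) (hs.trans (hsa.trans hra.symm))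
      subst this
      exact (Finset.mem_filter.1 hr₀).2 hrB.2
    have hsum := hR.sum_card_inter_le Finset.univ
    have h2 : R.card * 14 ≤ ∑ r ∈ R, (Finset.univ ∩ comp G r).card := by
      refine Finset.card_nsmul_le_sum R _ 14 fun r hr => ?_
      have hrT : r ∈ T := by
        rw [hT, Finset.mem_filter]
        refine ⟨hr, fun h' => ?_⟩
        have : r ∈ B := by
          rw [hB, Finset.mem_filter]
          exact ⟨hr, h'⟩
        simp [hB0] at this
      obtain ⟨a, b, c, x, hra, hT', hac, hcb, hcx, hxa⟩ := htip r hrT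
      have hT'' := hT'.symm_of_short hac hcb hcx hxa
        (fun l hc hn _ hl => hP ⟨l, hc, hn, hl⟩) (htri r hr a b hra hT'.1)
      obtain ⟨⟨L, hL, hLl, hLr⟩, -⟩ := h.exists_fourteen hT' hT'' hac hcb hcx hxa
      rw [Finset.univ_inter, comp_eq_of_reachable hra, ← hLl]
      exact length_le_card_comp hL hLr
    rw [Finset.card_univ, ← hRdef] at hsum
    omega

/-! ### Saturated forests with `n - n / 14` edges -/

/-- The graph joining every vertex to its image under `p`. -/
def parentGraph (p : V → V) : SimpleGraph V where
  Adj v w := v ≠ w ∧ (p v = w ∨ p w = v)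
  symm := ⟨fun _ _ h => ⟨h.1.symm, h.2.symm⟩⟩
  loopless := ⟨fun _ h => h.1 rfl⟩

/-- A path first follows `p` and then runs against it. Four consecutive steps in one direction
repeat a vertex by the identity for `p`; three steps each way make both neighbours of the middle
vertex equal to its image. -/
lemma parentGraph_no_path {p : V → V} (hp : ∀ v, p (p (p (p v))) = p (p v))
    (hc : l.IsChain (parentGraph p).Adj) (hn : l.Nodup) (hl : l.length = 7) : False := by
  obtain ⟨a, b, c, d, e, f, g, rfl⟩ : ∃ a b c d e f g, l = [a, b, c, d, e, f, g] := by
    rcases l with _ | ⟨a, _ | ⟨b, _ | ⟨c, _ | ⟨d, _ | ⟨e, _ | ⟨f, _ | ⟨g, _ | _⟩⟩⟩⟩⟩⟩⟩ <;>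
      simp at hl ⊢
  simp only [List.isChain_cons_cons, parentGraph] at hc
  -- Once a path runs against `p`, it continues to do so.
  have step : ∀ {u v w : V}, (p u = v ∨ p v = u) → (p v = w ∨ p w = v) → u ≠ w → p u ≠ v →
      p w = v ∧ p v ≠ w := by
    intro u v w h1 h2 h3 h4
    have h5 := h1.resolve_left h4
    have h6 : p v ≠ w := fun h => h3 (h5.symm.trans h)
    exact ⟨h2.resolve_left h6, h6⟩
  have four : ∀ {u v w x y : V}, p u = v → p v = w → p w = x → p x = y → w = y := by
    rintro u v w x y rfl rfl rfl rfl
    exact (hp u).symm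
  obtain ⟨⟨-, h1⟩, ⟨-, h2⟩, ⟨-, h3⟩, ⟨-, h4⟩, ⟨-, h5⟩, ⟨-, h6⟩, -⟩ := hc
  simp only [List.nodup_cons, List.mem_cons, not_or] at hn
  obtain ⟨⟨-, ac, -⟩, ⟨-, bd, -⟩, ⟨-, ce, -⟩, ⟨-, df, -⟩, ⟨-, eg, -⟩, -⟩ := hn
  have down : p c ≠ d ∨ p d ≠ e → False := by
    intro h
    have k4 : p e = d ∧ p d ≠ e := by
      rcases h with h | h
      · exact step h3 h4 ce h
      · exact ⟨h4.resolve_left h, h⟩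
    have k5 := step h4 h5 df k4.2
    have k6 := step h5 h6 eg k5.2
    rcases h3 with h3 | h3
    · by_cases h2' : p b = c
      · by_cases h1' : p a = b
        · -- both legs have length three
          have q1 : p d = c := by
            rw [← h3, ← h2', ← h1']
            exact hp a
          have q2 : p d = e := by
            rw [← k4.1, ← k5.1, ← k6.1]
            exact hp g
          exact ce (q1.symm.trans q2)
        · exact (step h1 h2 ac h1').2 h2'
      · exact (step h2 (Or.inl h3) bd h2').2 h3
    · exact absurd (four k6.1 k5.1 k4.1 h3) (Ne.symm ce)
  have k3 : p c = d := by_contra fun h => down (Or.inl h)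
  have k4 : p d = e := by_contra fun h => down (Or.inr h)
  have k2 : p b = c := by
    by_contra h
    exact (step h2 h3 bd h).2 k3
  have k1 : p a = b := by
    by_contra h
    exact (step h1 h2 ac h).2 k2
  exact ce (four k1 k2 k3 k4)

/-- The vertices of a disjoint union of trees, indexed by `Q`: each tree has two adjacent roots,
each root has two further neighbours, and the elements of `L` are leaves attached to those. -/
inductive BroomVertex (Q L : Type*)
  | root (i : Q) (s : Bool)
  | mid (i : Q) (s c : Bool)
  | leaf (x : L)

namespace BroomVertex

variable {Q L : Type*} {π : L → Q × Bool × Bool}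

def equivSum : BroomVertex Q L ≃ (Q × Bool) ⊕ (Q × Bool × Bool) ⊕ L where
  toFun
    | root i s => Sum.inl (i, s)
    | mid i s c => Sum.inr (Sum.inl (i, s, c))
    | leaf x => Sum.inr (Sum.inr x)
  invFun
    | Sum.inl (i, s) => root i s
    | Sum.inr (Sum.inl (i, s, c)) => mid i s c
    | Sum.inr (Sum.inr x) => leaf x
  left_inv v := by cases v <;> rfl
  right_inv v := by
    rcases v with ⟨i, s⟩ | ⟨i, s, c⟩ | x <;> rfl

/-- The two roots of a tree are each other's parents, which makes the root edge an ordinary parent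
edge. -/
def parent (π : L → Q × Bool × Bool) : BroomVertex Q L → BroomVertex Q L
  | root i s => root i (!s)
  | mid i s _ => root i s
  | leaf x => mid (π x).1 (π x).2.1 (π x).2.2

def tree (π : L → Q × Bool × Bool) : BroomVertex Q L → Q
  | root i _ => i
  | mid i _ _ => i
  | leaf x => (π x).1

lemma parent_four (v : BroomVertex Q L) :
    parent π (parent π (parent π (parent π v))) = parent π (parent π v) := by
  rcases v with ⟨i, s⟩ | ⟨i, s, c⟩ | x <;> simp [parent]

/-- The disjoint union of trees described by `BroomVertex`. -/
abbrev brooms (π : L → Q × Bool × Bool) : SimpleGraph (BroomVertex Q L) := parentGraph (parent π)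

lemma adj_root (i : Q) (s : Bool) : (brooms π).Adj (root i s) (root i (!s)) := by
  simp [parentGraph, parent]

lemma adj_mid (i : Q) (s c : Bool) : (brooms π).Adj (root i s) (mid i s c) := by
  simp [parentGraph, parent]

lemma adj_leaf {i : Q} {s c : Bool} {x : L} (hx : π x = (i, s, c)) :
    (brooms π).Adj (mid i s c) (leaf x) := by
  simp [parentGraph, parent, hx]

/-- The vertex can be deleted together with the stars and root edges indexed by `D` and `E`. -/
def Within (π : L → Q × Bool × Bool) (D : Finset (Q × Bool × Bool)) (E : Finset Q) :
    BroomVertex Q L → Prop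
  | root i _ => i ∈ E
  | mid i s c => (i, s, c) ∈ D
  | leaf x => π x ∈ D

lemma Within.mono {D D' : Finset (Q × Bool × Bool)} {E E' : Finset Q} {v : BroomVertex Q L}
    (h : Within π D E v) (hD : D ⊆ D') (hE : E ⊆ E') : Within π D' E' v := by
  rcases v with ⟨i, s⟩ | ⟨i, s, c⟩ | x
  · exact hE h
  · exact hD h
  · exact hD h

/-- Each tree has five disjoint edges: the root edge and one leaf edge at each of its four middle
vertices. `D` and `E` index the discarded ones; all leaves of a discarded middle vertex become
uncovered as well. -/
lemma exists_match [Fintype Q] (hπ : ∀ m, ∃ x, π x = m) (D : Finset (Q × Bool × Bool))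
    (E : Finset Q) : ∃ M, IsMatch (brooms π) M ∧ M.card + D.card + E.card = 5 * Fintype.card Q ∧
      ∀ v, Within π D E v → Uncov M v := by
  choose x hx using hπ
  have hxi : Function.Injective x := fun a b h => by rw [← hx a, ← hx b, h]
  set f : Q × Bool × Bool → Sym2 (BroomVertex Q L) := fun m =>
    s(mid m.1 m.2.1 m.2.2, leaf (x m)) with hf
  set g : Q → Sym2 (BroomVertex Q L) := fun i => s(root i false, root i true) with hg
  have hfi : Function.Injective f := by
    intro a b h
    simp only [hf, Sym2.eq_iff, leaf.injEq, reduceCtorEq, and_false, or_false] at h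
    exact hxi h.2
  have hgi : Function.Injective g := by
    intro a b h
    simpa [hg] using h
  refine ⟨Dᶜ.image f ∪ Eᶜ.image g, ⟨?_, ?_⟩, ?_, ?_⟩
  · intro e he
    simp only [Finset.mem_union, Finset.mem_image] at he
    rcases he with ⟨m, -, rfl⟩ | ⟨i, -, rfl⟩
    · exact adj_leaf (hx m)
    · exact adj_root i false
  · intro e he e' he' v hv hv'
    simp only [Finset.mem_union, Finset.mem_image] at he he'
    rcases he with ⟨m, -, rfl⟩ | ⟨i, -, rfl⟩ <;> rcases he' with ⟨m', -, rfl⟩ | ⟨i', -, rfl⟩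
    · simp only [hf, Sym2.mem_iff] at hv hv'
      rcases hv with rfl | rfl <;> rcases hv' with hv' | hv'
      · simp only [mid.injEq] at hv'
        rw [Prod.ext hv'.1 (Prod.ext hv'.2.1 hv'.2.2)]
      · cases hv'
      · cases hv'
      · simp only [leaf.injEq] at hv'
        rw [hxi hv']
    · simp only [hf, hg, Sym2.mem_iff] at hv hv'
      rcases hv with rfl | rfl <;> simp at hv'
    · simp only [hf, hg, Sym2.mem_iff] at hv hv'
      rcases hv with rfl | rfl <;> simp at hv'
    · simp only [hg, Sym2.mem_iff] at hv hv'
      rcases hv with rfl | rfl <;> simp at hv' <;> rw [hv']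
  · rw [Finset.card_union_of_disjoint, Finset.card_image_of_injective _ hfi,
      Finset.card_image_of_injective _ hgi, Finset.card_compl, Finset.card_compl]
    · have h1 := Finset.card_le_univ D
      have h2 := Finset.card_le_univ E
      simp only [Fintype.card_prod, Fintype.card_bool] at h1 ⊢
      omega
    · rw [Finset.disjoint_left]
      intro e he he'
      simp only [Finset.mem_image] at he he'
      obtain ⟨m, -, rfl⟩ := he
      obtain ⟨i, -, hi⟩ := he'
      simp [hf, hg] at hi
  · intro v hv e he hve
    simp only [Finset.mem_union, Finset.mem_image, Finset.mem_compl] at he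
    rcases he with ⟨m, hm, rfl⟩ | ⟨i, hi, rfl⟩
    · simp only [hf, Sym2.mem_iff] at hve
      rcases hve with rfl | rfl
      · exact hm hv
      · simp only [Within, hx] at hv
        exact hm hv
    · simp only [hg, Sym2.mem_iff] at hve
      rcases hve with rfl | rfl
      · exact hi hv
      · exact hi hv

lemma hasForest_of_within [Fintype Q] (hπ : ∀ m, ∃ x, π x = m) {G : SimpleGraph (BroomVertex Q L)}
    (hG : brooms π ≤ G) {l : List (BroomVertex Q L)} (hc : l.IsChain G.Adj) (hn : l.Nodup)
    (hl : l.length = 7) (D : Finset (Q × Bool × Bool)) (E : Finset Q)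
    (hw : ∀ v ∈ l, Within π D E v) (ht : t + D.card + E.card ≤ 5 * Fintype.card Q) :
    HasForest G t := by
  obtain ⟨M, hM, hMc, hMw⟩ := exists_match hπ D E
  exact Forest.hasForest ⟨hc, hn, hM.mono hG, fun v hv => hMw v (hw v hv)⟩ hl.ge (by omega)

/-- Paths starting at a given vertex, together with the part of the tree they use. -/
lemma exists_paths (hπ : ∀ m, ∃ x, π x = m) (v : BroomVertex Q L) :
    (∃ p m, (v :: p).IsChain (brooms π).Adj ∧ (v :: p).Nodup ∧ p.length = 2 ∧
      (∀ w ∈ v :: p, tree π w = tree π v) ∧ ∀ w ∈ v :: p, Within π {m} {tree π v} w) ∧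
    ∃ p m m', (v :: p).IsChain (brooms π).Adj ∧ (v :: p).Nodup ∧ p.length = 3 ∧
      (∀ w ∈ v :: p, tree π w = tree π v) ∧ ∀ w ∈ v :: p, Within π {m, m'} {tree π v} w := by
  rcases v with ⟨i, s⟩ | ⟨i, s, c⟩ | x
  · obtain ⟨x, hx⟩ := hπ (i, !s, false)
    refine ⟨⟨[root i (!s), mid i (!s) false], (i, !s, false), ?_, ?_, rfl, ?_, ?_⟩,
      ⟨[root i (!s), mid i (!s) false, leaf x], (i, !s, false), (i, !s, false), ?_, ?_, rfl, ?_, ?_⟩⟩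
    · simp [adj_root, adj_mid]
    · simp
    · simp [tree]
    · simp [Within, tree]
    · simp [adj_root, adj_mid, adj_leaf hx]
    · simp
    · simp [tree, hx]
    · simp [Within, tree, hx]
  · refine ⟨⟨[root i s, root i (!s)], (i, s, c), ?_, ?_, rfl, ?_, ?_⟩,
      ⟨[root i s, root i (!s), mid i (!s) false], (i, s, c), (i, !s, false), ?_, ?_, rfl, ?_, ?_⟩⟩
    · simp [adj_root, (adj_mid i s c).symm]
    · simp
    · simp [tree]
    · simp [Within, tree]
    · simp [adj_root, adj_mid, (adj_mid i s c).symm]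
    · simp
    · simp [tree]
    · simp [Within, tree]
  · obtain ⟨i, s, c, hx⟩ : ∃ i s c, π x = (i, s, c) := ⟨_, _, _, rfl⟩
    refine ⟨⟨[mid i s c, root i s], (i, s, c), ?_, ?_, rfl, ?_, ?_⟩,
      ⟨[mid i s c, root i s, root i (!s)], (i, s, c), (i, s, c), ?_, ?_, rfl, ?_, ?_⟩⟩
    · simp [(adj_mid i s c).symm, (adj_leaf hx).symm]
    · simp
    · simp [tree, hx]
    · simp [Within, tree, hx]
    · simp [adj_root, (adj_mid i s c).symm, (adj_leaf hx).symm]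
    · simp
    · simp [tree, hx]
    · simp [Within, tree, hx]

def depth : BroomVertex Q L → ℕ
  | root _ _ => 0
  | mid _ _ _ => 1
  | leaf _ => 2

/-- Case analysis over the types of the two ends. The second leaf at each middle vertex is what
makes new edges at a leaf produce long enough paths. -/
lemma exists_path_of_depth_le (hπ : ∀ m, ∃ x y, x ≠ y ∧ π x = m ∧ π y = m)
    {u v : BroomVertex Q L} (htree : tree π u = tree π v) (huv : u ≠ v)
    (hadj : ¬ (brooms π).Adj u v) (hd : depth u ≤ depth v) :
    ∃ l : List (BroomVertex Q L), l.IsChain (brooms π ⊔ edge u v).Adj ∧ l.Nodup ∧ l.length = 7 ∧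
      ∀ w ∈ l, tree π w = tree π u := by
  have hleaf : ∀ i s c, ∃ x, π x = (i, s, c) := fun i s c => by
    obtain ⟨x, -, -, hx, -⟩ := hπ (i, s, c)
    exact ⟨x, hx⟩
  have hother : ∀ x, ∃ y, y ≠ x ∧ π y = π x := fun x => by
    obtain ⟨y, z, hyz, hy, hz⟩ := hπ (π x)
    by_cases h : y = x
    · exact ⟨z, fun h' => hyz (h.trans h'.symm), hz⟩
    · exact ⟨y, h, hy⟩
  have hne : ∀ {x y : L}, π x ≠ π y → x ≠ y := fun h h' => h (congrArg π h')
  have hbool : ∀ {a b : Bool}, a ≠ b → b = !a := by decide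
  have e1 : (brooms π ⊔ edge u v).Adj u v := by simp [sup_adj, edge_adj, huv]
  have e2 := e1.symm
  have up : ∀ {a b}, (brooms π).Adj a b → (brooms π ⊔ edge u v).Adj a b := fun h => Or.inl h
  rcases u with ⟨i, s⟩ | ⟨i, s, c⟩ | x <;> rcases v with ⟨j, s'⟩ | ⟨j, s', c'⟩ | y <;>
    simp only [depth] at hd
  · obtain rfl : i = j := htree
    have hs : s ≠ s' := by
      rintro rfl
      exact huv rfl
    exact absurd (hbool hs ▸ adj_root i s) hadj
  · obtain rfl : i = j := htree
    obtain rfl := hbool (a := s) (b := s') fun h => hadj (h ▸ adj_mid i s c')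
    obtain ⟨x, hx⟩ := hleaf i s false
    obtain ⟨y, hy⟩ := hleaf i (!s) (!c')
    refine ⟨[leaf x, mid i s false, root i s, mid i (!s) c', root i (!s), mid i (!s) (!c'), leaf y],
      isChain_seven (up (adj_leaf hx).symm) (up (adj_mid i s false).symm) e1
      (up (adj_mid i (!s) c').symm) (up (adj_mid i (!s) (!c'))) (up (adj_leaf hy)), ?_, rfl, ?_⟩
    · have : x ≠ y := hne (by simp [hx, hy])
      simp [this]
    · simp [tree, hx, hy]
  · obtain ⟨k, s', c', hy⟩ : ∃ i s c, π y = (i, s, c) := ⟨_, _, _, rfl⟩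
    obtain rfl : i = k := by simpa [tree, hy] using htree
    by_cases hs : s = s'
    · subst hs
      obtain ⟨x, hx⟩ := hleaf i (!s) false
      obtain ⟨z, hzy, hz⟩ := hother y
      rw [hy] at hz
      refine ⟨[leaf x, mid i (!s) false, root i (!s), root i s, leaf y, mid i s c', leaf z],
        isChain_seven (up (adj_leaf hx).symm) (up (adj_mid i (!s) false).symm)
        (up (adj_root i s).symm) e1 (up (adj_leaf hy).symm) (up (adj_leaf hz)), ?_, rfl, ?_⟩
      · have h1 : x ≠ y := hne (by simp [hx, hy])
        have h2 : x ≠ z := hne (by simp [hx, hz])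
        simp [h1, h2, hzy.symm]
      · simp [tree, hx, hy, hz]
    · obtain rfl := hbool hs
      obtain ⟨x, hx⟩ := hleaf i s false
      refine ⟨[leaf x, mid i s false, root i s, leaf y, mid i (!s) c', root i (!s), mid i (!s) (!c')],
        isChain_seven (up (adj_leaf hx).symm) (up (adj_mid i s false).symm) e1
        (up (adj_leaf hy).symm) (up (adj_mid i (!s) c').symm) (up (adj_mid i (!s) (!c'))), ?_,
        rfl, ?_⟩
      · have h1 : x ≠ y := hne (by simp [hx, hy])
        simp [h1]
      · simp [tree, hx, hy]
  · omega
  · obtain rfl : i = j := htree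
    obtain ⟨x, hx⟩ := hleaf i s c
    by_cases hs : s = s'
    · subst hs
      obtain rfl := hbool (a := c) (b := c') fun h => huv (by rw [h])
      obtain ⟨y, hy⟩ := hleaf i (!s) false
      refine ⟨[leaf x, mid i s c, mid i s (!c), root i s, root i (!s), mid i (!s) false, leaf y],
        isChain_seven (up (adj_leaf hx).symm) e1 (up (adj_mid i s (!c)).symm)
        (up (adj_root i s)) (up (adj_mid i (!s) false)) (up (adj_leaf hy)), ?_, rfl, ?_⟩
      · have h1 : x ≠ y := hne (by simp [hx, hy])
        simp [h1]
      · simp [tree, hx, hy]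
    · obtain rfl := hbool hs
      obtain ⟨y, hy⟩ := hleaf i s (!c)
      refine ⟨[leaf x, mid i s c, mid i (!s) c', root i (!s), root i s, mid i s (!c), leaf y],
        isChain_seven (up (adj_leaf hx).symm) e1 (up (adj_mid i (!s) c').symm)
        (up (adj_root i s).symm) (up (adj_mid i s (!c))) (up (adj_leaf hy)), ?_, rfl, ?_⟩
      · have h1 : x ≠ y := hne (by simp [hx, hy])
        simp [h1]
      · simp [tree, hx, hy]
  · obtain ⟨k, s', c', hy⟩ : ∃ i s c, π y = (i, s, c) := ⟨_, _, _, rfl⟩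
    obtain rfl : i = k := by simpa [tree, hy] using htree
    obtain ⟨x, hx⟩ := hleaf i s c
    by_cases hs : s = s'
    · subst hs
      obtain rfl := hbool (a := c) (b := c') fun h => hadj (h ▸ adj_leaf hy)
      refine ⟨[leaf x, mid i s c, leaf y, mid i s (!c), root i s, root i (!s), mid i (!s) false],
        isChain_seven (up (adj_leaf hx).symm) e1 (up (adj_leaf hy).symm)
        (up (adj_mid i s (!c)).symm) (up (adj_root i s)) (up (adj_mid i (!s) false)), ?_, rfl, ?_⟩
      · have h1 : x ≠ y := hne (by simp [hx, hy])
        simp [h1]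
      · simp [tree, hx, hy]
    · obtain rfl := hbool hs
      refine ⟨[leaf x, mid i s c, leaf y, mid i (!s) c', root i (!s), root i s, mid i s (!c)],
        isChain_seven (up (adj_leaf hx).symm) e1 (up (adj_leaf hy).symm)
        (up (adj_mid i (!s) c').symm) (up (adj_root i s).symm) (up (adj_mid i s (!c))), ?_, rfl, ?_⟩
      · have h1 : x ≠ y := hne (by simp [hx, hy])
        simp [h1]
      · simp [tree, hx, hy]
  · omega
  · omega
  · obtain ⟨i, s, c, hx⟩ : ∃ i s c, π x = (i, s, c) := ⟨_, _, _, rfl⟩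
    obtain ⟨k, s', c', hy⟩ : ∃ i s c, π y = (i, s, c) := ⟨_, _, _, rfl⟩
    obtain rfl : i = k := by simpa [tree, hx, hy] using htree
    have hxy : x ≠ y := fun h => huv (by rw [h])
    by_cases hs : s = s'
    · subst hs
      by_cases hcc : c = c'
      · subst hcc
        obtain ⟨z, hz⟩ := hleaf i (!s) false
        refine ⟨[leaf x, leaf y, mid i s c, root i s, root i (!s), mid i (!s) false, leaf z],
          isChain_seven e1 (up (adj_leaf hy).symm) (up (adj_mid i s c).symm) (up (adj_root i s))
          (up (adj_mid i (!s) false)) (up (adj_leaf hz)), ?_, rfl, ?_⟩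
        · have h1 : x ≠ z := hne (by simp [hx, hz])
          have h2 : y ≠ z := hne (by simp [hy, hz])
          simp [hxy, h1, h2]
        · simp [tree, hx, hy, hz]
      · obtain rfl := hbool hcc
        obtain ⟨z, hzx, hz⟩ := hother x
        rw [hx] at hz
        refine ⟨[leaf z, mid i s c, leaf x, leaf y, mid i s (!c), root i s, root i (!s)],
          isChain_seven (up (adj_leaf hz).symm) (up (adj_leaf hx)) e1 (up (adj_leaf hy).symm)
          (up (adj_mid i s (!c)).symm) (up (adj_root i s)), ?_, rfl, ?_⟩
        · have h1 : z ≠ y := hne (by simp [hy, hz])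
          simp [hxy, h1, hzx]
        · simp [tree, hx, hy, hz]
    · obtain rfl := hbool hs
      obtain ⟨z, hzx, hz⟩ := hother x
      rw [hx] at hz
      refine ⟨[leaf z, mid i s c, leaf x, leaf y, mid i (!s) c', root i (!s), root i s],
        isChain_seven (up (adj_leaf hz).symm) (up (adj_leaf hx)) e1 (up (adj_leaf hy).symm)
        (up (adj_mid i (!s) c').symm) (up (adj_root i s).symm), ?_, rfl, ?_⟩
      · have h1 : z ≠ y := hne (by simp [hy, hz])
        simp [hxy, h1, hzx]
      · simp [tree, hx, hy, hz]

/-- The new path stays in one tree, so giving up the five matching edges of that tree suffices. -/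
lemma hasForest_of_tree_eq [Fintype Q] (hπ : ∀ m, ∃ x y, x ≠ y ∧ π x = m ∧ π y = m)
    (ht : t + 5 ≤ 5 * Fintype.card Q) {u v : BroomVertex Q L} (htree : tree π u = tree π v)
    (huv : u ≠ v) (hadj : ¬ (brooms π).Adj u v) (hd : depth u ≤ depth v) :
    HasForest (brooms π ⊔ edge u v) t := by
  obtain ⟨l, hc, hn, hl, hw⟩ := exists_path_of_depth_le hπ htree huv hadj hd
  refine hasForest_of_within (fun m => (hπ m).imp fun x ⟨_, h⟩ => h.2.1) le_sup_left hc hn hl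
    ({tree π u} ×ˢ Finset.univ) {tree π u} (fun v hv => ?_) ?_
  · have := hw v hv
    rcases v with ⟨i, s⟩ | ⟨i, s, c⟩ | x
    · exact Finset.mem_singleton.2 this
    · exact Finset.mem_product.2 ⟨Finset.mem_singleton.2 this, Finset.mem_univ _⟩
    · exact Finset.mem_product.2 ⟨Finset.mem_singleton.2 this, Finset.mem_univ _⟩
  · rw [Finset.card_product, Finset.card_univ]
    simp
    omega

/-- There is no seven-vertex path to begin with, and every new edge creates one that costs at most
five of the `5 * Fintype.card Q` matching edges. -/
theorem sat [Fintype Q] (hπ : ∀ m, ∃ x y, x ≠ y ∧ π x = m ∧ π y = m)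
    (ht : t + 5 ≤ 5 * Fintype.card Q) : Sat (brooms π) t := by
  refine ⟨?_, fun u v huv hadj => ?_⟩
  · rintro ⟨l, M, hF, hl, -⟩
    exact parentGraph_no_path parent_four hF.chain hF.nodup hl
  · by_cases htree : tree π u = tree π v
    · rcases le_total (depth u) (depth v) with hd | hd
      · exact hasForest_of_tree_eq hπ ht htree huv hadj hd
      · rw [edge_comm]
        exact hasForest_of_tree_eq hπ ht htree.symm huv.symm (fun h => hadj h.symm) hd
    · have hπ' : ∀ m, ∃ x, π x = m := fun m => (hπ m).imp fun x ⟨_, h⟩ => h.2.1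
      obtain ⟨⟨p, m, hp, hpn, hpl, hpt, hpw⟩, -⟩ := exists_paths hπ' u
      obtain ⟨-, ⟨q, m₁, m₂, hq, hqn, hql, hqt, hqw⟩⟩ := exists_paths hπ' v
      refine hasForest_of_within (l := (u :: p).reverse ++ v :: q) hπ' le_sup_left
        (isChain_join ?_ (hp.imp fun _ _ h => Or.inl h) (hq.imp fun _ _ h => Or.inl h)) ?_ ?_
        {m, m₁, m₂} {tree π u, tree π v} (fun w hw => ?_) ?_
      · simp [sup_adj, edge_adj, huv]
      · rw [List.nodup_append]
        refine ⟨List.nodup_reverse.2 hpn, hqn, fun a ha b hb hab => htree ?_⟩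
        rw [← hpt a (List.mem_reverse.1 ha), hab, hqt b hb]
      · simp
        omega
      · rcases List.mem_append.1 hw with hw | hw
        · exact (hpw w (List.mem_reverse.1 hw)).mono (by simp) (by simp)
        · exact (hqw w hw).mono (by simp) (by simp)
      -- Three vertices in one tree and four in the other together touch at most three leaf edges
      -- and two root edges.
      · have h1 : ({m, m₁, m₂} : Finset (Q × Bool × Bool)).card ≤ 3 := Finset.card_le_three
        have h2 : ({tree π u, tree π v} : Finset Q).card ≤ 2 := Finset.card_le_two
        omega

/-- Each edge leads from a vertex to its parent, and the two roots of a tree share one edge; so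
every tree has one edge fewer than vertices. -/
lemma ncard_edgeSet_le [Fintype Q] [Fintype L] :
    (brooms π).edgeSet.ncard + Fintype.card Q ≤ 6 * Fintype.card Q + Fintype.card L := by
  have : Fintype (BroomVertex Q L) := Fintype.ofEquiv _ equivSum.symm
  have hsub : (brooms π).edgeSet ⊆ (fun i : Q => s(root i false, root i true)) '' Set.univ ∪
      (fun w : (Q × Bool × Bool) ⊕ L => s(equivSum.symm (Sum.inr w),
        parent π (equivSum.symm (Sum.inr w)))) '' Set.univ := by
    have key : ∀ u v, parent π u = v → s(u, v) ∈ (fun i : Q => s(root i false, root i true)) ''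
        Set.univ ∪ (fun w : (Q × Bool × Bool) ⊕ L => s(equivSum.symm (Sum.inr w),
          parent π (equivSum.symm (Sum.inr w)))) '' Set.univ := by
      rintro u v rfl
      rcases u with ⟨i, s⟩ | ⟨i, s, c⟩ | x
      · left
        cases s
        · exact ⟨i, trivial, rfl⟩
        · exact ⟨i, trivial, Sym2.eq_swap⟩
      · exact Or.inr ⟨Sum.inl (i, s, c), trivial, rfl⟩
      · exact Or.inr ⟨Sum.inr x, trivial, rfl⟩
    intro e he
    induction e with
    | _ u v =>
      rcases he.2 with h | h
      · exact key u v h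
      · rw [Sym2.eq_swap]
        exact key v u h
  have h1 := (Set.ncard_le_ncard hsub (Set.toFinite _)).trans (Set.ncard_union_le _ _)
  have h2 := Set.ncard_image_le (f := fun i : Q => (s(root i false, root i true) :
    Sym2 (BroomVertex Q L))) (s := Set.univ) (Set.toFinite _)
  have h3 := Set.ncard_image_le (f := fun w : (Q × Bool × Bool) ⊕ L => s(equivSum.symm (Sum.inr w),
        parent π (equivSum.symm (Sum.inr w)))) (s := Set.univ) (Set.toFinite _)
  rw [Set.ncard_univ, Nat.card_eq_fintype_card] at h2 h3
  simp only [Fintype.card_sum, Fintype.card_prod, Fintype.card_bool] at h3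
  omega

end BroomVertex

lemma hasForest_iso {G : SimpleGraph V} {G' : SimpleGraph W} (e : G ≃g G') :
    HasForest G t ↔ HasForest G' t := by
  rw [← hasForest_iff, ← hasForest_iff]
  exact ⟨fun h => h.trans e.isContained, fun h => h.trans e.symm.isContained⟩

lemma Sat.comap (h : Sat G t) (e : W ≃ V) : Sat (G.comap e) t := by
  refine ⟨fun h' => h.free ((hasForest_iso (Iso.comap e G)).1 h'), fun u v huv hadj => ?_⟩
  have := h.add (e u) (e v) (e.injective.ne huv) hadj
  rw [← hasForest_iso (Iso.comap e _)] at this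
  convert this using 1
  ext a b
  simp [edge_adj, sup_adj, comap_adj]

lemma ncard_edgeSet_iso {G : SimpleGraph V} {G' : SimpleGraph W} (e : G ≃g G') :
    G.edgeSet.ncard = G'.edgeSet.ncard := Nat.card_congr e.mapEdgeSet

theorem exists_sat_brooms {n : ℕ} (hn : 14 * t + 135 ≤ 5 * n) :
    ∃ G : SimpleGraph (Fin n), Sat G t ∧ G.edgeSet.ncard ≤ n - n / 14 := by
  obtain ⟨q, hq⟩ : ∃ q, q = n / 14 := ⟨_, rfl⟩
  have hcard : Fintype.card (Fin q × Bool × Bool) = q * 4 := by simp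
  let φ := (Fintype.equivFinOfCardEq hcard).symm
  -- Six vertices of each tree are not leaves. The remaining vertices, at least `8 * q` in number,
  -- are distributed cyclically over the `4 * q` middle vertices, so each receives at least two.
  let π : Fin (n - 6 * q) → Fin q × Bool × Bool := fun x =>
    φ ⟨x % (q * 4), Nat.mod_lt _ (by omega)⟩
  have hπ : ∀ m, ∃ x y, x ≠ y ∧ π x = m ∧ π y = m := by
    intro m
    obtain ⟨k, rfl⟩ := φ.surjective m
    have hk := k.2
    refine ⟨⟨k, by omega⟩, ⟨k + q * 4, by omega⟩, ?_, ?_, ?_⟩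
    · simp
      omega
    · simp only [π, Nat.mod_eq_of_lt hk]
    · simp only [π, Nat.add_mod_right, Nat.mod_eq_of_lt hk]
  -- From `n ≤ 14 * q + 13` follows `14 * t + 135 ≤ 70 * q + 65`, which is exactly `t + 5 ≤ 5 * q`.
  have hsat := BroomVertex.sat (t := t) hπ (by simp; omega)
  have hle := BroomVertex.ncard_edgeSet_le (π := π)
  have : Fintype (BroomVertex (Fin q) (Fin (n - 6 * q))) :=
    Fintype.ofEquiv _ BroomVertex.equivSum.symm
  have hV : Fintype.card (BroomVertex (Fin q) (Fin (n - 6 * q))) = n := by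
    rw [Fintype.card_congr BroomVertex.equivSum]
    simp
    omega
  let e : Fin n ≃ BroomVertex (Fin q) (Fin (n - 6 * q)) := (Fintype.equivFinOfCardEq hV).symm
  refine ⟨_, hsat.comap e, ?_⟩
  rw [ncard_edgeSet_iso (Iso.comap e _)]
  simp only [Fintype.card_fin] at hle
  omega

/-! ### Combining the cases -/

lemma two_le_degree [Fintype V] {v x y : V} (hx : G.Adj v x) (hy : G.Adj v y) (hxy : x ≠ y) :
    2 ≤ G.degree v := by
  rw [← card_neighborFinset_eq_degree, ← Finset.card_pair hxy]
  apply Finset.card_le_card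
  intro w hw
  rw [Finset.mem_insert, Finset.mem_singleton] at hw
  rcases hw with rfl | rfl <;> rwa [mem_neighborFinset]

lemma Sat.large_of_unique_isolated [Fintype V] (h : Sat G t) {u : V} (hu : ∀ w, ¬ G.Adj u w)
    (hiso : ∀ v, v ≠ u → ∃ w, G.Adj v w) : Fintype.card V ≤ G.edgeSet.ncard + 1 := by
  have h1 := sum_degree_eq (G := G)
  have h2 : ({u}ᶜ : Finset V).card * 2 ≤ ∑ v ∈ {u}ᶜ, G.degree v := by
    refine Finset.card_nsmul_le_sum _ _ 2 fun v hv => ?_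
    obtain ⟨x, hx⟩ := hiso v (by simpa using hv)
    obtain ⟨z, hz, hvz⟩ := h.exists_second_neighbour hu hx
    exact two_le_degree hx hvz hz.symm
  have h3 : ∑ v ∈ {u}ᶜ, G.degree v ≤ ∑ v, G.degree v :=
    Finset.sum_le_sum_of_subset (Finset.subset_univ _)
  rw [Finset.card_compl, Finset.card_singleton] at h2
  omega

/-- Without isolated vertices all degrees outside the clique are at least two, and `3 * t + 25`
edges allow at most `3 * t + 5` vertices. -/
lemma Mill.exists_isolated [Fintype V] {X : Finset V} {ζ π : V → V} (h : Mill G t X ζ π)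
    (hn : 3 * t + 5 < Fintype.card V) : ∃ v, ∀ w, ¬ G.Adj v w := by
  by_contra! hcon
  have h1 := sum_degree_eq (G := G)
  rw [h.ncard_edgeSet, ← Finset.sum_add_sum_compl X] at h1
  have h2 : X.card * 7 ≤ ∑ v ∈ X, G.degree v := by
    refine Finset.card_nsmul_le_sum _ _ 7 fun v hv => ?_
    rw [← card_neighborFinset_eq_degree]
    have : (X.erase v).card = 7 := by rw [Finset.card_erase_of_mem hv, h.card]
    rw [← this]
    apply Finset.card_le_card
    intro w hw
    rw [Finset.mem_erase] at hw
    rw [mem_neighborFinset]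
    exact h.clique v hv w hw.2 hw.1.symm
  have h3 : Xᶜ.card * 2 ≤ ∑ v ∈ Xᶜ, G.degree v := by
    refine Finset.card_nsmul_le_sum _ _ 2 fun v hv => ?_
    rw [Finset.mem_compl] at hv
    by_cases hζ : ζ v = v
    · obtain ⟨w, hw⟩ := hcon v
      obtain ⟨hwX, hwv, hne⟩ := (h.adj_center hv hζ).1 hw
      have hζw : ζ w ≠ w := by
        rw [hwv]
        exact hne.symm
      refine two_le_degree hw ((h.adj_center hv hζ).2 ⟨h.pair_notMem w hwX hζw, ?_, ?_⟩)
        (h.pair_ne w hwX hζw).symm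
      · rw [h.center_pair w hwX hζw, hwv]
      · rw [← hwv]
        exact h.pair_ne_center w hwX hζw
    · exact two_le_degree ((h.adj v hv hζ _).2 (Or.inl rfl)) ((h.adj v hv hζ _).2 (Or.inr rfl))
        (h.pair_ne_center v hv hζ).symm
  rw [Finset.card_compl, h.card] at h3
  rw [h.card] at h2
  omega

/-- The part `cK_3` alone: there are graphs of the extremal form on `n` vertices. -/
lemma exists_isK8K3FanGraph {n : ℕ} (ht : 0 < t) (hn : 3 * t + 5 ≤ n) :
    ∃ G : SimpleGraph (Fin n), IsK8K3FanGraph t G := by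
  obtain ⟨c, rfl⟩ : ∃ c, t = c + 1 := ⟨t - 1, by omega⟩
  let k : Fin 0 → ℕ := fun _ => 0
  have hc : matchingNumber (copies c (completeGraph (Fin 3)) ⊕g fanUnion k) + 1 = c + 1 := by
    have h1 := (fans_model (c := c) (k := k)).two_mul_matchingNumber
    have h2 : ((Finset.univ : Finset (Fin c)) ×ˢ ({1, 2} : Finset (Fin 3))).card =
        (leafSet ∅ (modelCenter (c := c) (k := k))).card := by
      refine Finset.card_bij (fun x _ => Sum.inl x) ?_ ?_ ?_
      · rintro ⟨i, a⟩ ha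
        simp only [Finset.mem_product, Finset.mem_univ, true_and, Finset.mem_insert,
          Finset.mem_singleton] at ha
        rcases ha with rfl | rfl <;> simp [mem_leafSet, modelCenter]
      · intro x _ y _ hxy
        simpa using hxy
      · rintro (⟨i, a⟩ | ⟨j, -⟩) ha
        · refine ⟨(i, a), ?_, rfl⟩
          simp only [mem_leafSet, modelCenter, ne_eq, Sum.inl.injEq, Prod.mk.injEq, true_and] at ha
          simp only [Finset.mem_product, Finset.mem_univ, true_and, Finset.mem_insert,
            Finset.mem_singleton]
          have key : ∀ a : Fin 3, ¬ 0 = a → a = 1 ∨ a = 2 := by decide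
          exact key a ha.2
        · exact j.elim0
    rw [Finset.card_product] at h2
    simp at h2
    omega
  have hcard : Fintype.card (ModelVertex c k (n - (3 * c + 8))) = n := by
    simp
    omega
  let e : Fin n ≃ ModelVertex c k (n - (3 * c + 8)) := (Fintype.equivFinOfCardEq hcard).symm
  exact ⟨_, c, 0, k, n - (3 * c + 8), fun j => j.elim0, hc, ⟨Iso.comap e _⟩⟩

/-- The number of isolated vertices decides. The strict inequality in the first alternative comes
from the case of exactly one: then there are at least `n - 1` edges, and `n / 14` is at least two.
-/
lemma Sat.large_cases [Fintype V] (h : Sat G t) (ht : 0 < t)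
    (hn : 14 * t + 135 ≤ 5 * Fintype.card V) :
    (Fintype.card V - Fintype.card V / 14 ≤ G.edgeSet.ncard ∧
      ((∃ v, ∀ w, ¬ G.Adj v w) → Fintype.card V - Fintype.card V / 14 < G.edgeSet.ncard)) ∨
    (3 * t + 25 ≤ G.edgeSet.ncard ∧ (G.edgeSet.ncard = 3 * t + 25 → IsK8K3FanGraph t G)) := by
  by_cases hiso : ∃ u, ∀ w, ¬ G.Adj u w
  · obtain ⟨u, hu⟩ := hiso
    by_cases h2 : ∃ u', u' ≠ u ∧ ∀ w, ¬ G.Adj u' w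
    · obtain ⟨u', hne, hu'⟩ := h2
      have := h.large_of_isolated hne hu' hu
      exact Or.inr ⟨this.1, fun he => isK8K3FanGraph_iff.2 (this.2 he)⟩
    · push Not at h2
      have := h.large_of_unique_isolated hu h2
      left
      constructor
      · omega
      · intro
        omega
  · push Not at hiso
    refine Or.inl ⟨h.large_of_no_isolated hiso hn, fun ⟨v, hv⟩ => ?_⟩
    obtain ⟨w, hw⟩ := hiso v
    exact absurd hw (hv w)

lemma isLeast_saturatedSizes {n : ℕ} (ht : 0 < t) (hn : 14 * t + 135 ≤ 5 * n) :
    IsLeast (saturatedSizes n (p7tp2 t)) (min (3 * t + 25) (n - n / 14)) := by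
  have hlow : ∀ G : SimpleGraph (Fin n), Sat G t →
      min (3 * t + 25) (n - n / 14) ≤ G.edgeSet.ncard := by
    intro G hG
    have := hG.large_cases ht (by simpa using hn)
    rw [Fintype.card_fin] at this
    rcases this with h | h
    · exact (min_le_right _ _).trans h.1
    · exact (min_le_left _ _).trans h.1
  refine ⟨?_, ?_⟩
  · rcases le_total (3 * t + 25) (n - n / 14) with hle | hle
    · obtain ⟨G, hG⟩ := exists_isK8K3FanGraph (n := n) ht (by omega)
      obtain ⟨X, ζ, π, hM⟩ := isK8K3FanGraph_iff.1 hG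
      exact ⟨G, isSaturated_iff.2 hM.sat, by rw [hM.ncard_edgeSet, min_eq_left hle]⟩
    · obtain ⟨G, hG, hc⟩ := exists_sat_brooms hn
      refine ⟨G, isSaturated_iff.2 hG, le_antisymm ?_ (hlow G hG)⟩
      rwa [min_eq_right hle]
  · rintro _ ⟨G, hG, rfl⟩
    exact hlow G (isSaturated_iff.1 hG)

lemma satNumber_eq {n : ℕ} (ht : 0 < t) (hn : 14 * t + 135 ≤ 5 * n) :
    satNumber n (p7tp2 t) = min (3 * t + 25) (n - n / 14) :=
  (isLeast_saturatedSizes ht hn).csInf_eq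

lemma mem_minSaturated_of_isK8K3FanGraph {n : ℕ} (ht : 0 < t) (hn : 14 * t + 135 ≤ 5 * n)
    (hle : 3 * t + 25 ≤ n - n / 14) {G : SimpleGraph (Fin n)} (hG : IsK8K3FanGraph t G) :
    G ∈ minSaturated n (p7tp2 t) := by
  obtain ⟨X, ζ, π, hM⟩ := isK8K3FanGraph_iff.1 hG
  exact ⟨isSaturated_iff.2 hM.sat, by rw [satNumber_eq ht hn, min_eq_left hle, hM.ncard_edgeSet]⟩

lemma mem_minSaturated_iff_of_lt {n : ℕ} (ht : 0 < t) (hn : 14 * t + 135 ≤ 5 * n)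
    (hlt : 3 * t + 25 < n - n / 14) (G : SimpleGraph (Fin n)) :
    G ∈ minSaturated n (p7tp2 t) ↔ IsK8K3FanGraph t G := by
  refine ⟨fun ⟨hG, hc⟩ => ?_, mem_minSaturated_of_isK8K3FanGraph ht hn hlt.le⟩
  rw [satNumber_eq ht hn, min_eq_left hlt.le] at hc
  have := (isSaturated_iff.1 hG).large_cases ht (by simpa using hn)
  rw [Fintype.card_fin] at this
  rcases this with h | h
  · omega
  · exact h.2 hc

lemma mem_minSaturated_iff_of_eq {n : ℕ} (ht : 0 < t) (hn : 14 * t + 135 ≤ 5 * n)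
    (heq : 3 * t + 25 = n - n / 14) (G : SimpleGraph (Fin n)) :
    (G ∈ minSaturated n (p7tp2 t) ∧ ∃ v, ∀ w, ¬ G.Adj v w) ↔ IsK8K3FanGraph t G := by
  refine ⟨fun ⟨⟨hG, hc⟩, hiso⟩ => ?_,
    fun hG => ⟨mem_minSaturated_of_isK8K3FanGraph ht hn heq.le hG, ?_⟩⟩
  · rw [satNumber_eq ht hn, min_eq_left heq.le] at hc
    have := (isSaturated_iff.1 hG).large_cases ht (by simpa using hn)
    rw [Fintype.card_fin] at this
    rcases this with h | h
    · have := h.2 hiso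
      omega
    · exact h.2 hc
  · obtain ⟨X, ζ, π, hM⟩ := isK8K3FanGraph_iff.1 hG
    exact hM.exists_isolated (by rw [Fintype.card_fin]; omega)

end LinearForestSat

open LinearForestSat in
theorem theorem1p1 (n t : ℕ) (hn : 0 < n) (ht : 0 < t)
    (hnt : (14 / 5 : ℝ) * t + 27 ≤ n) :
    ((saturatedSizes n (p7tp2 t)).Nonempty ∧
      satNumber n (p7tp2 t) = min (3 * t + 25) (n - n / 14)) ∧
    ((14 / 13 : ℝ) * (3 * t + 25) < n →
      ∀ G : SimpleGraph (Fin n), G ∈ minSaturated n (p7tp2 t) ↔ IsK8K3FanGraph t G) ∧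
    ((14 / 13 : ℝ) * (3 * t + 25) = n →
      ∀ G : SimpleGraph (Fin n),
        (G ∈ minSaturated n (p7tp2 t) ∧ ∃ v, ∀ w, ¬ G.Adj v w) ↔ IsK8K3FanGraph t G) := by
  have h1 : 14 * t + 135 ≤ 5 * n := by
    have : (14 * t + 135 : ℝ) ≤ 5 * n := by linarith
    exact_mod_cast this
  refine ⟨⟨⟨_, (isLeast_saturatedSizes ht h1).1⟩, satNumber_eq ht h1⟩, fun h => ?_, fun h => ?_⟩
  -- As `n - n / 14` is `13 * n / 14` rounded up, this is equivalent to `3 * t + 25 < n - n / 14`.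
  · have h2 : 14 * (3 * t + 25) < 13 * n := by
      have : (14 * (3 * t + 25) : ℝ) < 13 * n := by linarith
      exact_mod_cast this
    exact mem_minSaturated_iff_of_lt ht h1 (by omega)
  -- Equality makes `n` divisible by 14, so no rounding occurs and both expressions in the minimum
  -- agree.
  · have h2 : 14 * (3 * t + 25) = 13 * n := by
      have : (14 * (3 * t + 25) : ℝ) = 13 * n := by linarith
      exact_mod_cast this
    exact mem_minSaturated_iff_of_eq ht h1 (by omega)
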